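/- Let $k$ be an algebraically closed field and let $\mathcal{E}$ be a connected, skeletal finite EI category (a small category with finitely many morphisms in which every endomorphism is an isomorphism) which is free, i.e. isomorphic to the category generated by a finite EI quiver: a finite acyclic quiver with a finite group $f(v)$ at each vertex $v$ and a finite $(f(w),f(v))$-biset $g(\alpha)$ at each arrow $\alpha: v\to w$; in the generated category the objects are the vertices, and the morphisms from $v$ to $w$ are the disjoint union, over all directed paths $\alpha_n\cdots\alpha_1$ from $v$ to $w$, of the biset products $g(\alpha_n)\times_{f(v_{n-1})}\cdots\times_{f(v_1)}g(\alpha_1)$ (for the trivial path at $v$: the group $f(v)$), composition being induced by concatenation. Let $k\mathcal{E}$ be the category algebra (with basis the morphisms, and product $\beta\cdot\alpha$ equal to the composite $\beta\alpha$, first $\alpha$, then $\beta$, if it is defined, and $0$ otherwise), graded by the length grading: isomorphisms have degree $0$, and a composite of $n\geqslant 1$ unfactorizable morphisms has degree $n$ (a non-isomorphism is unfactorizable if in each factorization of it into two morphisms one of the two is an isomorphism). View $k\mathcal{E}_0$ as the left $k\mathcal{E}$-module $k\mathcal{E}/\bigoplus_{i\geqslant 1}k\mathcal{E}_i$. Then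 the following are equivalent: 1. $\operatorname{pd}_{k\mathcal{E}} k\mathcal{E}_0\leqslant 1$; 2. $k\mathcal{E}$ is a (generalized) Koszul algebra: the module $k\mathcal{E}_0$, concentrated in degree $0$, has a graded projective resolution $\cdots\to P^1\to P^0\to k\mathcal{E}_0\to 0$ in which $P^i$ is generated in degree $i$ for every $i\geqslant 0$; 3. $\mathcal{E}$ is standardly stratified with respect to the canonical order on its objects ($x\leqslant y$ if and only if there is a morphism $x\to y$): for a set $\{e_\lambda\}_{\lambda\in\Lambda}$ of orthogonal primitive idempotents of $k\mathcal{E}$ with sum $1$ and $e_\lambda\in 1_{x_\lambda}k\mathcal{E}\,1_{x_\lambda}$ for objects $x_\lambda$, with the preorder $\lambda\preccurlyeq\mu$ if and only if $x_\lambda\leqslant x_\mu$, and with $P_\lambda=k\mathcal{E}e_\lambda$ and $S_\lambda=P_\lambda/\operatorname{rad}P_\lambda$, there are modules $\Delta_\lambda$ such that $[\Delta_\lambda:S_\mu]=0$ whenever $\mu\not\preccurlyeq\lambda$, and for every $\lambda$ there is a short exact sequence $0\to K_\lambda\to P_\lambda\to\Delta_\lambda\to 0$ in which $K_\lambda$ has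 a finite filtration with factors $\Delta_\mu$, $\mu\succ\lambda$; 4. $\operatorname{pd}_{k\mathcal{E}} k\mathcal{E}_0<\infty$. -/

import Mathlib

open CategoryTheory

universe u v w

/-! ### Finite EI quivers and the categories they generate -/

set_option linter.checkUnivs false in
/-- A finite EI quiver: a finite acyclic quiver, with a finite group `grp x` at each vertex `x` and
a finite `(grp y, grp x)`-biset at each arrow `x ⟶ y`. The right action of `grp x` is written as a
left action of `(grp x)ᵐᵒᵖ`. -/
structure FiniteEIQuiver where
  vertex : Type u
  arrow : vertex → vertex → Type v
  finite_vertex : Finite vertex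
  finite_arrow : ∀ x y, Finite (arrow x y)
  /-- the group at a vertex -/
  grp : vertex → Type v
  [group : ∀ x, Group (grp x)]
  finite_grp : ∀ x, Finite (grp x)
  /-- the biset at an arrow -/
  biset : ∀ {x y : vertex}, arrow x y → Type v
  [leftAction : ∀ {x y : vertex} (a : arrow x y), MulAction (grp y) (biset a)]
  [rightAction : ∀ {x y : vertex} (a : arrow x y), MulAction (grp x)ᵐᵒᵖ (biset a)]
  [comm : ∀ {x y : vertex} (a : arrow x y), SMulCommClass (grp y) (grp x)ᵐᵒᵖ (biset a)]
  finite_biset : ∀ {x y : vertex} (a : arrow x y), Finite (biset a)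
  /-- there is no oriented cycle: every path from a vertex to itself is trivial -/
  acyclic : ∀ (x : vertex) (p : @Quiver.Path vertex ⟨arrow⟩ x x), @Quiver.Path.length vertex ⟨arrow⟩ x x p = 0

namespace FiniteEIQuiver

variable (Q : FiniteEIQuiver.{u, v})

attribute [instance] FiniteEIQuiver.group FiniteEIQuiver.leftAction FiniteEIQuiver.rightAction
  FiniteEIQuiver.comm

instance quiver : Quiver.{v} Q.vertex := ⟨Q.arrow⟩

/-- One step of the biset product: for an arrow `a : y ⟶ z` and a left `grp y`-set `T`, the relation
on `biset a × T` generated by `(b · h, t) ∼ (b, h · t)`. -/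
def balancedRel {y z : Q.vertex} (a : y ⟶ z) (T : Type v) [MulAction (Q.grp y) T] :
    Q.biset a × T → Q.biset a × T → Prop :=
  fun s t => ∃ h : Q.grp y, s.1 = MulOpposite.op h • t.1 ∧ t.2 = h • s.2

/-- The biset product `biset a ×_{grp y} T`. -/
def BalancedProd {y z : Q.vertex} (a : y ⟶ z) (T : Type v) [MulAction (Q.grp y) T] : Type v :=
  Quot (Q.balancedRel a T)

instance {y z : Q.vertex} (a : y ⟶ z) (T : Type v) [MulAction (Q.grp y) T] :
    MulAction (Q.grp z) (Q.BalancedProd a T) where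
  smul g := Quot.map (fun s => (g • s.1, s.2)) (by
    rintro ⟨b, t⟩ ⟨b', t'⟩ ⟨h, h1, h2⟩
    refine ⟨h, ?_, h2⟩
    dsimp only at h1 ⊢
    rw [h1, smul_comm])
  one_smul := by
    rintro ⟨b, t⟩
    exact congrArg (Quot.mk _) (by simp)
  mul_smul g g' := by
    rintro ⟨b, t⟩
    exact congrArg (Quot.mk _) (by simp [mul_smul])

/-- For a path `γ = αₙ ⋯ α₁` from `x` to `y`, the left `grp y`-set
`H_γ = g(αₙ) ×_{grp} ⋯ ×_{grp} g(α₁)`; for the trivial path at `x` it is `grp x`.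
(In the recursion the last factor on the right is `grp x` itself, and
`g(α₁) ×_{grp x} grp x = g(α₁)`.) -/
def pathSet {x : Q.vertex} : ∀ {y : Q.vertex}, Quiver.Path x y → Σ T : Type v, MulAction (Q.grp y) T
  | _, .nil => ⟨Q.grp x, inferInstance⟩
  | _, .cons γ a =>
    letI := (pathSet γ).2
    ⟨Q.BalancedProd a (pathSet γ).1, inferInstance⟩

/-- The underlying set of `H_γ`. -/
def H {x y : Q.vertex} (γ : Quiver.Path x y) : Type v := (Q.pathSet γ).1

instance {x y : Q.vertex} (γ : Quiver.Path x y) : MulAction (Q.grp y) (Q.H γ) := (Q.pathSet γ).2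

/-- The class of `(b, t)` in `H_{αγ} = g(α) ×_{grp y} H_γ`. -/
def consMk {x y z : Q.vertex} {γ : Quiver.Path x y} (a : y ⟶ z) (b : Q.biset a) (t : Q.H γ) :
    Q.H (γ.cons a) :=
  Quot.mk _ (b, t)

lemma smul_consMk {x y z : Q.vertex} {γ : Quiver.Path x y} (a : y ⟶ z) (b : Q.biset a)
    (t : Q.H γ) (g : Q.grp z) : g • Q.consMk a b t = Q.consMk a (g • b) t := rfl

lemma consMk_eq {x y z : Q.vertex} {γ : Quiver.Path x y} (a : y ⟶ z) (b : Q.biset a)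
    (t : Q.H γ) (h : Q.grp y) :
    Q.consMk a (MulOpposite.op h • b) t = Q.consMk a b (h • t) :=
  Quot.sound ⟨h, rfl, rfl⟩

/-- The set of morphisms from `x` to `y`: the disjoint union of the sets `H_γ` over all paths `γ`
from `x` to `y`. (By acyclicity it is `grp x` when `x = y`.) -/
def Mor (x y : Q.vertex) : Type (max u v) := Σ γ : Quiver.Path x y, Q.H γ

/-- The left action of `grp y` on the morphisms from `x` to `y`. -/
def Mor.smul {x y : Q.vertex} (g : Q.grp y) (f : Q.Mor x y) : Q.Mor x y := ⟨f.1, g • f.2⟩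

/-- Composing a morphism with an element of the biset of an arrow. -/
def Mor.cons {x y z : Q.vertex} (a : y ⟶ z) (b : Q.biset a) (f : Q.Mor x y) : Q.Mor x z :=
  ⟨f.1.cons a, Q.consMk a b f.2⟩

lemma Mor.cons_op_smul {x y z : Q.vertex} (a : y ⟶ z) (b : Q.biset a) (h : Q.grp y)
    (f : Q.Mor x y) : Mor.cons Q a (MulOpposite.op h • b) f = Mor.cons Q a b (Mor.smul Q h f) :=
  congrArg (Sigma.mk _) (Q.consMk_eq a b f.2 h)

/-- Together with its equivariance, the map `H_{γ'} × H_γ → H_{γ' γ}` induced by juxtaposition. -/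
def compAux {x y : Q.vertex} (γ : Quiver.Path x y) (s : Q.H γ) :
    ∀ {z : Q.vertex} (γ' : Quiver.Path y z),
      {F : Q.H γ' → Q.H (γ.comp γ') // ∀ (g : Q.grp z) t, F (g • t) = g • F t}
  | _, .nil => ⟨fun h => (show Q.grp y from h) • s, fun g t => mul_smul (g : Q.grp y) (show Q.grp y from t) s⟩
  | _, .cons γ' a =>
    ⟨Quot.lift (fun p => Q.consMk a p.1 ((compAux γ s γ').1 p.2)) (by
        rintro ⟨b, t⟩ ⟨b', t'⟩ ⟨h, h1, h2⟩
        dsimp only at h1 h2 ⊢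
        have e := (compAux γ s γ').2 h t
        subst h1
        rw [Q.consMk_eq, ← e]
        exact congrArg (fun r => Q.consMk a b' ((compAux γ s γ').1 r)) h2.symm),
      fun g => by
        rintro ⟨b, t⟩
        rfl⟩

/-- Composition of morphisms, in the order of Mathlib's `≫`: first `f`, then `f'`. -/
def Mor.comp {x y z : Q.vertex} (f : Q.Mor x y) (f' : Q.Mor y z) : Q.Mor x z :=
  ⟨f.1.comp f'.1, (Q.compAux f.1 f.2 f'.1).1 f'.2⟩

/-- The identity of `x`: the neutral element of `grp x`. -/
def Mor.id (x : Q.vertex) : Q.Mor x x := ⟨.nil, (1 : Q.grp x)⟩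

lemma Mor.comp_smul {x y z : Q.vertex} (f : Q.Mor x y) (g : Q.grp z) (f' : Q.Mor y z) :
    Mor.comp Q f (Mor.smul Q g f') = Mor.smul Q g (Mor.comp Q f f') :=
  congrArg (Sigma.mk _) ((Q.compAux f.1 f.2 f'.1).2 g f'.2)

lemma Mor.comp_cons {x y z w : Q.vertex} (f : Q.Mor x y) (a : z ⟶ w) (b : Q.biset a)
    (f' : Q.Mor y z) : Mor.comp Q f (Mor.cons Q a b f') = Mor.cons Q a b (Mor.comp Q f f') := rfl

lemma Mor.comp_nil {x y : Q.vertex} (f : Q.Mor x y) (g : Q.grp y) :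
    Mor.comp Q f ⟨.nil, g⟩ = Mor.smul Q g f := rfl

lemma Mor.induction {x : Q.vertex} {motive : ∀ {y : Q.vertex}, Q.Mor x y → Prop}
    (nil : ∀ g : Q.grp x, motive (y := x) ⟨.nil, g⟩)
    (cons : ∀ {y z : Q.vertex} (a : y ⟶ z) (b : Q.biset a) (f : Q.Mor x y), motive f →
      motive (Mor.cons Q a b f)) {y : Q.vertex} (f : Q.Mor x y) : motive f := by
  obtain ⟨γ, t⟩ := f
  induction γ with
  | nil => exact nil t
  | cons γ a ih =>
    obtain ⟨b, t⟩ := t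
    exact cons a b ⟨γ, t⟩ (ih t)

lemma Mor.id_comp' {x y : Q.vertex} (f : Q.Mor x y) : Mor.comp Q (Mor.id Q x) f = f :=
  Mor.induction Q (motive := fun f => Mor.comp Q (Mor.id Q x) f = f)
    (fun g => congrArg (Sigma.mk (Quiver.Path.nil (a := x))) (mul_one g))
    (fun a b _ ih => congrArg (Mor.cons Q a b) ih) f

lemma Mor.comp_id' {x y : Q.vertex} (f : Q.Mor x y) : Mor.comp Q f (Mor.id Q y) = f :=
  congrArg (Sigma.mk f.1) (one_smul (Q.grp y) f.2)

lemma Mor.assoc' {x y z w : Q.vertex} (f : Q.Mor x y) (f' : Q.Mor y z) (f'' : Q.Mor z w) :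
    Mor.comp Q (Mor.comp Q f f') f'' = Mor.comp Q f (Mor.comp Q f' f'') :=
  Mor.induction Q
    (motive := fun f'' => Mor.comp Q (Mor.comp Q f f') f'' = Mor.comp Q f (Mor.comp Q f' f''))
    (fun g => (Mor.comp_smul Q f g f').symm)
    (fun a b _ ih => congrArg (Mor.cons Q a b) ih) f''

/-- The objects of the category generated by a finite EI quiver are its vertices. -/
def Generated : Type u := Q.vertex

/-- The category generated by a finite EI quiver. -/
instance : Category.{max u v} Q.Generated where
  Hom x y := Q.Mor x y
  id x := Mor.id Q x
  comp f f' := Mor.comp Q f f'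
  id_comp f := Mor.id_comp' Q f
  comp_id f := Mor.comp_id' Q f
  assoc f f' f'' := Mor.assoc' Q f f' f''

end FiniteEIQuiver

/-! ### Finite free EI categories and the length grading -/

/-- Isomorphism of categories: a fully faithful functor that is bijective on objects. -/
def AreIsomorphicCategories.{u₁, v₁, u₂, v₂} (C : Type u₁) [Category.{v₁} C] (D : Type u₂)
    [Category.{v₂} D] : Prop :=
  ∃ F : C ⥤ D, F.Full ∧ F.Faithful ∧ Function.Bijective F.obj

/-- A connected skeletal finite EI category: finitely many morphisms (hence objects), and every
endomorphism is an isomorphism. -/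
structure IsFiniteEI (E : Type u) [Category.{v} E] : Prop where
  finite_obj : Finite E
  finite_hom : ∀ x y : E, Finite (x ⟶ y)
  isIso : ∀ (x : E) (f : x ⟶ x), IsIso f
  skeletal : Skeletal E
  connected : IsConnected E

/-- A finite EI category is free if it is isomorphic to the one generated by a finite EI quiver. -/
structure IsFiniteFreeEI (E : Type u) [Category.{v} E] : Prop extends IsFiniteEI E where
  free : ∃ Q : FiniteEIQuiver.{u, v}, AreIsomorphicCategories E Q.Generated

namespace CategoryTheory

/-- A morphism is unfactorizable if it is not an isomorphism, and in each factorization of it one of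
the two factors is an isomorphism. -/
def IsUnfactorizable {E : Type u} [Category.{v} E] {x z : E} (α : x ⟶ z) : Prop :=
  ¬ IsIso α ∧ ∀ (y : E) (β : x ⟶ y) (γ : y ⟶ z), β ≫ γ = α → IsIso β ∨ IsIso γ

/-- `HasLength α n`: `n = 0` and `α` is an isomorphism, or `n ≥ 1` and `α` is a composite of `n`
unfactorizable morphisms. -/
inductive HasLength {E : Type u} [Category.{v} E] : ∀ {x y : E}, (x ⟶ y) → ℕ → Prop
  | iso {x y : E} (α : x ⟶ y) : IsIso α → HasLength α 0
  | unfactorizable {x y : E} (α : x ⟶ y) : IsUnfactorizable α → HasLength α 1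
  | comp {x y z : E} (α : x ⟶ y) (β : y ⟶ z) (n : ℕ) : IsUnfactorizable α →
      HasLength β (n + 1) → HasLength (α ≫ β) (n + 2)

/-! ### The category algebra -/

variable (k : Type w) [Field k] (E : Type u) [Category.{v} E]

/-- The underlying vector space of the category algebra `kE`: its basis is the set of all morphisms
of `E`. -/
def CategoryAlgebra : Type (max u v w) := (Σ x y : E, x ⟶ y) →₀ k

namespace CategoryAlgebra

noncomputable instance : AddCommGroup (CategoryAlgebra k E) :=
  inferInstanceAs (AddCommGroup ((Σ x y : E, x ⟶ y) →₀ k))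

noncomputable instance : Module k (CategoryAlgebra k E) :=
  inferInstanceAs (Module k ((Σ x y : E, x ⟶ y) →₀ k))

/-- The basis of `kE` formed by the morphisms of `E`. -/
noncomputable def basis : Module.Basis (Σ x y : E, x ⟶ y) k (CategoryAlgebra k E) :=
  ⟨LinearEquiv.refl k ((Σ x y : E, x ⟶ y) →₀ k)⟩

variable {E}

/-- The basis element given by a morphism. -/
noncomputable def of {x y : E} (α : x ⟶ y) : CategoryAlgebra k E := basis k E ⟨x, y, α⟩

open Classical in
/-- The product of two basis elements: `β · α` is the composite `βα` (first `α`, then `β`) if the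
target of `α` is the source of `β`, and `0` otherwise. -/
noncomputable def ofMul (β α : Σ x y : E, x ⟶ y) : CategoryAlgebra k E :=
  if h : α.2.1 = β.1 then of k (α.2.2 ≫ eqToHom h ≫ β.2.2) else 0

/-- The multiplication of the category algebra: the bilinear extension of composition. -/
noncomputable def mulHom :
    CategoryAlgebra k E →ₗ[k] CategoryAlgebra k E →ₗ[k] CategoryAlgebra k E :=
  (basis k E).constr k fun β => (basis k E).constr k fun α => ofMul k β α

noncomputable instance : Mul (CategoryAlgebra k E) := ⟨fun b a => mulHom k b a⟩

/-- The unit: the sum of all identities. -/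
noncomputable instance [Finite E] : One (CategoryAlgebra k E) :=
  letI := Fintype.ofFinite E
  ⟨∑ x : E, of k (𝟙 x)⟩

lemma mul_def (a b : CategoryAlgebra k E) : a * b = mulHom k a b := rfl

lemma one_def [Finite E] [Fintype E] : (1 : CategoryAlgebra k E) = ∑ x : E, of k (𝟙 x) := by
  change (∑ x ∈ @Finset.univ E (Fintype.ofFinite E), of k (𝟙 x)) = _
  congr!

lemma induction {motive : CategoryAlgebra k E → Prop} (zero : motive 0)
    (add : ∀ a b, motive a → motive b → motive (a + b))
    (smul_of : ∀ (c : k) {x y : E} (α : x ⟶ y), motive (c • of k α)) (a : CategoryAlgebra k E) :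
    motive a := by
  rw [← (basis k E).linearCombination_repr a, Finsupp.linearCombination_apply]
  exact Finset.sum_induction _ motive add zero fun i _ => smul_of _ i.2.2

lemma of_mul_of {x y y' z : E} (β : y' ⟶ z) (α : x ⟶ y) :
    of k β * of k α = ofMul k ⟨y', z, β⟩ ⟨x, y, α⟩ := by
  simp only [mul_def, mulHom, of, Module.Basis.constr_basis]

lemma of_mul_of_comp {x y z : E} (β : y ⟶ z) (α : x ⟶ y) :
    of k β * of k α = of k (α ≫ β) := by
  rw [of_mul_of, ofMul, dif_pos rfl]; simp

lemma of_mul_of_ne {x y y' z : E} (β : y' ⟶ z) (α : x ⟶ y) (h : y ≠ y') :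
    of k β * of k α = 0 := by
  rw [of_mul_of, ofMul, dif_neg h]

noncomputable instance : NonUnitalNonAssocRing (CategoryAlgebra k E) where
  left_distrib a b c := map_add (mulHom k a) b c
  right_distrib a b c := by simp [mul_def]
  zero_mul a := by simp [mul_def]
  mul_zero a := by simp [mul_def]

lemma smul_mul' (c : k) (a b : CategoryAlgebra k E) : (c • a) * b = c • (a * b) := by
  simp [mul_def]

lemma mul_smul' (c : k) (a b : CategoryAlgebra k E) : a * (c • b) = c • (a * b) := by
  simp [mul_def]

lemma assoc' (a b c : CategoryAlgebra k E) : a * b * c = a * (b * c) := by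
  induction a using induction with
  | zero => simp
  | add a a' h h' => simp [add_mul, h, h']
  | smul_of s α =>
  induction b using induction with
  | zero => simp
  | add b b' h h' => simp [add_mul, mul_add, h, h']
  | smul_of t β =>
  induction c using induction with
  | zero => simp
  | add c c' h h' => simp [mul_add, h, h']
  | @smul_of r x y γ =>
  rename_i x₁ y₁ x₂ y₂
  simp only [smul_mul', mul_smul']
  congr 3
  by_cases h : y = x₂
  · subst h
    by_cases h' : y₂ = x₁
    · subst h'
      simp [of_mul_of_comp]
    · simp [of_mul_of_comp, of_mul_of_ne _ _ _ h']
  · by_cases h' : y₂ = x₁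
    · subst h'
      simp [of_mul_of_comp, of_mul_of_ne _ _ _ h]
    · simp [of_mul_of_ne _ _ _ h, of_mul_of_ne _ _ _ h']

noncomputable instance [Finite E] : Ring (CategoryAlgebra k E) where
  mul_assoc := assoc' k
  one_mul a := by
    have := Fintype.ofFinite E
    rw [one_def]
    induction a using induction with
    | zero => simp
    | add a b h h' => rw [mul_add, h, h']
    | @smul_of c x y α =>
      rw [mul_smul', Finset.sum_mul, Finset.sum_eq_single y]
      · simp [of_mul_of_comp]
      · intro z _ hz
        exact of_mul_of_ne _ _ _ hz.symm
      · simp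
  mul_one a := by
    have := Fintype.ofFinite E
    rw [one_def]
    induction a using induction with
    | zero => simp
    | add a b h h' => rw [add_mul, h, h']
    | @smul_of c x y α =>
      rw [smul_mul', Finset.mul_sum, Finset.sum_eq_single x]
      · simp [of_mul_of_comp]
      · intro z _ hz
        exact of_mul_of_ne _ _ _ hz
      · simp
  neg_add_cancel := neg_add_cancel
  sub_eq_add_neg := sub_eq_add_neg
  zsmul := fun n a => n • a
  zsmul_zero' := SubNegMonoid.zsmul_zero'
  zsmul_succ' := SubNegMonoid.zsmul_succ'
  zsmul_neg' := SubNegMonoid.zsmul_neg'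

noncomputable instance [Finite E] : Algebra k (CategoryAlgebra k E) :=
  Algebra.ofModule (smul_mul' k) (mul_smul' k)

variable (E)

/-- The length grading: `kE_n` is spanned by the morphisms of length `n`. -/
noncomputable def lengthGrading (n : ℕ) : Submodule k (CategoryAlgebra k E) :=
  Submodule.span k {a | ∃ (x y : E) (α : x ⟶ y), HasLength α n ∧ a = of k α}

end CategoryAlgebra

end CategoryTheory

/-! ### Generalized Koszul algebras -/

section Koszul

variable {k : Type u} [Field k] {A : Type w} [Ring A] [Algebra k A] (𝒜 : ℕ → Submodule k A)

/-- The left ideal `J` generated by the components of positive degree (for a grading, `J` is the sum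
of these components, a two-sided ideal). -/
def positivePart : Ideal A := Ideal.span (⋃ i : ℕ, (𝒜 (i + 1) : Set A))

/-- `A_0` viewed as a left `A`-module: the quotient `A / J`, on which `J` acts as zero. -/
abbrev DegreeZeroModule : Type w := A ⧸ positivePart 𝒜

/-- `ℳ` makes `M` a graded `A`-module: `M` is the direct sum of the `ℳ i`, `i ∈ ℤ`, and
`A_i ℳ_j ⊆ ℳ_{i + j}`. -/
structure IsGradedModule {M : Type w} [AddCommGroup M] [Module A M] (ℳ : ℤ → AddSubgroup M) :
    Prop where
  isInternal : DirectSum.IsInternal ℳ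
  smul_mem : ∀ (i : ℕ) (j : ℤ) (a : A) (m : M), a ∈ 𝒜 i → m ∈ ℳ j → a • m ∈ ℳ (i + j)

/-- `M` is generated in degree `s`: `M = A · M_s`. -/
def GeneratedInDegree (A : Type w) [Ring A] {M : Type w} [AddCommGroup M] [Module A M]
    (ℳ : ℤ → AddSubgroup M) (s : ℤ) : Prop :=
  Submodule.span A (ℳ s : Set M) = ⊤

/-- A graded module generated in degree `0` is a (generalized) Koszul module if it has a graded
projective resolution `⋯ → P 1 → P 0 → M → 0` such that `P n` is generated in degree `n`. -/
structure IsKoszulModule {M : Type w} [AddCommGroup M] [Module A M] (ℳ : ℤ → AddSubgroup M) :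
    Prop where
  graded : IsGradedModule 𝒜 ℳ
  generated : GeneratedInDegree A ℳ 0
  resolution : ∃ (P : ℕ → ModuleCat.{w} A) (𝒬 : ∀ n, ℤ → AddSubgroup (P n))
    (d : ∀ n, P (n + 1) →ₗ[A] P n) (ε : P 0 →ₗ[A] M),
    (∀ n, Module.Projective A (P n)) ∧
    (∀ n, IsGradedModule 𝒜 (𝒬 n)) ∧
    (∀ n, GeneratedInDegree A (𝒬 n) n) ∧
    (∀ n i, ∀ p ∈ 𝒬 (n + 1) i, d n p ∈ 𝒬 n i) ∧
    (∀ i, ∀ p ∈ 𝒬 0 i, ε p ∈ ℳ i) ∧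
    (∀ n, Function.Exact (d (n + 1)) (d n)) ∧
    Function.Exact (d 0) ε ∧
    Function.Surjective ε

/-- The grading of a module concentrated in degree `0`. -/
def concentratedInDegreeZero (M : Type w) [AddCommGroup M] (i : ℤ) : AddSubgroup M :=
  if i = 0 then ⊤ else ⊥

/-- `A` is a (generalized) Koszul algebra if `A_0`, as a graded `A`-module concentrated in degree
`0`, is a Koszul module. -/
def IsKoszulAlgebra : Prop :=
  IsKoszulModule 𝒜 (concentratedInDegreeZero (DegreeZeroModule 𝒜))

end Koszul

/-! ### Standardly stratified algebras -/

section Stratified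

variable {A : Type w} [Ring A]

/-- A primitive idempotent: a nonzero idempotent that is not the sum of two nonzero orthogonal
idempotents. -/
def IsPrimitiveIdempotent (e : A) : Prop :=
  e ≠ 0 ∧ IsIdempotentElem e ∧ ∀ f g : A, IsIdempotentElem f → IsIdempotentElem g →
    f * g = 0 → g * f = 0 → f + g = e → f = 0 ∨ g = 0

/-- The projective module `P = A e`. -/
abbrev idempotentProjective (e : A) : Submodule A A := Submodule.span A {e}

/-- The module `S = P / rad P`, for `P = A e`; it is simple if `e` is primitive and `A` is a
finite-dimensional algebra. -/
abbrev idempotentSimple (e : A) : Type w :=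
  idempotentProjective e ⧸ Module.jacobson A (idempotentProjective e)

/-- The simple module `S` is a composition factor of `M`, i.e. `[M : S] ≠ 0`: there are submodules
`N ≤ N'` of `M` with `N' / N ≅ S`. -/
def IsCompositionFactor (S M : Type w) [AddCommGroup S] [Module A S] [AddCommGroup M]
    [Module A M] : Prop :=
  ∃ N N' : Submodule A M, N ≤ N' ∧ Nonempty ((N' ⧸ N.submoduleOf N') ≃ₗ[A] S)

/-- `K` has a finite filtration all of whose factors are isomorphic to modules `Δ μ` with `p μ`. -/
def HasFiltration {Λ : Type*} (Δ : Λ → ModuleCat.{w} A) (p : Λ → Prop) (K : Type w)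
    [AddCommGroup K] [Module A K] : Prop :=
  ∃ (n : ℕ) (F : ℕ → Submodule A K), F 0 = ⊥ ∧ F n = ⊤ ∧
    ∀ i < n, F i ≤ F (i + 1) ∧
      ∃ μ, p μ ∧ Nonempty ((F (i + 1) ⧸ (F i).submoduleOf (F (i + 1))) ≃ₗ[A] Δ μ)

/-- `A` is standardly stratified with respect to the preorder `le` on the index set `Λ` of the
primitive idempotents `e λ`: there are modules `Δ λ` such that the composition factors `S μ` of
`Δ λ` satisfy `μ ≼ λ`, and such that there is a short exact sequence `0 → K λ → P λ → Δ λ → 0`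
with `K λ` filtered by modules `Δ μ` with `μ ≻ λ`. -/
def IsStandardlyStratifiedFor {Λ : Type*} (e : Λ → A) (le : Λ → Λ → Prop) : Prop :=
  ∃ Δ : Λ → ModuleCat.{w} A,
    (∀ l m, ¬ le m l → ¬ IsCompositionFactor (A := A) (idempotentSimple (e m)) (Δ l)) ∧
    ∀ l, ∃ π : idempotentProjective (e l) →ₗ[A] Δ l, Function.Surjective π ∧
      HasFiltration Δ (fun m => le l m ∧ ¬ le m l) (LinearMap.ker π)

end Stratified

namespace CategoryTheory

/-- The category `E` is standardly stratified (over `k`): for a set of orthogonal primitive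
idempotents of `kE` with sum `1`, each of them lying in `1_x (kE) 1_x` for an object `x = ob l`, the
algebra `kE` is standardly stratified with respect to the preorder induced by the canonical order on
the objects (`x ≤ y` if and only if there is a morphism from `x` to `y`). -/
def IsStandardlyStratified (k : Type w) [Field k] (E : Type u) [Category.{v} E] [Finite E] : Prop :=
  ∃ (n : ℕ) (e : Fin n → CategoryAlgebra k E) (ob : Fin n → E),
    CompleteOrthogonalIdempotents e ∧
    (∀ l, IsPrimitiveIdempotent (e l)) ∧
    (∀ l, CategoryAlgebra.of k (𝟙 (ob l)) * e l = e l ∧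
      e l * CategoryAlgebra.of k (𝟙 (ob l)) = e l) ∧
    IsStandardlyStratifiedFor e fun l m => Nonempty (ob l ⟶ ob m)

end CategoryTheory

/-! Write `J` for the span of the non-isomorphisms, so that `0 → J → kE → kE_0 → 0` is exact. All
four conditions amount to one statement about group algebras: for each object `y`, the space `1_y
kE` is a projective left module over the group algebra of `Aut y`. The characteristic may divide the
group orders, so projectivity is expressed by Higman's criterion: the identity is a relative trace
`∑ g θ g⁻¹` of a `k`-linear map `θ`. In this form (`IsProjectiveAt`) it passes to retracts,
extensions and direct sums, and also to the quotient of a projective by a projective, because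
relative traces yield retractions as well as sections.

Freeness enters through `LengthFunction`: a non-isomorphism has a first factor of length one, unique
up to an automorphism (`Mor.first_unique`). Hence `J` is `kE ⊗ kE_1` over `kE_0`. If `kE_1` is
projective over `kE_0`, which follows from the projectivity of all `1_y kE`, then `J` is projective
over `kE` (`projective_positivePart`). This gives projective dimension at most one, and `J → kE` is
then a resolution generated in the right degrees (`isKoszulAlgebra`).

Conversely, a Koszul resolution determines `kE_1` through the degree one part of `P 1`, because `P
2` has nothing in degree one; projectivity of `P 1` then makes `kE_1` projective over `kE_0`
(`degreeOneProjective_of_presentation`).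

If `kE_0` has finite projective dimension, the columns `1_y kE 1_x` are treated by induction from
the top of the object order. The module `J 1_x` lives strictly above `x`, so it is resolved by
projectives whose components at `y` are already known to be projective over the group algebra, and
the quotient property carries projectivity along the resolution
(`isColumnProjectiveAt_of_hasProjectiveDimensionLT`).

For stratification, the conditions on composition factors force `Δ_λ` to live at the single object
`x_λ`, where it agrees with `P_λ` and is therefore projective; the filtrations spread this to all of
`kE` (`isProjectiveAt_of_isStandardlyStratified`). In the other direction `Δ_λ = kE_0 e_λ` works: a
module with projective components has a projective component at a maximal object of its support, and
copies of the `Δ_λ` can be split off there one at a time (`hasFiltration_of_isProjectiveAt`). -/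

set_option linter.unusedSectionVars false

/-! ### Unique factorization in the category generated by an EI quiver -/

namespace FiniteEIQuiver

variable (Q : FiniteEIQuiver.{u, v})

/-- The relation is the orbit relation of a group action, hence already an equivalence, and passing
to the quotient identifies nothing more. -/
lemma balancedRel_of_mk_eq {y z : Q.vertex} (a : y ⟶ z) (T : Type v) [MulAction (Q.grp y) T]
    {s t : Q.biset a × T} (h : Quot.mk (Q.balancedRel a T) s = Quot.mk _ t) :
    Q.balancedRel a T s t := by
  have heq : Equivalence (Q.balancedRel a T) := by
    refine ⟨fun s => ⟨1, by simp, by simp⟩, ?_, ?_⟩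
    · rintro s t ⟨h, h1, h2⟩
      exact ⟨h⁻¹, by simp [h1, ← mul_smul], by simp [h2]⟩
    · rintro r s t ⟨h, h1, h2⟩ ⟨h', h1', h2'⟩
      refine ⟨h' * h, ?_, ?_⟩
      · rw [h1, h1', ← mul_smul, ← MulOpposite.op_mul]
      · rw [h2', h2, mul_smul]
  exact (Quot.eqvGen_exact h).rec (fun _ _ h => h) (fun _ => heq.refl _)
    (fun _ _ _ h => heq.symm h) (fun _ _ _ _ _ h h' => heq.trans h h')

/-- The only ambiguity in splitting off the last arrow is a group element moved across the balanced
product. The sigma type records that the intermediate vertices and arrows agree as well. -/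
lemma Mor.cons_inj {x y y' z : Q.vertex} {a : y ⟶ z} {b : Q.biset a} {f : Q.Mor x y}
    {a' : y' ⟶ z} {b' : Q.biset a'} {f' : Q.Mor x y'}
    (h : Mor.cons Q a b f = Mor.cons Q a' b' f') :
    ∃ g : Q.grp y', (⟨y, a, b, f⟩ : Σ y : Q.vertex, Σ a : y ⟶ z, Q.biset a × Q.Mor x y) =
      ⟨y', a', MulOpposite.op g • b', Mor.smul Q g⁻¹ f'⟩ := by
  obtain ⟨γ, t⟩ := f
  obtain ⟨γ', t'⟩ := f'
  obtain ⟨h1, h2⟩ := Sigma.mk.inj h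
  cases h1
  obtain ⟨g, h3, h4⟩ := Q.balancedRel_of_mk_eq a (Q.H γ) (eq_of_heq h2)
  change b = MulOpposite.op g • b' at h3
  change t' = g • t at h4
  refine ⟨g, ?_⟩
  subst h3 h4
  have : Mor.smul Q g⁻¹ (⟨γ, g • t⟩ : Q.Mor x y) = ⟨γ, t⟩ :=
    congrArg (Sigma.mk γ) (inv_smul_smul g t)
  rw [this]

/-- An element of the group at `x`, as an endomorphism of `x`. -/
def Mor.ofGrp {x : Q.vertex} (g : Q.grp x) : Q.Mor x x := ⟨.nil, g⟩

lemma Mor.smul_ofGrp {x : Q.vertex} (g h : Q.grp x) :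
    Mor.smul Q g (Mor.ofGrp Q h) = Mor.ofGrp Q (g * h) := rfl

lemma Mor.comp_ofGrp {x y : Q.vertex} (f : Q.Mor x y) (g : Q.grp y) :
    Mor.comp Q f (Mor.ofGrp Q g) = Mor.smul Q g f := rfl

lemma Mor.eq_ofGrp_or_cons {x y : Q.vertex} (f : Q.Mor x y) :
    (∃ g, (⟨y, f⟩ : Σ y, Q.Mor x y) = ⟨x, Mor.ofGrp Q g⟩) ∨
      ∃ (z : Q.vertex) (a : z ⟶ y) (b : Q.biset a) (f' : Q.Mor x z), f = Mor.cons Q a b f' :=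
  Mor.induction Q (motive := fun {y} f => (∃ g, (⟨y, f⟩ : Σ y, Q.Mor x y) = ⟨x, Mor.ofGrp Q g⟩) ∨
      ∃ (z : Q.vertex) (a : z ⟶ y) (b : Q.biset a) (f' : Q.Mor x z), f = Mor.cons Q a b f')
    (fun g => .inl ⟨g, rfl⟩) (fun a b f _ => .inr ⟨_, a, b, f, rfl⟩) f

/-- The number of arrows in the path underlying a morphism. -/
def Mor.len {x y : Q.vertex} (f : Q.Mor x y) : ℕ := f.1.length

lemma Mor.len_cons {x y z : Q.vertex} (a : y ⟶ z) (b : Q.biset a) (f : Q.Mor x y) :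
    Mor.len Q (Mor.cons Q a b f) = Mor.len Q f + 1 := rfl

lemma Mor.len_ofGrp {x : Q.vertex} (g : Q.grp x) : Mor.len Q (Mor.ofGrp Q g) = 0 := rfl

lemma Mor.len_comp {x y z : Q.vertex} (f : Q.Mor x y) (f' : Q.Mor y z) :
    Mor.len Q (Mor.comp Q f f') = Mor.len Q f + Mor.len Q f' :=
  Quiver.Path.length_comp _ _

lemma Mor.smul_smul' {x y : Q.vertex} (g g' : Q.grp y) (f : Q.Mor x y) :
    Mor.smul Q g (Mor.smul Q g' f) = Mor.smul Q (g * g') f :=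
  congrArg (Sigma.mk f.1) (mul_smul g g' f.2).symm

lemma Mor.one_smul' {x y : Q.vertex} (f : Q.Mor x y) : Mor.smul Q 1 f = f :=
  congrArg (Sigma.mk f.1) (one_smul (Q.grp y) f.2)

lemma Mor.exists_first {x z : Q.vertex} (f : Q.Mor x z) : ∀ n, Mor.len Q f = n + 1 →
    ∃ (y : Q.vertex) (p : Q.Mor x y) (q : Q.Mor y z), Mor.len Q p = 1 ∧ Mor.len Q q = n ∧
      Mor.comp Q p q = f :=
  Mor.induction Q (motive := fun {z} f => ∀ n, Mor.len Q f = n + 1 →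
    ∃ (y : Q.vertex) (p : Q.Mor x y) (q : Q.Mor y z), Mor.len Q p = 1 ∧ Mor.len Q q = n ∧
      Mor.comp Q p q = f)
    (fun g n h => by cases h)
    (fun {y z} a b f ih n h => by
      rw [Mor.len_cons] at h
      obtain rfl | ⟨n, rfl⟩ : n = 0 ∨ ∃ m, n = m + 1 := by cases n <;> simp
      · exact ⟨z, Mor.cons Q a b f, Mor.id Q z, h, rfl, Mor.comp_id' Q _⟩
      · obtain ⟨y', p, q, hp, hq, rfl⟩ := ih n (by omega)
        exact ⟨y', p, Mor.cons Q a b q, hp, by rw [Mor.len_cons, hq], rfl⟩) f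

/-- This is where freeness is used. Morphisms are built by adding arrows at the target, so the
induction strips last arrows from both sides until only the first factors remain. -/
lemma Mor.first_unique {x y z : Q.vertex} (p : Q.Mor x y) (hp : Mor.len Q p = 1) (q : Q.Mor y z) :
    ∀ {y' : Q.vertex} (p' : Q.Mor x y') (q' : Q.Mor y' z), Mor.len Q p' = 1 →
      Mor.comp Q p q = Mor.comp Q p' q' →
      ∃ h : Q.Mor y y', p' = Mor.comp Q p h ∧ q = Mor.comp Q h q' :=
  Mor.induction Q (motive := fun {z} q => ∀ {y' : Q.vertex} (p' : Q.Mor x y') (q' : Q.Mor y' z),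
      Mor.len Q p' = 1 → Mor.comp Q p q = Mor.comp Q p' q' →
      ∃ h : Q.Mor y y', p' = Mor.comp Q p h ∧ q = Mor.comp Q h q')
    (fun g y' p' q' hp' h => by
      change Mor.comp Q p (Mor.ofGrp Q g) = _ at h
      change ∃ h : Q.Mor y y', p' = Mor.comp Q p h ∧ Mor.ofGrp Q g = Mor.comp Q h q'
      have hl := congrArg (Mor.len Q) h
      rw [Mor.len_comp, Mor.len_comp, hp, hp', Mor.len_ofGrp] at hl
      rcases Mor.eq_ofGrp_or_cons Q q' with ⟨t, ht⟩ | ⟨w, a, b, f, rfl⟩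
      · cases ht
        rw [Mor.comp_ofGrp, Mor.comp_ofGrp] at h
        -- Both second factors are group elements, so the equation reads `g • p = t • p'` and forces
        -- `p' = (t⁻¹ g) • p`.
        refine ⟨Mor.ofGrp Q (t⁻¹ * g), ?_, ?_⟩
        · rw [Mor.comp_ofGrp, ← Mor.smul_smul', h, Mor.smul_smul', inv_mul_cancel, Mor.one_smul']
        · rw [Mor.comp_ofGrp, Mor.smul_ofGrp, mul_inv_cancel_left]
      · rw [Mor.len_cons] at hl
        omega)
    (fun {y₁ z} a b q ih y' p' q' hp' h => by
      have hl := congrArg (Mor.len Q) h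
      rw [Mor.len_comp, Mor.len_comp, hp, hp', Mor.len_cons] at hl
      rcases Mor.eq_ofGrp_or_cons Q q' with ⟨t, ht⟩ | ⟨y₂, a', b', f, rfl⟩
      · cases ht
        rw [Mor.len_ofGrp] at hl
        omega
      · rw [Mor.comp_cons, Mor.comp_cons] at h
        obtain ⟨g, hg⟩ := Mor.cons_inj Q h
        generalize hf : Mor.comp Q p q = r at hg
        cases hg
        -- The group element left over from the last arrow is absorbed into the remaining second
        -- factor, so that the induction hypothesis applies.
        rw [← Mor.comp_smul] at hf
        obtain ⟨h, h1, h2⟩ := ih _ _ hp' hf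
        refine ⟨h, h1, ?_⟩
        rw [Mor.cons_op_smul, h2, Mor.comp_smul, Mor.smul_smul', mul_inv_cancel, Mor.one_smul',
          Mor.comp_cons]) q

lemma Mor.isIso_iff {x y : Q.vertex} (f : Q.Mor x y) :
    @IsIso Q.Generated _ x y f ↔ Mor.len Q f = 0 := by
  constructor
  · intro h
    have := congrArg (Mor.len Q) (@IsIso.hom_inv_id Q.Generated _ x y f h)
    have h2 := Mor.len_comp Q f (@inv Q.Generated _ x y f h)
    have h3 : Mor.len Q (Mor.id Q x) = 0 := rfl
    exact (Nat.add_eq_zero_iff.1 (h2.symm.trans (this.trans h3))).1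
  · intro h
    rcases Mor.eq_ofGrp_or_cons Q f with ⟨t, ht⟩ | ⟨w, a, b, f, rfl⟩
    · cases ht
      refine ⟨⟨Mor.ofGrp Q t⁻¹, ?_, ?_⟩⟩
      · change Mor.ofGrp Q (t⁻¹ * t) = Mor.ofGrp Q 1
        rw [inv_mul_cancel]
      · change Mor.ofGrp Q (t * t⁻¹) = Mor.ofGrp Q 1
        rw [mul_inv_cancel]
    · cases h

end FiniteEIQuiver

/-! ### Length functions -/

namespace CategoryTheory

/-- An additive length on the morphisms of a category, for which the isomorphisms are the morphisms
of length `0`, and each morphism of positive length has an essentially unique first factor of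
length `1`. -/
structure LengthFunction (E : Type u) [Category.{v} E] where
  len : ∀ {x y : E}, (x ⟶ y) → ℕ
  len_comp : ∀ {x y z : E} (f : x ⟶ y) (g : y ⟶ z), len (f ≫ g) = len f + len g
  len_eq_zero_iff : ∀ {x y : E} (f : x ⟶ y), len f = 0 ↔ IsIso f
  exists_first : ∀ {x z : E} (f : x ⟶ z) (n : ℕ), len f = n + 1 →
    ∃ (y : E) (p : x ⟶ y) (q : y ⟶ z), len p = 1 ∧ len q = n ∧ p ≫ q = f
  first_unique : ∀ {x y y' z : E} (p : x ⟶ y) (q : y ⟶ z) (p' : x ⟶ y') (q' : y' ⟶ z),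
    len p = 1 → len p' = 1 → p ≫ q = p' ≫ q' → ∃ h : y ⟶ y', p' = p ≫ h ∧ q = h ≫ q'

theorem IsFiniteFreeEI.nonempty_lengthFunction {E : Type u} [Category.{v} E]
    (hE : IsFiniteFreeEI E) : Nonempty (LengthFunction E) := by
  obtain ⟨Q, F, hfull, hfaith, hbij⟩ := hE.free
  refine ⟨⟨fun f => FiniteEIQuiver.Mor.len Q (F.map f), ?_, ?_, ?_, ?_⟩⟩
  · intro x y z f g
    rw [F.map_comp]
    exact FiniteEIQuiver.Mor.len_comp Q (F.map f) (F.map g)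
  · intro x y f
    refine (FiniteEIQuiver.Mor.isIso_iff Q (F.map f)).symm.trans ⟨fun h => isIso_of_reflects_iso f F, fun h => inferInstance⟩
  · intro x z f n h
    obtain ⟨y, p, q, hp, hq, hpq⟩ := FiniteEIQuiver.Mor.exists_first Q (F.map f) n h
    obtain ⟨y, rfl⟩ := hbij.2 y
    obtain ⟨p, rfl⟩ := F.map_surjective p
    obtain ⟨q, rfl⟩ := F.map_surjective q
    refine ⟨y, p, q, hp, hq, F.map_injective ?_⟩
    rw [F.map_comp]
    exact hpq
  · intro x y y' z p q p' q' hp hp' h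
    have h' : F.map p ≫ F.map q = F.map p' ≫ F.map q' := by
      rw [← F.map_comp, ← F.map_comp, h]
    obtain ⟨t, h1, h2⟩ := FiniteEIQuiver.Mor.first_unique Q _ hp (F.map q) _ (F.map q') hp' h'
    obtain ⟨t, rfl⟩ := F.map_surjective (X := y) (Y := y') t
    refine ⟨t, F.map_injective ?_, F.map_injective ?_⟩
    · rw [F.map_comp]
      exact h1
    · rw [F.map_comp]
      exact h2

namespace LengthFunction

variable {E : Type u} [Category.{v} E] (L : LengthFunction E)

lemma len_isIso {x y : E} (f : x ⟶ y) [h : IsIso f] : L.len f = 0 := (L.len_eq_zero_iff f).2 h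

lemma isUnfactorizable_iff {x y : E} (f : x ⟶ y) : IsUnfactorizable f ↔ L.len f = 1 := by
  constructor
  · rintro ⟨h1, h2⟩
    rw [← L.len_eq_zero_iff] at h1
    obtain ⟨n, hn⟩ := Nat.exists_eq_succ_of_ne_zero h1
    obtain ⟨z, p, q, hp, hq, hpq⟩ := L.exists_first f n hn
    rcases h2 z p q hpq with h | h
    · have := L.len_isIso p
      omega
    · have := L.len_isIso q
      omega
  · intro h
    refine ⟨?_, ?_⟩
    · rw [← L.len_eq_zero_iff, h]
      exact one_ne_zero
    · intro z p q hpq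
      rw [← L.len_eq_zero_iff, ← L.len_eq_zero_iff]
      rw [← hpq, L.len_comp] at h
      omega

/-- Unfactorizable morphisms are those of length one, and length is additive, so the number of
unfactorizable factors does not depend on the factorization. -/
lemma hasLength_iff {x y : E} (f : x ⟶ y) (n : ℕ) : HasLength f n ↔ L.len f = n := by
  constructor
  · intro h
    induction h with
    | iso α h => exact L.len_isIso α
    | unfactorizable α h => exact (L.isUnfactorizable_iff α).1 h
    | comp α β n h _ ih =>
      rw [L.len_comp, ih, (L.isUnfactorizable_iff α).1 h]
      omega
  · induction n generalizing x with
    | zero => exact fun h => .iso f ((L.len_eq_zero_iff f).1 h)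
    | succ n ih =>
      intro h
      cases n with
      | zero => exact .unfactorizable f ((L.isUnfactorizable_iff f).2 h)
      | succ n =>
        obtain ⟨z, p, q, hp, hq, rfl⟩ := L.exists_first f _ h
        exact .comp p q n ((L.isUnfactorizable_iff p).2 hp) (ih q hq)

end LengthFunction

end CategoryTheory

/-! ### Homogeneous projections of the category algebra -/

namespace CategoryTheory

namespace CategoryAlgebra

variable (k : Type w) [Field k] {E : Type u} [Category.{v} E]

lemma of_comp {x y z : E} (α : x ⟶ y) (β : y ⟶ z) : of k (α ≫ β) = of k β * of k α :=
  (of_mul_of_comp k β α).symm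

variable {k} in
lemma hom_ext {M : Type*} [AddCommGroup M] [Module k M] {f g : CategoryAlgebra k E →ₗ[k] M}
    (h : ∀ {x y : E} (α : x ⟶ y), f (of k α) = g (of k α)) : f = g :=
  (basis k E).ext fun i => h i.2.2

end CategoryAlgebra

open CategoryAlgebra

namespace LengthFunction

variable (k : Type w) [Field k] {E : Type u} [Category.{v} E] (L : LengthFunction E)

/-- The projection of the category algebra to the span of the morphisms of length `n`. -/
noncomputable def proj (n : ℕ) : CategoryAlgebra k E →ₗ[k] CategoryAlgebra k E :=
  (basis k E).constr k fun m => if L.len m.2.2 = n then of k m.2.2 else 0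

lemma proj_of (n : ℕ) {x y : E} (α : x ⟶ y) :
    L.proj k n (of k α) = if L.len α = n then of k α else 0 := by
  rw [proj, of, Module.Basis.constr_basis]
  rfl

variable {k}

lemma proj_proj (n m : ℕ) (a : CategoryAlgebra k E) :
    L.proj k n (L.proj k m a) = if n = m then L.proj k n a else 0 := by
  induction a using CategoryAlgebra.induction with
  | zero => simp
  | add a b ha hb => rw [map_add, map_add, ha, hb]; split_ifs <;> simp
  | smul_of c α =>
    simp only [map_smul, proj_of]
    split_ifs with h h' h' <;> simp_all [proj_of]
    exact fun e => (h' e.symm).elim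

lemma proj_mem (n : ℕ) (a : CategoryAlgebra k E) : L.proj k n a ∈ lengthGrading k E n := by
  induction a using CategoryAlgebra.induction with
  | zero => simp
  | add a b ha hb => rw [map_add]; exact add_mem ha hb
  | smul_of c α =>
    rw [map_smul, proj_of]
    refine Submodule.smul_mem _ _ ?_
    split_ifs with h
    · exact Submodule.subset_span ⟨_, _, α, (L.hasLength_iff α n).2 h, rfl⟩
    · exact zero_mem _

lemma proj_eq_self_of_mem {n : ℕ} {a : CategoryAlgebra k E} (h : a ∈ lengthGrading k E n) :
    L.proj k n a = a := by
  induction h using Submodule.span_induction with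
  | mem a h =>
    obtain ⟨x, y, α, h, rfl⟩ := h
    rw [proj_of, if_pos ((L.hasLength_iff α n).1 h)]
  | zero => simp
  | add a b _ _ ha hb => rw [map_add, ha, hb]
  | smul c a _ ha => rw [map_smul, ha]

lemma of_mem {x y : E} (α : x ⟶ y) : of k α ∈ lengthGrading k E (L.len α) :=
  Submodule.subset_span ⟨_, _, α, (L.hasLength_iff α _).2 rfl, rfl⟩

lemma proj_mul_of_of {n : ℕ} {x y x' y' : E} (β : x' ⟶ y') (α : x ⟶ y) :
    L.proj k n (of k β * of k α) =
      if L.len α + L.len β = n then of k β * of k α else 0 := by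
  by_cases h : y = x'
  · subst h
    rw [of_mul_of_comp, proj_of, L.len_comp]
  · rw [of_mul_of_ne _ _ _ h]
    simp

lemma proj_add_mul (n i : ℕ) {a : CategoryAlgebra k E} (ha : a ∈ lengthGrading k E i)
    (b : CategoryAlgebra k E) : L.proj k (n + i) (a * b) = a * L.proj k n b := by
  induction ha using Submodule.span_induction with
  | zero => simp
  | add a b _ _ ha hb => rw [add_mul, add_mul, map_add, ha, hb]
  | smul c a _ ha => rw [smul_mul', smul_mul', map_smul, ha]
  | mem a h =>
  obtain ⟨x, y, α, h, rfl⟩ := h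
  rw [L.hasLength_iff] at h
  induction b using CategoryAlgebra.induction with
  | zero => simp
  | add a b ha hb => rw [mul_add, map_add, map_add, mul_add, ha, hb]
  | smul_of c β =>
    rw [mul_smul', map_smul, map_smul, mul_smul', proj_mul_of_of, proj_of, h]
    simp

lemma proj_zero_mul (a b : CategoryAlgebra k E) :
    L.proj k 0 (a * b) = L.proj k 0 a * L.proj k 0 b := by
  induction a using CategoryAlgebra.induction with
  | zero => simp
  | add a b ha hb => rw [add_mul, map_add, map_add, add_mul, ha, hb]
  | smul_of c α =>
  induction b using CategoryAlgebra.induction with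
  | zero => simp
  | add a b ha hb => rw [mul_add, map_add, map_add, mul_add, ha, hb]
  | smul_of d β =>
    simp only [mul_smul', smul_mul', map_smul, proj_mul_of_of, proj_of]
    congr 2
    split_ifs <;> first | omega | simp

lemma proj_one_mul (a b : CategoryAlgebra k E) :
    L.proj k 1 (a * b) = L.proj k 0 a * L.proj k 1 b + L.proj k 1 a * L.proj k 0 b := by
  induction a using CategoryAlgebra.induction with
  | zero => simp
  | add a b ha hb => rw [add_mul, map_add, map_add, map_add, add_mul, add_mul, ha, hb]; abel
  | smul_of c α =>
  induction b using CategoryAlgebra.induction with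
  | zero => simp
  | add a b ha hb => rw [mul_add, map_add, map_add, map_add, mul_add, mul_add, ha, hb]; abel
  | smul_of d β =>
    simp only [mul_smul', smul_mul', map_smul, proj_mul_of_of, proj_of, ← smul_add]
    congr 2
    split_ifs <;> first | omega | simp

section

variable [Finite E]

/-- The projection to degree zero is multiplicative and kills the generators of the ideal;
conversely `a - L.proj k 0 a` is a combination of morphisms of positive length. -/
lemma mem_positivePart_iff {a : CategoryAlgebra k E} :
    a ∈ positivePart (lengthGrading k E) ↔ L.proj k 0 a = 0 := by
  constructor
  · intro h
    induction h using Submodule.span_induction with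
    | zero => simp
    | add a b _ _ ha hb => rw [map_add, ha, hb, add_zero]
    | smul c a _ ha => rw [smul_eq_mul, proj_zero_mul, ha, mul_zero]
    | mem a h =>
      obtain ⟨i, h⟩ := Set.mem_iUnion.1 h
      rw [← L.proj_eq_self_of_mem h, proj_proj, if_neg (by simp)]
  · intro h
    have key : a - L.proj k 0 a ∈ positivePart (lengthGrading k E) := by
      clear h
      induction a using CategoryAlgebra.induction with
      | zero => simp
      | add a b ha hb => rw [map_add, add_sub_add_comm]; exact add_mem ha hb
      | smul_of c α =>
        rw [map_smul, ← smul_sub, proj_of]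
        refine Submodule.smul_of_tower_mem _ c ?_
        split_ifs with h
        · simp
        · obtain ⟨n, hn⟩ := Nat.exists_eq_succ_of_ne_zero h
          rw [sub_zero]
          exact Ideal.subset_span (Set.mem_iUnion.2 ⟨n, by simpa [hn] using L.of_mem (k := k) α⟩)
    rwa [h, sub_zero] at key

include L in
lemma mul_mem_positivePart_left {a : CategoryAlgebra k E}
    (h : a ∈ positivePart (lengthGrading k E)) (b : CategoryAlgebra k E) :
    a * b ∈ positivePart (lengthGrading k E) := by
  rw [L.mem_positivePart_iff] at h ⊢
  rw [proj_zero_mul, h, zero_mul]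

lemma mem_positivePart_of_pos {x y : E} {α : x ⟶ y} (h : L.len α ≠ 0) :
    of k α ∈ positivePart (lengthGrading k E) := by
  rw [L.mem_positivePart_iff, proj_of, if_neg h]

lemma positivePart_induction {motive : CategoryAlgebra k E → Prop} (zero : motive 0)
    (add : ∀ a b, motive a → motive b → motive (a + b))
    (smul_of : ∀ (c : k) {x y : E} (α : x ⟶ y), L.len α ≠ 0 → motive (c • of k α))
    {a : CategoryAlgebra k E} (h : a ∈ positivePart (lengthGrading k E)) : motive a := by
  rw [L.mem_positivePart_iff] at h
  have key : motive (a - L.proj k 0 a) := by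
    clear h
    induction a using CategoryAlgebra.induction with
    | zero => simpa
    | add a b ha hb => rw [map_add, add_sub_add_comm]; exact add _ _ ha hb
    | smul_of c α =>
      rw [map_smul, ← smul_sub, proj_of]
      split_ifs with h
      · simpa
      · rw [sub_zero]
        exact smul_of c α h
  rwa [h, sub_zero] at key

variable [∀ x y : E, Finite (x ⟶ y)]

instance : Module.Finite k (CategoryAlgebra k E) := Module.Finite.of_basis (basis k E)

variable (E) in
lemma exists_bound : ∃ N, ∀ {x y : E} (α : x ⟶ y), L.len α < N := by
  obtain ⟨N, hN⟩ := (Set.finite_range fun m : Σ x y : E, x ⟶ y => L.len m.2.2).bddAbove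
  exact ⟨N + 1, fun {x y} α => Nat.lt_succ_of_le (hN ⟨⟨x, y, α⟩, rfl⟩)⟩

lemma sum_proj {N : ℕ} (hN : ∀ {x y : E} (α : x ⟶ y), L.len α < N) (a : CategoryAlgebra k E) :
    ∑ n ∈ Finset.range N, L.proj k n a = a := by
  induction a using CategoryAlgebra.induction with
  | zero => simp
  | add a b ha hb => simp only [map_add, Finset.sum_add_distrib, ha, hb]
  | smul_of c α =>
    simp only [map_smul, ← Finset.smul_sum, proj_of]
    rw [Finset.sum_ite_eq, if_pos (Finset.mem_range.2 (hN α))]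

end

end LengthFunction

end CategoryTheory

/-! ### Relative traces and Higman's criterion -/

namespace CategoryTheory

namespace CategoryAlgebra

variable {k : Type w} [Field k] {E : Type u} [Category.{v} E] [Finite E] (y : E)
variable {M N Q : Type*} [AddCommGroup M] [Module k M] [Module (CategoryAlgebra k E) M]
  [IsScalarTower k (CategoryAlgebra k E) M]
  [AddCommGroup N] [Module k N] [Module (CategoryAlgebra k E) N]
  [IsScalarTower k (CategoryAlgebra k E) N]
  [AddCommGroup Q] [Module k Q] [Module (CategoryAlgebra k E) Q]
  [IsScalarTower k (CategoryAlgebra k E) Q]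

lemma of_id_mul_of {x : E} (α : x ⟶ y) : of k (𝟙 y) * of k α = of k α := by
  rw [of_mul_of_comp, Category.comp_id]

lemma of_mul_of_id {x : E} (α : y ⟶ x) : of k α * of k (𝟙 y) = of k α := by
  rw [of_mul_of_comp, Category.id_comp]

/-- A linear map between modules over the category algebra that commutes with the automorphisms of
the object `y`. -/
def IsEquivariantAt (f : M →ₗ[k] N) : Prop :=
  ∀ (g : Aut y) (m : M), f (of k g.hom • m) = of k g.hom • f m

variable {y}

namespace IsEquivariantAt

lemma of_linearMap (f : M →ₗ[CategoryAlgebra k E] N) :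
    IsEquivariantAt y (f.restrictScalars k) :=
  fun _ m => f.map_smul _ m

lemma map_inv {f : M →ₗ[k] N} (hf : IsEquivariantAt y f) (g : Aut y) (m : M) :
    f (of k g.inv • m) = of k g.inv • f m :=
  hf g⁻¹ m

lemma map_id {f : M →ₗ[k] N} (hf : IsEquivariantAt y f) (m : M) :
    f (of k (𝟙 y) • m) = of k (𝟙 y) • f m :=
  hf 1 m

lemma comp {f : N →ₗ[k] Q} (hf : IsEquivariantAt y f) {g : M →ₗ[k] N}
    (hg : IsEquivariantAt y g) : IsEquivariantAt y (f ∘ₗ g) := fun a m => by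
  rw [LinearMap.comp_apply, hg, hf, LinearMap.comp_apply]

lemma sub {f g : M →ₗ[k] N} (hf : IsEquivariantAt y f) (hg : IsEquivariantAt y g) :
    IsEquivariantAt y (f - g) := fun a m => by
  rw [LinearMap.sub_apply, hf, hg, LinearMap.sub_apply, smul_sub]

lemma id : IsEquivariantAt y (LinearMap.id : M →ₗ[k] M) := fun _ _ => rfl

lemma lsmul_id : IsEquivariantAt y (Algebra.lsmul k k M (of k (𝟙 y))) := fun g m => by
  change of k (𝟙 y) • of k g.hom • m = of k g.hom • of k (𝟙 y) • m
  rw [← mul_smul, ← mul_smul, of_id_mul_of, of_mul_of_id]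

end IsEquivariantAt

variable (y) [Fintype (Aut y)]

/-- The relative trace of a linear map, with respect to the automorphism group of `y`. -/
noncomputable def relTrace (θ : M →ₗ[k] N) : M →ₗ[k] N :=
  ∑ g : Aut y, Algebra.lsmul k k N (of k g.hom) ∘ₗ θ ∘ₗ Algebra.lsmul k k M (of k g.inv)

lemma relTrace_apply (θ : M →ₗ[k] N) (m : M) :
    relTrace y θ m = ∑ g : Aut y, of k g.hom • θ (of k g.inv • m) := by
  simp [relTrace]

variable {y}

lemma relTrace_isEquivariantAt (θ : M →ₗ[k] N) : IsEquivariantAt y (relTrace y θ) := by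
  intro h m
  rw [relTrace_apply, relTrace_apply, Finset.smul_sum]
  refine Fintype.sum_equiv (Equiv.mulLeft h⁻¹) _ _ fun g => ?_
  have h1 : (h⁻¹ * g).hom ≫ h.hom = g.hom := by
    change (g.hom ≫ h.inv) ≫ h.hom = g.hom
    rw [Category.assoc, h.inv_hom_id, Category.comp_id]
  have h2 : h.hom ≫ g.inv = (h⁻¹ * g).inv := rfl
  rw [← mul_smul, ← mul_smul, of_mul_of_comp, Equiv.coe_mulLeft, of_mul_of_comp, h1, h2]

lemma of_id_smul_relTrace (θ : M →ₗ[k] N) (m : M) :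
    of k (𝟙 y) • relTrace y θ m = relTrace y θ m := by
  rw [relTrace_apply, Finset.smul_sum]
  refine Finset.sum_congr rfl fun g _ => ?_
  rw [← mul_smul, of_id_mul_of]

lemma relTrace_comp {M' N' : Type*} [AddCommGroup M'] [Module k M']
    [Module (CategoryAlgebra k E) M'] [IsScalarTower k (CategoryAlgebra k E) M']
    [AddCommGroup N'] [Module k N'] [Module (CategoryAlgebra k E) N']
    [IsScalarTower k (CategoryAlgebra k E) N'] {q : N →ₗ[k] N'} (hq : IsEquivariantAt y q)
    {i : M' →ₗ[k] M} (hi : IsEquivariantAt y i) (θ : M →ₗ[k] N) (m : M') :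
    relTrace y (q ∘ₗ θ ∘ₗ i) m = q (relTrace y θ (i m)) := by
  simp only [relTrace_apply, map_sum, LinearMap.comp_apply, hi.map_inv, hq _ (θ _)]

lemma relTrace_add (θ θ' : M →ₗ[k] N) : relTrace y (θ + θ') = relTrace y θ + relTrace y θ' := by
  ext m
  simp [relTrace_apply, Finset.sum_add_distrib]

lemma relTrace_sum {ι : Type*} (s : Finset ι) (θ : ι → M →ₗ[k] N) :
    relTrace y (∑ i ∈ s, θ i) = ∑ i ∈ s, relTrace y (θ i) := by
  classical
  induction s using Finset.induction_on with
  | empty => ext m; simp [relTrace_apply]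
  | insert i s hi ih => rw [Finset.sum_insert hi, Finset.sum_insert hi, relTrace_add, ih]

variable (y)

variable (k M) in
/-- Higman's criterion for the projectivity of `1_y M` over the group algebra of `Aut y`: the
identity of `1_y M` is a relative trace. -/
def IsProjectiveAt : Prop :=
  ∃ θ : M →ₗ[k] M, ∀ m, relTrace y θ m = of k (𝟙 y) • m

variable {y}

namespace IsProjectiveAt

lemma of_retract (h : IsProjectiveAt k y M) {q : M →ₗ[k] N} (hq : IsEquivariantAt y q)
    {i : N →ₗ[k] M} (hi : IsEquivariantAt y i) (hqi : ∀ n, q (of k (𝟙 y) • i n) = of k (𝟙 y) • n) :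
    IsProjectiveAt k y N := by
  obtain ⟨θ, hθ⟩ := h
  exact ⟨q ∘ₗ θ ∘ₗ i, fun n => by rw [relTrace_comp hq hi, hθ, hqi]⟩

lemma of_retract_linear (h : IsProjectiveAt k y M) (q : M →ₗ[CategoryAlgebra k E] N)
    (i : N →ₗ[CategoryAlgebra k E] M) (hqi : ∀ n, q (i n) = n) : IsProjectiveAt k y N :=
  h.of_retract (.of_linearMap q) (.of_linearMap i) fun n => by simp [hqi]

lemma of_linearEquiv (h : IsProjectiveAt k y M) (e : M ≃ₗ[CategoryAlgebra k E] N) :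
    IsProjectiveAt k y N :=
  h.of_retract_linear e.toLinearMap e.symm.toLinearMap fun n => by simp

lemma of_smul_eq_zero (h : ∀ m : M, of k (𝟙 y) • m = 0) : IsProjectiveAt k y M :=
  ⟨0, fun m => by simp [relTrace_apply, h]⟩

/-- Projective implies relatively injective: averaging `θ ∘ r`, for a `k`-linear retraction `r` of
`j`, gives an equivariant retraction on the component at `y`. -/
lemma exists_retraction (h : IsProjectiveAt k y N) {j : N →ₗ[k] M} (hj : IsEquivariantAt y j)
    (hinj : Function.Injective j) :
    ∃ r : M →ₗ[k] N, IsEquivariantAt y r ∧ (∀ n, r (j n) = of k (𝟙 y) • n) ∧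
      ∀ m, of k (𝟙 y) • r m = r m := by
  obtain ⟨θ, hθ⟩ := h
  obtain ⟨r, hr⟩ := j.exists_leftInverse_of_injective (LinearMap.ker_eq_bot.2 hinj)
  refine ⟨relTrace y (θ ∘ₗ r), relTrace_isEquivariantAt _, fun n => ?_,
    fun m => of_id_smul_relTrace _ _⟩
  have h1 := relTrace_comp (y := y) (N := N) .id hj (θ ∘ₗ r) n
  have h2 : (LinearMap.id ∘ₗ (θ ∘ₗ r) ∘ₗ j) = θ := by
    rw [LinearMap.comp_assoc, hr, LinearMap.comp_id, LinearMap.id_comp]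
  rw [h2, hθ] at h1
  exact h1.symm

lemma exists_section (h : IsProjectiveAt k y Q) {q : M →ₗ[k] Q} (hq : IsEquivariantAt y q)
    (hsurj : Function.Surjective q) :
    ∃ s : Q →ₗ[k] M, IsEquivariantAt y s ∧ (∀ x, q (s x) = of k (𝟙 y) • x) ∧
      ∀ x, of k (𝟙 y) • s x = s x := by
  obtain ⟨θ, hθ⟩ := h
  obtain ⟨s, hs⟩ := q.exists_rightInverse_of_surjective (LinearMap.range_eq_top.2 hsurj)
  refine ⟨relTrace y (s ∘ₗ θ), relTrace_isEquivariantAt _, fun n => ?_,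
    fun m => of_id_smul_relTrace _ _⟩
  have h1 := relTrace_comp (y := y) (M := Q) hq .id (s ∘ₗ θ) n
  have h2 : (q ∘ₗ (s ∘ₗ θ) ∘ₗ LinearMap.id) = θ := by
    rw [LinearMap.comp_id, ← LinearMap.comp_assoc, hs, LinearMap.id_comp]
  rw [h2, hθ] at h1
  exact h1.symm

/-- The submodule splits off at `y` because it is relatively injective, so the quotient is a retract
at `y`. This plays the role of self-injectivity of group algebras. -/
lemma of_quotient (hN : IsProjectiveAt k y N) (hM : IsProjectiveAt k y M)
    (j : N →ₗ[CategoryAlgebra k E] M) (q : M →ₗ[CategoryAlgebra k E] Q)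
    (hj : Function.Injective j) (hq : Function.Surjective q) (hjq : Function.Exact j q) :
    IsProjectiveAt k y Q := by
  have hj' := IsEquivariantAt.of_linearMap (y := y) (k := k) j
  have hq' := IsEquivariantAt.of_linearMap (y := y) (k := k) q
  obtain ⟨r, hr, hrj, -⟩ := hN.exists_retraction hj' hj
  obtain ⟨t, ht⟩ := (q.restrictScalars k).exists_rightInverse_of_surjective
    (LinearMap.range_eq_top.2 hq)
  have ht' (x : Q) : q (t x) = x := LinearMap.congr_fun ht x
  -- The projection onto a complement of `N` at `y`. It vanishes on `j N`, so `f ∘ t` is independent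
  -- of the merely linear section `t` and is equivariant.
  set f : M →ₗ[k] M := Algebra.lsmul k k M (of k (𝟙 y)) - j.restrictScalars k ∘ₗ r with hf
  have hfe : IsEquivariantAt y f := .sub .lsmul_id (hj'.comp hr)
  have hfj (n : N) : f (j n) = 0 := by
    have := hrj n
    rw [LinearMap.restrictScalars_apply] at this
    simp [hf, this]
  have hft (m : M) : f (t (q m)) = f m := by
    obtain ⟨n, hn⟩ := (hjq (t (q m) - m)).1 (by rw [map_sub, ht', sub_self])
    rw [← sub_eq_zero, ← map_sub, ← hn, hfj]
  refine hM.of_retract (i := f ∘ₗ t) hq' ?_ ?_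
  · intro g x
    obtain ⟨m, rfl⟩ := hq x
    rw [← map_smul, LinearMap.comp_apply, LinearMap.comp_apply, hft, hft, hfe]
  · intro x
    have hqj (n : N) : q (j n) = 0 := (hjq _).2 ⟨n, rfl⟩
    simp only [LinearMap.comp_apply, hf, LinearMap.sub_apply, Algebra.lsmul_coe,
      LinearMap.restrictScalars_apply, map_sub, map_smul, hqj, ht', smul_sub, smul_zero, sub_zero]
    rw [← mul_smul, of_id_mul_of]

lemma of_extension (hN : IsProjectiveAt k y N) (hQ : IsProjectiveAt k y Q)
    (j : N →ₗ[CategoryAlgebra k E] M) (q : M →ₗ[CategoryAlgebra k E] Q)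
    (hj : Function.Injective j) (hq : Function.Surjective q) (hjq : Function.Exact j q) :
    IsProjectiveAt k y M := by
  have hj' := IsEquivariantAt.of_linearMap (y := y) (k := k) j
  have hq' := IsEquivariantAt.of_linearMap (y := y) (k := k) q
  obtain ⟨r, hr, hrj, hr1⟩ := hN.exists_retraction hj' hj
  obtain ⟨s, hs, hqs, hs1⟩ := hQ.exists_section hq' hq
  obtain ⟨θ, hθ⟩ := hN
  obtain ⟨θ', hθ'⟩ := hQ
  -- With an equivariant section `s` and retraction `r`, the identity at `y` is `s q + j r (1 - s
  -- q)`; each summand is a relative trace.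
  refine ⟨s ∘ₗ θ' ∘ₗ q.restrictScalars k + j.restrictScalars k ∘ₗ θ ∘ₗ
    (r ∘ₗ (LinearMap.id - s ∘ₗ q.restrictScalars k)), fun m => ?_⟩
  rw [relTrace_add, LinearMap.add_apply, relTrace_comp hs hq',
    relTrace_comp hj' (hr.comp (.sub .id (hs.comp hq'))), hθ, hθ']
  simp only [LinearMap.comp_apply, LinearMap.sub_apply, LinearMap.id_apply,
    LinearMap.restrictScalars_apply] at hqs hrj ⊢
  rw [hs.map_id, hs1, hr1]
  obtain ⟨n, hn⟩ := (hjq (of k (𝟙 y) • (m - s (q m)))).1 (by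
    rw [map_smul, map_sub, hqs, smul_sub, ← mul_smul, of_id_mul_of, sub_self])
  rw [← hr1, ← hr.map_id, ← hn, hrj, map_smul, hn, ← mul_smul, of_id_mul_of, smul_sub, hs1]
  abel

lemma finsupp (h : IsProjectiveAt k y M) (X : Type*) : IsProjectiveAt k y (X →₀ M) := by
  obtain ⟨θ, hθ⟩ := h
  refine ⟨Finsupp.mapRange.linearMap θ, fun m => ?_⟩
  ext x
  rw [relTrace_apply, Finsupp.finsetSum_apply]
  have := hθ (m x)
  rw [relTrace_apply] at this
  simpa using this

lemma of_filtration (F : ℕ → Submodule (CategoryAlgebra k E) M) (n : ℕ) (h0 : F 0 = ⊥)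
    (h : ∀ i < n, F i ≤ F (i + 1) ∧
      IsProjectiveAt k y (F (i + 1) ⧸ (F i).submoduleOf (F (i + 1)))) :
    IsProjectiveAt k y (F n) := by
  induction n with
  | zero =>
    refine of_smul_eq_zero fun m => ?_
    have hm : (m : M) ∈ (⊥ : Submodule (CategoryAlgebra k E) M) := h0.le m.2
    rw [show m = 0 from Subtype.ext ((Submodule.mem_bot _).1 hm), smul_zero]
  | succ n ih =>
    have hn := h n n.lt_succ_self
    refine (ih fun i hi => h i (by omega)).of_extension hn.2 (Submodule.inclusion hn.1)
      (Submodule.mkQ _) (Submodule.inclusion_injective _) (Submodule.mkQ_surjective _) ?_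
    intro m
    rw [← LinearMap.mem_ker, Submodule.ker_mkQ]
    change (m : M) ∈ F n ↔ _
    constructor
    · exact fun hm => ⟨⟨m, hm⟩, rfl⟩
    · rintro ⟨m', rfl⟩
      exact m'.2

end IsProjectiveAt

end CategoryAlgebra

end CategoryTheory

/-! ### Primitive idempotents and their local corner rings -/

section Primitive

variable {A : Type w} [Ring A]

lemma mul_eq_of_sum_orthogonalIdempotents {ι : Type*} [Fintype ι] {f : ι → A}
    (hf : OrthogonalIdempotents f) (i : ι) :
    f i * (∑ j, f j) = f i ∧ (∑ j, f j) * f i = f i := by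
  classical
  constructor
  · rw [Finset.mul_sum, Finset.sum_eq_single i (fun j _ hj => hf.ortho hj.symm) (by simp),
      hf.idem i]
  · rw [Finset.sum_mul, Finset.sum_eq_single i (fun j _ hj => hf.ortho hj) (by simp),
      hf.idem i]

/-- Each part of a nontrivial orthogonal splitting generates a strictly smaller left ideal, so
splitting stops by the descending chain condition. -/
theorem exists_primitive_decomposition [IsArtinian A A] (e : A) (he : IsIdempotentElem e) :
    ∃ (ι : Type) (_ : Fintype ι) (f : ι → A), OrthogonalIdempotents f ∧ ∑ i, f i = e ∧
      ∀ i, IsPrimitiveIdempotent (f i) := by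
  generalize hP : idempotentProjective e = P
  induction P using WellFoundedLT.induction generalizing e with
  | ind P ih =>
  subst hP
  by_cases h0 : e = 0
  · exact ⟨Empty, inferInstance, Empty.elim, ⟨fun i => i.elim, fun i => i.elim⟩, by simp [h0],
      fun i => i.elim⟩
  by_cases hprim : IsPrimitiveIdempotent e
  · exact ⟨Unit, inferInstance, fun _ => e, ⟨fun _ => he, fun i j h => (h rfl).elim⟩, by simp,
      fun _ => hprim⟩
  unfold IsPrimitiveIdempotent at hprim
  push Not at hprim
  obtain ⟨f, g, hf, hg, hfg, hgf, hsum, hf0, hg0⟩ := hprim h0 he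
  have key (f g : A) (hf : IsIdempotentElem f) (hg : IsIdempotentElem g) (hfg : f * g = 0)
      (hsum : f + g = e) (hg0 : g ≠ 0) : idempotentProjective f < idempotentProjective e := by
    refine lt_of_le_of_ne ((Submodule.span_singleton_le_iff_mem _ _).2 ?_) fun h => hg0 ?_
    · exact Submodule.mem_span_singleton.2
        ⟨f, by rw [smul_eq_mul, ← hsum, mul_add, hf, hfg, add_zero]⟩
    · have : e ∈ idempotentProjective f := h ▸ Submodule.mem_span_singleton_self e
      obtain ⟨x, hx⟩ := Submodule.mem_span_singleton.1 this
      have h1 : e * g = g := by rw [← hsum, add_mul, hfg, hg, zero_add]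
      rw [← h1, ← hx, smul_eq_mul, mul_assoc, hfg, mul_zero]
  obtain ⟨ι, _, p, hp, hps, hpp⟩ := ih _ (key f g hf hg hfg hsum hg0) f hf rfl
  obtain ⟨κ, _, q, hq, hqs, hqp⟩ := ih _ (key g f hg hf hgf ((add_comm g f).trans hsum) hf0) g hg rfl
  have hpq (i j) : p i * q j = 0 := by
    rw [← (mul_eq_of_sum_orthogonalIdempotents hp i).1,
      ← (mul_eq_of_sum_orthogonalIdempotents hq j).2, hps, hqs, mul_assoc, ← mul_assoc f, hfg,
      zero_mul, mul_zero]
  have hqp' (i j) : q i * p j = 0 := by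
    rw [← (mul_eq_of_sum_orthogonalIdempotents hq i).1,
      ← (mul_eq_of_sum_orthogonalIdempotents hp j).2, hps, hqs, mul_assoc, ← mul_assoc g, hgf,
      zero_mul, mul_zero]
  refine ⟨ι ⊕ κ, inferInstance, Sum.elim p q, ⟨?_, ?_⟩, ?_, ?_⟩
  · rintro (i | i)
    · exact hp.idem i
    · exact hq.idem i
  · rintro (i | i) (j | j) hij
    · exact hp.ortho fun h => hij (by rw [h])
    · exact hpq i j
    · exact hqp' i j
    · exact hq.ortho fun h => hij (by rw [h])
  · rw [Fintype.sum_sum_type]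
    simp only [Sum.elim_inl, Sum.elim_inr]
    rw [hps, hqs, hsum]
  · rintro (i | i)
    · exact hpp i
    · exact hqp i

namespace IsPrimitiveIdempotent

variable {e : A} (he : IsPrimitiveIdempotent e)
include he

/-- The corner ring of a primitive idempotent is local, with nilpotent maximal ideal. -/
theorem nilpotent_or_exists_mul_eq [IsArtinian A A] [IsNoetherian A A] {a : A} (ha : e * a = a)
    (ha' : a * e = a) : (∃ n, a ^ n = 0) ∨ ∃ b, b * a = e := by
  set r : Module.End A A := LinearMap.toSpanSingleton A A a with hr
  have hpow (n : ℕ) (x : A) : (r ^ n) x = x * a ^ n := by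
    induction n generalizing x with
    | zero => simp
    | succ n ih =>
      rw [pow_succ, Module.End.mul_apply, ih, hr, LinearMap.toSpanSingleton_apply, smul_eq_mul,
        mul_assoc, pow_succ']
  -- Fitting's lemma for right multiplication by `a`: its kernel and image decompose `e` as `c + d`,
  -- and these turn out to be orthogonal idempotents, so one of them is zero. The exponent is taken
  -- positive so that `e` fixes the power of `a` from both sides.
  obtain ⟨n, hn, hn1⟩ := (r.eventually_isCompl_ker_pow_range_pow.and
    (Filter.eventually_ge_atTop 1)).exists
  obtain ⟨n, rfl⟩ : ∃ m, n = m + 1 := ⟨n - 1, by omega⟩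
  have hea : e * a ^ (n + 1) = a ^ (n + 1) := by rw [pow_succ', ← mul_assoc, ha]
  have hae : a ^ (n + 1) * e = a ^ (n + 1) := by rw [pow_succ, mul_assoc, ha']
  obtain ⟨c, hc, d, hd, hcd⟩ := Submodule.mem_sup.1
    (show e ∈ LinearMap.ker (r ^ (n + 1)) ⊔ LinearMap.range (r ^ (n + 1)) by
      rw [hn.sup_eq_top]; trivial)
  obtain ⟨t, rfl⟩ := hd
  rw [LinearMap.mem_ker, hpow] at hc
  rw [hpow] at hcd
  have hzero {x y : A} (hx : x * a ^ (n + 1) = 0) (hxy : x = y * a ^ (n + 1)) : x = 0 := by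
    have := Submodule.disjoint_def.1 hn.disjoint x (by rw [LinearMap.mem_ker, hpow, hx])
      ⟨y, by rw [hpow, hxy]⟩
    exact this
  set d := t * a ^ (n + 1) with hd
  have hde : d * e = d := by rw [hd, mul_assoc, hae]
  have hce : c * e = c := by
    have h1 : e * e = e := he.2.1
    have h2 : c = e - d := by rw [← hcd, add_sub_cancel_right]
    rw [h2, sub_mul, h1, hde]
  have hcc : c * c + c * d = c := by rw [← mul_add, hcd, hce]
  have hdd : d * c + d * d = d := by rw [← mul_add, hcd, hde]
  have hcd0 : c * d = 0 := by
    refine hzero (y := c * t) ?_ (by rw [hd, mul_assoc])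
    rw [show c * d = c - c * c by rw [eq_sub_iff_add_eq', hcc], sub_mul, mul_assoc, hc, mul_zero,
      sub_zero]
  have hdc0 : d * c = 0 := by
    refine hzero (y := t - d * t) (by rw [mul_assoc, hc, mul_zero]) ?_
    rw [sub_mul, mul_assoc d, ← hd, eq_sub_iff_add_eq, hdd]
  rw [hcd0, add_zero] at hcc
  rw [hdc0, zero_add] at hdd
  rcases he.2.2 c d hcc hdd hcd0 hdc0 hcd with h | h
  · right
    refine ⟨t * a ^ n, ?_⟩
    rw [mul_assoc, ← pow_succ, ← hd, ← hcd, h, zero_add]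
  · left
    refine ⟨n + 1, ?_⟩
    rw [← hea, ← hcd, h, add_zero, hc]

/-- An endomorphism is determined by the image of the generator, which is `a • m` for some `a` in
the corner ring. If `a` is nilpotent, so is `f`; if `a` has a left inverse there, `f` is surjective,
hence injective by the Noetherian property. -/
theorem nilpotent_or_injective [IsArtinian A A] [IsNoetherian A A] {M : Type*} [AddCommGroup M]
    [Module A M] [IsNoetherian A M] {m : M} (hm : ∀ x, ∃ a : A, a • m = x) (hem : e • m = m)
    (f : Module.End A M) : (∃ n, f ^ n = 0) ∨ Function.Injective f := by
  obtain ⟨a₀, ha₀⟩ := hm (f m)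
  have hee : e * e = e := he.2.1
  set a := e * a₀ * e with ha
  have hfm : f m = a • m := by
    rw [ha, mul_smul, mul_smul, hem, ha₀, ← f.map_smul, hem]
  have hpow (n : ℕ) : (f ^ n) m = a ^ n • m := by
    induction n with
    | zero => simp
    | succ n ih => rw [pow_succ', Module.End.mul_apply, ih, map_smul, hfm, ← mul_smul, pow_succ]
  rcases he.nilpotent_or_exists_mul_eq (a := a) (by rw [ha, ← mul_assoc, ← mul_assoc, hee])
    (by rw [ha, mul_assoc, hee]) with ⟨n, hn⟩ | ⟨b, hb⟩
  · refine .inl ⟨n, LinearMap.ext fun x => ?_⟩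
    obtain ⟨c, rfl⟩ := hm x
    rw [map_smul, hpow, hn, zero_smul, smul_zero, LinearMap.zero_apply]
  · refine .inr (IsNoetherian.injective_of_surjective_endomorphism f fun x => ?_)
    obtain ⟨c, rfl⟩ := hm x
    exact ⟨c • b • m, by rw [map_smul, map_smul, hfm, ← mul_smul b, hb, hem]⟩

/-- If a maximal submodule `C` missed `N`, then `e` would be a sum of elements of `C` and `N`. Since
the corner ring is local, one of the two summands, multiplied by `e`, has a left inverse there, and
the submodule containing it is everything. -/
theorem le_jacobson [IsArtinian A A] [IsNoetherian A A]
    {N : Submodule A (idempotentProjective e)} (hN : N ≠ ⊤) :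
    N ≤ Module.jacobson A (idempotentProjective e) := by
  have hee : e * e = e := he.2.1
  set e' : idempotentProjective e := ⟨e, Submodule.mem_span_singleton_self e⟩ with he'
  have hgen (x : idempotentProjective e) : (x : A) • e' = x := by
    obtain ⟨t, ht⟩ := Submodule.mem_span_singleton.1 x.2
    refine Subtype.ext ?_
    change (x : A) * e = x
    rw [← ht, smul_eq_mul, mul_assoc, hee]
  have htop {C : Submodule A (idempotentProjective e)} (h : e' ∈ C) : C = ⊤ :=
    eq_top_iff.2 fun x _ => hgen x ▸ C.smul_mem _ h
  refine le_sInf fun C (hC : IsCoatom C) => ?_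
  by_contra hNC
  have hsup : C ⊔ N = ⊤ := hC.2 _ (left_lt_sup.2 hNC)
  obtain ⟨c, hc, a₀, ha₀, hsum⟩ := Submodule.mem_sup.1 (show e' ∈ C ⊔ N from hsup ▸ trivial)
  have h1 : e * (a₀ : A) ∈ idempotentProjective e := Submodule.smul_mem _ _ a₀.2
  set a : A := e * a₀ with ha
  have hae : a * e = a := by
    have := congrArg Subtype.val (hgen a₀)
    rw [ha, mul_assoc]
    exact congrArg (e * ·) this
  have hea : e * a = a := by rw [ha, ← mul_assoc, hee]
  have haN : a • e' ∈ N := by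
    have : a • e' = e • a₀ := Subtype.ext (by exact hae)
    rw [this]
    exact N.smul_mem _ ha₀
  have hC' : (e - a) • e' ∈ C := by
    have : (e - a) • e' = e • c := by
      have h2 : c = e' - a₀ := by rw [← hsum, add_sub_cancel_right]
      rw [h2]
      refine Subtype.ext ?_
      change (e - a) * e = e * (e - a₀)
      rw [sub_mul, mul_sub, hae]
    rw [this]
    exact C.smul_mem _ hc
  rcases he.nilpotent_or_exists_mul_eq hea hae with ⟨n, hn⟩ | ⟨b, hb⟩
  · refine hC.1 (htop ?_)
    -- The geometric series inverts `1 - a`, since `a` is nilpotent.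
    have : e' = (∑ i ∈ Finset.range n, a ^ i) • (e - a) • e' := by
      refine Subtype.ext ?_
      change e = (∑ i ∈ Finset.range n, a ^ i) * ((e - a) * e)
      have h3 : (e - a) * e = (1 - a) * e := by rw [sub_mul, sub_mul, hee, one_mul]
      rw [h3, ← mul_assoc, geom_sum_mul_neg, hn, sub_zero, one_mul]
    rw [this]
    exact C.smul_mem _ hC'
  · refine hN (htop ?_)
    have : e' = b • a • e' := by
      refine Subtype.ext ?_
      change e = b * (a * e)
      rw [hae, hb]
    rw [this]
    exact N.smul_mem _ haN

end IsPrimitiveIdempotent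

end Primitive

/-! ### Projectivity of the ideal of non-isomorphisms -/

namespace CategoryTheory

open CategoryAlgebra TensorProduct

namespace LengthFunction

variable (k : Type w) [Field k] {E : Type u} [Category.{v} E] [Finite E] (L : LengthFunction E)
  [∀ y : E, Fintype (Aut y)]

/-- The degree one component of the category algebra is projective as a left module over the degree
zero component. -/
def DegreeOneProjective : Prop :=
  ∀ y : E, ∃ θ : CategoryAlgebra k E →ₗ[k] CategoryAlgebra k E,
    ∀ a, relTrace y θ a = of k (𝟙 y) * L.proj k 1 a

variable {k}

/-- The formula depends on a factorization of `α`. Two factorizations differ by an automorphism of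
the middle object, which merely reindexes the sum, so one tensor serves for all of them. -/
lemma exists_firstFactor_tensor (hs : Skeletal E)
    (θ : E → CategoryAlgebra k E →ₗ[k] CategoryAlgebra k E) {x z : E} (α : x ⟶ z) :
    ∃ t : CategoryAlgebra k E ⊗[k] CategoryAlgebra k E,
      ∀ (y : E) (p : x ⟶ y) (q : y ⟶ z), L.len p = 1 → p ≫ q = α →
        t = ∑ g : Aut y, of k (g.hom ≫ q) ⊗ₜ θ y (of k (p ≫ g.inv)) := by
  by_cases h : ∃ (y : E) (p : x ⟶ y) (q : y ⟶ z), L.len p = 1 ∧ p ≫ q = α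
  · obtain ⟨y, p, q, hp, rfl⟩ := h
    refine ⟨∑ g : Aut y, of k (g.hom ≫ q) ⊗ₜ θ y (of k (p ≫ g.inv)), fun y' p' q' hp' hpq => ?_⟩
    obtain ⟨h, rfl, rfl⟩ := L.first_unique p q p' q' hp hp' hpq.symm
    have hiso : IsIso h := by
      rw [← L.len_eq_zero_iff]
      rw [L.len_comp] at hp'
      omega
    obtain rfl := hs ⟨asIso h⟩
    let a : Aut y := asIso h
    refine Fintype.sum_equiv (Equiv.mulLeft a) _ _ fun g => ?_
    have h1 : (a * g).hom = g.hom ≫ h := rfl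
    have h2 : (a * g).inv = inv h ≫ g.inv := rfl
    rw [Equiv.coe_mulLeft, h1, h2]
    simp
  · exact ⟨0, fun y p q hp hpq => (h ⟨y, p, q, hp, hpq⟩).elim⟩

/-- The ideal is a retract of `kE ⊗ kE` over `k`, which is free on the left factor. The section
sends `q p`, with `p` of length one, to `∑ q g ⊗ θ (g⁻¹ p)`, and the retraction is `a ⊗ b ↦ a ·
L.proj k 1 b`; their composite is the identity by the trace condition on `θ`. -/
theorem DegreeOneProjective.projective_positivePart {L : LengthFunction E} (hs : Skeletal E)
    (h : L.DegreeOneProjective k) :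
    Module.Projective (CategoryAlgebra k E) (positivePart (lengthGrading k E)) := by
  choose θ hθ using h
  choose t ht using fun m : Σ x z : E, x ⟶ z => L.exists_firstFactor_tensor hs θ m.2.2
  set ι : CategoryAlgebra k E →ₗ[k] CategoryAlgebra k E ⊗[k] CategoryAlgebra k E :=
    (basis k E).constr k t
  have hι {x y z : E} (p : x ⟶ y) (q : y ⟶ z) (hp : L.len p = 1) :
      ι (of k (p ≫ q)) = ∑ g : Aut y, of k (g.hom ≫ q) ⊗ₜ θ y (of k (p ≫ g.inv)) := by
    rw [of, Module.Basis.constr_basis]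
    exact ht ⟨x, z, p ≫ q⟩ y p q hp rfl
  -- Multiplying on the left leaves the first factor `p` unchanged and affects only `q`; this is why
  -- `ι` is linear on the ideal, though not on the whole algebra.
  have hι' {x y : E} (α : x ⟶ y) (hα : L.len α ≠ 0) (a : CategoryAlgebra k E) :
      ι (a * of k α) = a • ι (of k α) := by
    obtain ⟨n, hn⟩ := Nat.exists_eq_succ_of_ne_zero hα
    obtain ⟨m, p, q, hp, -, rfl⟩ := L.exists_first α n hn
    induction a using CategoryAlgebra.induction with
    | zero => simp
    | add a b ha hb => rw [add_mul, map_add, add_smul, ha, hb]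
    | smul_of c γ =>
      rename_i z z'
      rw [smul_mul', map_smul, smul_assoc]
      congr 1
      rw [hι p q hp, Finset.smul_sum]
      by_cases hyz : y = z
      · subst hyz
        rw [of_mul_of_comp, Category.assoc, hι p _ hp]
        refine Finset.sum_congr rfl fun g _ => ?_
        rw [smul_tmul', smul_eq_mul, of_mul_of_comp, Category.assoc]
      · rw [of_mul_of_ne _ _ _ hyz, map_zero]
        refine (Finset.sum_eq_zero fun g _ => ?_).symm
        rw [smul_tmul', smul_eq_mul, of_mul_of_ne _ _ _ hyz, zero_tmul]
  let s : positivePart (lengthGrading k E) →ₗ[CategoryAlgebra k E]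
      CategoryAlgebra k E ⊗[k] CategoryAlgebra k E :=
    { toFun := fun a => ι a
      map_add' := fun a b => map_add ι (a : CategoryAlgebra k E) b
      map_smul' := fun b a => L.positivePart_induction
        (motive := fun a => ι (b * a) = b • ι a) (by simp)
        (fun a a' ha ha' => by rw [mul_add, map_add, map_add, smul_add, ha, ha'])
        (fun c x y α hα => by rw [mul_smul', map_smul, map_smul, hι' α hα, smul_comm]) a.2 }
  let μ : CategoryAlgebra k E ⊗[k] CategoryAlgebra k E →ₗ[CategoryAlgebra k E]
      CategoryAlgebra k E :=
    TensorProduct.AlgebraTensorModule.lift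
      (LinearMap.toSpanSingleton (CategoryAlgebra k E)
        (CategoryAlgebra k E →ₗ[k] CategoryAlgebra k E) (L.proj k 1))
  have hμ (a b : CategoryAlgebra k E) : μ (a ⊗ₜ b) = a * L.proj k 1 b := rfl
  have hμmem (t) : μ t ∈ positivePart (lengthGrading k E) := by
    induction t using TensorProduct.induction_on with
    | zero => simp
    | add a b ha hb => rw [map_add]; exact add_mem ha hb
    | tmul a b =>
      rw [hμ, ← smul_eq_mul]
      refine Submodule.smul_mem _ _ ?_
      rw [L.mem_positivePart_iff, proj_proj, if_neg zero_ne_one]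
  have hμι {x z : E} (α : x ⟶ z) (hα : L.len α ≠ 0) : μ (ι (of k α)) = of k α := by
    obtain ⟨n, hn⟩ := Nat.exists_eq_succ_of_ne_zero hα
    obtain ⟨m, p, q, hp, -, rfl⟩ := L.exists_first α n hn
    have h1 : L.proj k 1 (relTrace m (θ m) (of k p)) = of k p := by
      rw [hθ, proj_of, if_pos hp, of_id_mul_of, proj_of, if_pos hp]
    rw [hι p q hp, map_sum, of_comp]
    refine Eq.trans ?_ (congrArg (of k q * ·) h1)
    rw [relTrace_apply, map_sum, Finset.mul_sum]
    refine Finset.sum_congr rfl fun g _ => ?_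
    have h2 : of k g.hom ∈ lengthGrading k E 0 := by
      have := L.of_mem (k := k) g.hom
      rwa [L.len_isIso (h := Iso.isIso_hom g)] at this
    rw [hμ, of_comp, of_comp, mul_assoc, smul_eq_mul, smul_eq_mul]
    congr 1
    exact (L.proj_add_mul 1 0 h2 _).symm
  refine Module.Projective.of_split s (μ.codRestrict _ hμmem) (LinearMap.ext fun a => Subtype.ext ?_)
  exact L.positivePart_induction (motive := fun a => μ (ι a) = a) (by simp)
    (fun a b ha hb => by rw [map_add, map_add, ha, hb])
    (fun c x y α hα => by
      rw [map_smul, LinearMap.map_smul_of_tower, hμι α hα]) a.2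

end LengthFunction

end CategoryTheory

/-! ### Dimension shifting -/

namespace CategoryTheory

variable {A : Type w} [Ring A] {M N : Type w} [AddCommGroup M] [Module A M] [AddCommGroup N]
  [Module A N]

lemma hasProjectiveDimensionLT_of_ker (f : M →ₗ[A] N) (hf : Function.Surjective f)
    [Module.Projective A M] [Module.Projective A (LinearMap.ker f)] :
    HasProjectiveDimensionLT (ModuleCat.of A N) 2 := by
  have hM : Projective (ModuleCat.of A M) := (IsProjective.iff_projective _).1 ‹_›
  have hK : Projective (ModuleCat.of A (LinearMap.ker f)) := (IsProjective.iff_projective _).1 ‹_›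
  exact (LinearMap.shortExact_shortComplexKer hf).hasProjectiveDimensionLT_X₃ 1
    (inferInstanceAs (HasProjectiveDimensionLT (ModuleCat.of A (LinearMap.ker f)) 1))
    (inferInstanceAs (HasProjectiveDimensionLT (ModuleCat.of A M) 2))

lemma hasProjectiveDimensionLT_ker (f : M →ₗ[A] N) (hf : Function.Surjective f)
    [Module.Projective A M] (n : ℕ) (h : HasProjectiveDimensionLT (ModuleCat.of A N) (n + 2)) :
    HasProjectiveDimensionLT (ModuleCat.of A (LinearMap.ker f)) (n + 1) := by
  have hM : Projective (ModuleCat.of A M) := (IsProjective.iff_projective _).1 ‹_›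
  exact (LinearMap.shortExact_shortComplexKer hf).hasProjectiveDimensionLT_X₁ (n + 1)
    (hasProjectiveDimensionLT_of_ge (ModuleCat.of A M) 1 (n + 1) (by omega)) h

end CategoryTheory

/-! ### The length grading indexed by the integers -/

lemma DirectSum.isInternal_of_projections {M : Type*} [AddCommGroup M] {ℳ : ℤ → AddSubgroup M}
    (p : ℤ → M →+ M) (hmem : ∀ i m, m ∈ ℳ i ↔ p i m = m) (hidem : ∀ i m, p i (p i m) = p i m)
    (hortho : ∀ i j m, i ≠ j → p i (p j m) = 0) (S : Finset ℤ)
    (hS : ∀ m, ∑ i ∈ S, p i m = m) : DirectSum.IsInternal ℳ := by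
  constructor
  · rw [injective_iff_map_eq_zero]
    intro x hx
    have key (i : ℤ) : p i (DirectSum.coeAddMonoidHom ℳ x) = x i := by
      clear hx
      induction x using DirectSum.induction_on with
      | zero => simp
      | add x y hx hy => rw [map_add, map_add, hx, hy]; rfl
      | of j m =>
        rw [DirectSum.coeAddMonoidHom_of, ← (hmem j m).1 m.2]
        by_cases hij : i = j
        · subst hij
          rw [hidem, (hmem i m).1 m.2, DirectSum.of_eq_same]
        · rw [hortho _ _ _ hij, DirectSum.of_eq_of_ne _ _ _ hij]
          rfl
    refine DFinsupp.ext fun i => Subtype.ext ?_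
    rw [← key i, hx, map_zero]
    rfl
  · intro m
    refine ⟨∑ i ∈ S, DirectSum.of (fun i => ℳ i) i ⟨p i m, (hmem _ _).2 (hidem _ _)⟩, ?_⟩
    rw [map_sum]
    simp only [DirectSum.coeAddMonoidHom_of]
    exact hS m

namespace CategoryTheory

open CategoryAlgebra

namespace LengthFunction

variable (k : Type w) [Field k] {E : Type u} [Category.{v} E] (L : LengthFunction E)

/-- The projections of the length grading, indexed by the integers. -/
noncomputable def intProj (i : ℤ) : CategoryAlgebra k E →ₗ[k] CategoryAlgebra k E :=
  if 0 ≤ i then L.proj k i.toNat else 0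

variable {k}

lemma intProj_natCast (n : ℕ) : L.intProj k n = L.proj k n := by
  rw [intProj, if_pos (by omega), Int.toNat_natCast]

lemma intProj_intProj (i j : ℤ) (a : CategoryAlgebra k E) :
    L.intProj k i (L.intProj k j a) = if i = j then L.intProj k i a else 0 := by
  unfold intProj
  by_cases hj : 0 ≤ j
  · by_cases hi : 0 ≤ i
    · rw [if_pos hi, if_pos hj, proj_proj]
      have : i.toNat = j.toNat ↔ i = j := by omega
      simp only [this]
    · simp [hi]
  · by_cases hi : 0 ≤ i
    · rw [if_neg hj, LinearMap.zero_apply, map_zero, if_neg (by omega)]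
    · simp [hi]

variable (k) in
/-- The length grading, indexed by the integers. -/
def intGrading (i : ℤ) : AddSubgroup (CategoryAlgebra k E) where
  carrier := {a | L.intProj k i a = a}
  add_mem' {a b} ha hb := by rw [Set.mem_ofPred_eq] at *; rw [map_add, ha, hb]
  zero_mem' := map_zero _
  neg_mem' {a} ha := by rw [Set.mem_ofPred_eq] at *; rw [map_neg, ha]

lemma mem_intGrading_iff (i : ℤ) (a : CategoryAlgebra k E) :
    a ∈ L.intGrading k i ↔ L.intProj k i a = a := Iff.rfl

lemma mul_mem_intGrading (i : ℕ) (j : ℤ) (a b : CategoryAlgebra k E)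
    (ha : a ∈ lengthGrading k E i) (hb : b ∈ L.intGrading k j) :
    a * b ∈ L.intGrading k (i + j) := by
  rw [mem_intGrading_iff] at *
  by_cases hj : 0 ≤ j
  · obtain ⟨n, rfl⟩ := Int.eq_ofNat_of_zero_le hj
    rw [intProj_natCast] at hb
    rw [← Nat.cast_add, intProj_natCast, add_comm, L.proj_add_mul n i ha, hb]
  · rw [intProj, if_neg hj, LinearMap.zero_apply] at hb
    rw [← hb, mul_zero, map_zero]

section

variable [Finite E]

lemma intProj_mem_positivePart (i : ℤ) {a : CategoryAlgebra k E}
    (ha : a ∈ positivePart (lengthGrading k E)) :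
    L.intProj k i a ∈ positivePart (lengthGrading k E) := by
  rw [L.mem_positivePart_iff] at *
  rw [← Nat.cast_zero, ← intProj_natCast] at *
  rw [intProj_intProj]
  split_ifs
  · exact ha
  · rfl

/-- The length grading of the left ideal spanned by the non-isomorphisms. -/
noncomputable def intGradingPositivePart (i : ℤ) : AddSubgroup (positivePart (lengthGrading k E)) :=
  (L.intGrading k i).comap (positivePart (lengthGrading k E)).subtype.toAddMonoidHom

variable [∀ x y : E, Finite (x ⟶ y)]

variable (k) in
lemma exists_sum_intProj :
    ∃ S : Finset ℤ, ∀ a : CategoryAlgebra k E, ∑ i ∈ S, L.intProj k i a = a := by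
  obtain ⟨N, hN⟩ := L.exists_bound
  refine ⟨(Finset.range N).map Nat.castEmbedding, fun a => ?_⟩
  rw [Finset.sum_map]
  simp only [Nat.castEmbedding_apply, intProj_natCast]
  exact L.sum_proj hN a

lemma isGradedModule_intGrading : IsGradedModule (lengthGrading k E) (L.intGrading k) where
  isInternal := by
    obtain ⟨S, hS⟩ := L.exists_sum_intProj k
    exact DirectSum.isInternal_of_projections (fun i => (L.intProj k i).toAddMonoidHom)
      (fun i m => Iff.rfl) (fun i m => (L.intProj_intProj i i m).trans (if_pos rfl))
      (fun i j m h => (L.intProj_intProj i j m).trans (if_neg h)) S hS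
  smul_mem := L.mul_mem_intGrading

lemma isGradedModule_intGradingPositivePart :
    IsGradedModule (lengthGrading k E) (L.intGradingPositivePart (k := k)) where
  isInternal := by
    obtain ⟨S, hS⟩ := L.exists_sum_intProj k
    refine DirectSum.isInternal_of_projections
      (fun i =>
        { toFun := fun a => ⟨L.intProj k i a, L.intProj_mem_positivePart i a.2⟩
          map_zero' := by ext; simp
          map_add' := fun a b => by ext; simp })
      (fun i m => ?_) (fun i m => ?_) (fun i j m h => ?_) S (fun m => ?_)
    · rw [Subtype.ext_iff]
      rfl
    · exact Subtype.ext ((L.intProj_intProj i i m.1).trans (if_pos rfl))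
    · exact Subtype.ext ((L.intProj_intProj i j m.1).trans (if_neg h))
    · refine Subtype.ext ?_
      rw [AddSubmonoidClass.coe_finsetSum]
      exact hS m
  smul_mem i j a m ha hm := L.mul_mem_intGrading i j a m ha hm

lemma generatedInDegree_intGrading :
    GeneratedInDegree (CategoryAlgebra k E) (L.intGrading k) 0 := by
  have := Fintype.ofFinite E
  refine Ideal.eq_top_of_isUnit_mem _ (Submodule.subset_span ?_) isUnit_one
  rw [SetLike.mem_coe, mem_intGrading_iff, ← Nat.cast_zero, intProj_natCast, one_def, map_sum]
  refine Finset.sum_congr rfl fun x _ => ?_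
  rw [proj_of, if_pos (L.len_isIso _)]

/-- Every non-isomorphism is a left multiple of its first factor, which has length one. -/
lemma generatedInDegree_intGradingPositivePart :
    GeneratedInDegree (CategoryAlgebra k E) (L.intGradingPositivePart (k := k)) 1 := by
  set T := Submodule.span (CategoryAlgebra k E) 
    (L.intGradingPositivePart (k := k) 1 : Set (positivePart (lengthGrading k E)))
  have key : ∀ a ∈ positivePart (lengthGrading k E), a ∈ T.map (Submodule.subtype _) := by
    intro a ha
    refine L.positivePart_induction (motive := fun a => a ∈ T.map (Submodule.subtype _))
      (zero_mem _) (fun a b => add_mem) (fun c x y α hα => ?_) ha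
    refine Submodule.smul_of_tower_mem _ c ?_
    obtain ⟨n, hn⟩ := Nat.exists_eq_succ_of_ne_zero hα
    obtain ⟨z, p, q, hp, -, rfl⟩ := L.exists_first α n hn
    rw [of_comp, ← smul_eq_mul]
    refine Submodule.smul_mem _ _ ⟨⟨of k p, L.mem_positivePart_of_pos (by omega)⟩, ?_, rfl⟩
    refine Submodule.subset_span ?_
    change of k p ∈ L.intGrading k 1
    rw [mem_intGrading_iff, ← Nat.cast_one, intProj_natCast, proj_of, if_pos hp]
  refine eq_top_iff.2 fun a _ => ?_
  obtain ⟨b, hb, hba⟩ := key a a.2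
  rwa [← Subtype.ext (a1 := b) (a2 := a) hba]

end

end LengthFunction

end CategoryTheory

/-! ### The Koszul resolution of length one -/

section

variable {k : Type u} [Field k] {A : Type w} [Ring A] [Algebra k A] (𝒜 : ℕ → Submodule k A)
  {M : Type w} [AddCommGroup M] [Module A M]

lemma isGradedModule_top_of_subsingleton [Subsingleton M] :
    IsGradedModule 𝒜 (fun _ : ℤ => (⊤ : AddSubgroup M)) where
  isInternal := DirectSum.isInternal_of_projections (fun _ => 0)
    (fun _ _ => ⟨fun _ => Subsingleton.elim _ _, fun _ => trivial⟩) (fun _ _ => rfl)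
    (fun _ _ _ _ => rfl) ∅ (fun _ => Subsingleton.elim _ _)
  smul_mem _ _ _ _ _ _ := trivial

lemma isGradedModule_concentratedInDegreeZero
    (h : ∀ (i : ℕ) (a : A) (m : M), a ∈ 𝒜 (i + 1) → a • m = 0) :
    IsGradedModule 𝒜 (concentratedInDegreeZero M) where
  isInternal := by
    refine DirectSum.isInternal_of_projections (fun i => if i = 0 then AddMonoidHom.id M else 0)
      (fun i m => ?_) (fun i m => ?_) (fun i j m h => ?_) {0} (fun m => by simp)
    · rw [concentratedInDegreeZero]
      split_ifs
      · simp
      · simp [eq_comm]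
    · split_ifs <;> rfl
    · split_ifs <;> first | omega | rfl
  smul_mem i j a m ha hm := by
    rw [concentratedInDegreeZero] at *
    split_ifs at hm with hj
    · obtain _ | i := i
      · rw [if_pos (by simp [hj])]
        trivial
      · rw [h i a m ha]
        exact zero_mem _
    · rw [AddSubgroup.mem_bot.1 hm, smul_zero]
      exact zero_mem _

end

namespace CategoryTheory

open CategoryAlgebra

namespace LengthFunction

variable {k : Type w} [Field k] {E : Type u} [Category.{v} E] [Finite E] (L : LengthFunction E)
  [∀ x y : E, Finite (x ⟶ y)]

variable (k E) in
/-- The terms of the resolution of the degree zero component by the category algebra and the left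
ideal spanned by the non-isomorphisms. -/
noncomputable def resolutionTerm : ℕ → ModuleCat.{max u v w} (CategoryAlgebra k E)
  | 0 => ModuleCat.of _ (CategoryAlgebra k E)
  | 1 => ModuleCat.of _ (positivePart (lengthGrading k E))
  | _ + 2 => ModuleCat.of _ PUnit

/-- The gradings of the terms of the resolution. -/
noncomputable def resolutionGrading : ∀ n, ℤ → AddSubgroup (resolutionTerm k E n)
  | 0 => L.intGrading k
  | 1 => L.intGradingPositivePart
  | _ + 2 => fun _ => ⊤

variable (k E) in
/-- The differentials of the resolution. -/
noncomputable def resolutionDifferential :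
    ∀ n, resolutionTerm k E (n + 1) →ₗ[CategoryAlgebra k E] resolutionTerm k E n
  | 0 => (positivePart (lengthGrading k E)).subtype
  | _ + 1 => 0

variable (k E) in
/-- The augmentation of the resolution. -/
noncomputable def resolutionAugmentation :
    resolutionTerm k E 0 →ₗ[CategoryAlgebra k E] DegreeZeroModule (lengthGrading k E) :=
  show CategoryAlgebra k E →ₗ[CategoryAlgebra k E] _ from (positivePart (lengthGrading k E)).mkQ

include L in
theorem isKoszulAlgebra
    [Module.Projective (CategoryAlgebra k E) (positivePart (lengthGrading k E))] :
    IsKoszulAlgebra (lengthGrading k E) where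
  graded := by
    refine isGradedModule_concentratedInDegreeZero _ fun i a m ha => ?_
    obtain ⟨b, rfl⟩ := Submodule.mkQ_surjective _ m
    rw [← map_smul, smul_eq_mul, ← LinearMap.mem_ker, Submodule.ker_mkQ]
    exact L.mul_mem_positivePart_left (Ideal.subset_span (Set.mem_iUnion.2 ⟨i, ha⟩)) b
  generated := by
    rw [GeneratedInDegree, concentratedInDegreeZero, if_pos rfl]
    exact Submodule.span_univ
  resolution := by
    have hε (a : CategoryAlgebra k E) : (positivePart (lengthGrading k E)).mkQ a = 0 ↔
        L.proj k 0 a = 0 := by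
      rw [← LinearMap.mem_ker, Submodule.ker_mkQ, L.mem_positivePart_iff]
    refine ⟨resolutionTerm k E, L.resolutionGrading, resolutionDifferential k E,
      resolutionAugmentation k E, ?_, ?_, ?_, ?_, ?_, ?_, ?_,
      Submodule.mkQ_surjective _⟩
    · rintro (_ | _ | n)
      · exact inferInstanceAs (Module.Projective _ (CategoryAlgebra k E))
      · exact inferInstanceAs (Module.Projective _ (positivePart (lengthGrading k E)))
      · exact inferInstanceAs (Module.Projective (CategoryAlgebra k E) PUnit.{max u v w + 1})
    · rintro (_ | _ | n)
      · exact L.isGradedModule_intGrading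
      · exact L.isGradedModule_intGradingPositivePart
      · exact isGradedModule_top_of_subsingleton (M := PUnit.{max u v w + 1}) _
    · rintro (_ | _ | n)
      · exact L.generatedInDegree_intGrading
      · exact L.generatedInDegree_intGradingPositivePart
      · exact Submodule.span_univ
    · rintro (_ | n) i p hp
      · exact hp
      · exact zero_mem _
    · intro i p hp
      rw [concentratedInDegreeZero]
      split_ifs with hi
      · trivial
      · replace hp : L.intProj k i p = p := hp
        refine AddSubgroup.mem_bot.2 ((hε p).2 ?_)
        have h := L.intProj_intProj (k := k) (0 : ℕ) i p
        rw [if_neg (by exact fun h => hi h.symm), hp, intProj_natCast] at h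
        exact h
    · rintro (_ | n) x
      · refine ⟨fun hx => ⟨0, ?_⟩, ?_⟩
        · exact (Subtype.ext hx : x = 0).symm ▸ rfl
        · rintro ⟨y, rfl⟩
          rfl
      · exact ⟨fun _ => ⟨0, rfl⟩, fun _ => rfl⟩
    · intro x
      refine (hε x).trans (L.mem_positivePart_iff.symm.trans ⟨fun h => ⟨⟨x, h⟩, rfl⟩, ?_⟩)
      rintro ⟨y, rfl⟩
      exact y.2

end LengthFunction

end CategoryTheory

/-! ### From a Koszul resolution to projectivity in degree one -/

lemma DirectSum.IsInternal.exists_projections {M : Type*} [AddCommGroup M] {ℳ : ℤ → AddSubgroup M}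
    (h : DirectSum.IsInternal ℳ) :
    ∃ p : ℤ → M →+ M, (∀ i m, p i m ∈ ℳ i) ∧ (∀ i, ∀ m ∈ ℳ i, p i m = m) ∧
      (∀ i j, ∀ m ∈ ℳ j, i ≠ j → p i m = 0) := by
  let e := (AddEquiv.ofBijective _ h).symm
  have he (i : ℤ) (m : M) (hm : m ∈ ℳ i) : e m = DirectSum.of (fun i => ℳ i) i ⟨m, hm⟩ := by
    rw [AddEquiv.symm_apply_eq]
    exact (DirectSum.coeAddMonoidHom_of ℳ i ⟨m, hm⟩).symm
  refine ⟨fun i => (ℳ i).subtype.comp ((DFinsupp.evalAddMonoidHom i).comp e.toAddMonoidHom),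
    fun i m => SetLike.coe_mem _, fun i m hm => ?_, fun i j m hm hij => ?_⟩
  · change ((e m) i : M) = m
    rw [he i m hm, DirectSum.of_eq_same]
  · change ((e m) i : M) = 0
    rw [he j m hm, DirectSum.of_eq_of_ne _ _ _ hij]
    rfl

lemma DirectSum.IsInternal.addMonoidHom_ext {M N : Type*} [AddCommGroup M] [AddCommGroup N]
    {ℳ : ℤ → AddSubgroup M} (h : DirectSum.IsInternal ℳ) {f g : M →+ N}
    (hfg : ∀ i, ∀ m ∈ ℳ i, f m = g m) : f = g := by
  ext m
  obtain ⟨x, rfl⟩ := h.2 m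
  induction x using DirectSum.induction_on with
  | zero => simp
  | add x y hx hy => rw [map_add, map_add, map_add, hx, hy]
  | of i m => rw [DirectSum.coeAddMonoidHom_of, hfg i m m.2]

namespace CategoryTheory

open CategoryAlgebra

namespace LengthFunction

variable {k : Type w} [Field k] {E : Type u} [Category.{v} E] [Finite E] (L : LengthFunction E)

lemma proj_isEquivariantAt (n : ℕ) (y : E) : IsEquivariantAt y (L.proj k n) := fun g a => by
  have h := L.of_mem (k := k) g.hom
  rw [L.len_isIso (h := Iso.isIso_hom g)] at h
  exact L.proj_add_mul n 0 h a

lemma proj_zero_one : L.proj k 0 1 = 1 := by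
  have := Fintype.ofFinite E
  rw [one_def, map_sum]
  refine Finset.sum_congr rfl fun x _ => ?_
  rw [proj_of, if_pos (L.len_isIso _)]

include L in
lemma algebraMap_mem (c : k) :
    algebraMap k (CategoryAlgebra k E) c ∈ lengthGrading k E 0 := by
  rw [Algebra.algebraMap_eq_smul_one]
  exact Submodule.smul_mem _ _ (L.proj_zero_one (k := k) ▸ L.proj_mem 0 _)

/-- The part of degree zero at `y` is the regular representation of `Aut y`. Its projectivity is
witnessed by `θ` extracting the coefficient of the identity: the only surviving term in the trace of
`α` is `g = α`. -/
lemma exists_relTrace_eq_proj_zero (hs : Skeletal E) (hEI : ∀ (x : E) (f : x ⟶ x), IsIso f) (y : E)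
    [Fintype (Aut y)] :
    ∃ θ : CategoryAlgebra k E →ₗ[k] CategoryAlgebra k E,
      ∀ a, relTrace y θ a = of k (𝟙 y) * L.proj k 0 a := by
  classical
  let θ : CategoryAlgebra k E →ₗ[k] CategoryAlgebra k E :=
    (basis k E).constr k fun m => if m = ⟨y, y, 𝟙 y⟩ then of k (𝟙 y) else 0
  have hθ {x z : E} (α : x ⟶ z) : θ (of k α) =
      if (⟨x, z, α⟩ : Σ x z : E, x ⟶ z) = ⟨y, y, 𝟙 y⟩ then of k (𝟙 y) else 0 := by
    rw [of, Module.Basis.constr_basis]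
  refine ⟨θ, fun a => LinearMap.congr_fun (g := LinearMap.mulLeft k (of k (𝟙 y)) ∘ₗ L.proj k 0)
    (hom_ext fun {x z} α => ?_) a⟩
  rw [relTrace_apply, LinearMap.comp_apply, LinearMap.mulLeft_apply, proj_of]
  by_cases hz : z = y
  · subst hz
    by_cases hx : x = z
    · subst hx
      have := hEI x α
      rw [if_pos (L.len_isIso α), of_id_mul_of]
      let a : Aut x := asIso α
      rw [Fintype.sum_eq_single a]
      · rw [smul_eq_mul, smul_eq_mul, of_mul_of_comp, hθ]
        have h1 : α ≫ a.inv = 𝟙 x := a.hom_inv_id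
        rw [h1, if_pos rfl, of_mul_of_id]
        rfl
      · intro g hg
        rw [smul_eq_mul, smul_eq_mul, of_mul_of_comp, hθ, if_neg, mul_zero]
        intro h
        apply hg
        have h2 : α ≫ g.inv = 𝟙 x := by simpa using h
        refine Iso.ext ?_
        change g.hom = α
        have h3 : (α ≫ g.inv) ≫ g.hom = α := by
          rw [Category.assoc, g.inv_hom_id, Category.comp_id]
        rw [← h3, h2, Category.id_comp]
    · have h1 : L.len α ≠ 0 := fun h => hx (by
        rw [L.len_eq_zero_iff] at h
        exact hs ⟨asIso α⟩)
      rw [if_neg h1, mul_zero]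
      refine Finset.sum_eq_zero fun g _ => ?_
      rw [smul_eq_mul, smul_eq_mul, of_mul_of_comp, hθ, if_neg, mul_zero]
      intro h
      exact hx (Sigma.mk.inj h).1
  · have h1 : of k (𝟙 y) * (if L.len α = 0 then of k α else 0) = 0 := by
      split_ifs
      · exact of_mul_of_ne _ _ _ hz
      · rw [mul_zero]
    rw [h1]
    refine Finset.sum_eq_zero fun g _ => ?_
    rw [smul_eq_mul (of k g.inv), of_mul_of_ne _ _ _ hz, map_zero, smul_zero]

variable {P₀ P₁ P₂ : Type (max u v w)}
  [AddCommGroup P₀] [Module k P₀] [Module (CategoryAlgebra k E) P₀]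
  [IsScalarTower k (CategoryAlgebra k E) P₀]
  [AddCommGroup P₁] [Module k P₁] [Module (CategoryAlgebra k E) P₁]
  [IsScalarTower k (CategoryAlgebra k E) P₁]
  [AddCommGroup P₂] [Module (CategoryAlgebra k E) P₂]
  [∀ x y : E, Finite (x ⟶ y)]

include L in
lemma projection_eq_zero_of_generatedInDegree {𝒬 : ℤ → AddSubgroup P₂}
    (h𝒬 : IsGradedModule (lengthGrading k E) 𝒬) {s : ℤ}
    (hgen : GeneratedInDegree (CategoryAlgebra k E) 𝒬 s) {i : ℤ} (hi : i < s) {p : P₂ →+ P₂}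
    (hp : ∀ j, ∀ m ∈ 𝒬 j, i ≠ j → p m = 0) (m : P₂) : p m = 0 := by
  have hm : m ∈ Submodule.span (CategoryAlgebra k E) (𝒬 s : Set P₂) := hgen ▸ trivial
  induction hm using Submodule.closure_induction with
  | zero => simp
  | add x y _ _ hx hy => rw [map_add, hx, hy, add_zero]
  | smul_mem a m hm =>
    obtain ⟨N, hN⟩ := L.exists_bound
    rw [← L.sum_proj hN a, Finset.sum_smul, map_sum]
    exact Finset.sum_eq_zero fun n _ =>
      hp _ _ (h𝒬.smul_mem n s _ m (L.proj_mem n a) hm) (by omega)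

/-- `P₂` has no part of degree one, so `d₀` is injective on that part of `P₁`. Choosing `p` of
degree zero over the class of `1`, each `a` in `kE_1` gives a unique lift of `a • p` to `P₁`. This
embeds `kE_1` in the degree one part of `P₁`, and a splitting of `P₁` from a free module exhibits it
as a retract of copies of `kE_0`. -/
theorem degreeOneProjective_of_presentation (hs : Skeletal E)
    (hEI : ∀ (x : E) (f : x ⟶ x), IsIso f) [∀ y : E, Fintype (Aut y)]
    [Module.Projective (CategoryAlgebra k E) P₀] [Module.Projective (CategoryAlgebra k E) P₁]
    {𝒬₀ : ℤ → AddSubgroup P₀} {𝒬₁ : ℤ → AddSubgroup P₁} {𝒬₂ : ℤ → AddSubgroup P₂}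
    (h𝒬₀ : IsGradedModule (lengthGrading k E) 𝒬₀) (h𝒬₁ : IsGradedModule (lengthGrading k E) 𝒬₁)
    (h𝒬₂ : IsGradedModule (lengthGrading k E) 𝒬₂)
    (hgen : GeneratedInDegree (CategoryAlgebra k E) 𝒬₂ 2)
    {d₀ : P₁ →ₗ[CategoryAlgebra k E] P₀} {d₁ : P₂ →ₗ[CategoryAlgebra k E] P₁}
    {ε : P₀ →ₗ[CategoryAlgebra k E] DegreeZeroModule (lengthGrading k E)}
    (hd₀ : ∀ i, ∀ p ∈ 𝒬₁ i, d₀ p ∈ 𝒬₀ i) (hd₁ : ∀ i, ∀ p ∈ 𝒬₂ i, d₁ p ∈ 𝒬₁ i)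
    (hε : ∀ i, ∀ p ∈ 𝒬₀ i, ε p ∈ concentratedInDegreeZero (DegreeZeroModule (lengthGrading k E)) i)
    (hex₁ : Function.Exact d₁ d₀) (hex₀ : Function.Exact d₀ ε) (hsurj : Function.Surjective ε) :
    L.DegreeOneProjective k := by
  obtain ⟨c₀, hc₀, hc₀', hc₀''⟩ := h𝒬₀.isInternal.exists_projections
  obtain ⟨c₁, hc₁, hc₁', hc₁''⟩ := h𝒬₁.isInternal.exists_projections
  obtain ⟨c₂, hc₂, hc₂', hc₂''⟩ := h𝒬₂.isInternal.exists_projections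
  have hdc₀ (m : P₁) : d₀ (c₁ 1 m) = c₀ 1 (d₀ m) := by
    refine DFunLike.congr_fun (h𝒬₁.isInternal.addMonoidHom_ext
      (f := d₀.toAddMonoidHom.comp (c₁ 1)) (g := (c₀ 1).comp d₀.toAddMonoidHom)
      fun i m hm => ?_) m
    change d₀ (c₁ 1 m) = c₀ 1 (d₀ m)
    by_cases h : 1 = i
    · subst h
      rw [hc₁' _ _ hm, hc₀' _ _ (hd₀ _ _ hm)]
    · rw [hc₁'' _ _ _ hm h, hc₀'' _ _ _ (hd₀ _ _ hm) h, map_zero]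
  have hdc₁ (m : P₂) : c₁ 1 (d₁ m) = 0 := by
    refine Eq.trans (DFunLike.congr_fun (h𝒬₂.isInternal.addMonoidHom_ext
      (f := (c₁ 1).comp d₁.toAddMonoidHom) (g := d₁.toAddMonoidHom.comp (c₂ 1))
      fun i m hm => ?_) m) ?_
    · change c₁ 1 (d₁ m) = d₁ (c₂ 1 m)
      by_cases h : 1 = i
      · subst h
        rw [hc₂' _ _ hm, hc₁' _ _ (hd₁ _ _ hm)]
      · rw [hc₂'' _ _ _ hm h, hc₁'' _ _ _ (hd₁ _ _ hm) h, map_zero]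
    · change d₁ (c₂ 1 m) = 0
      rw [L.projection_eq_zero_of_generatedInDegree h𝒬₂ hgen (i := 1) (by omega) (hc₂'' 1), map_zero]
  have huniq (v : P₁) (hv : v ∈ 𝒬₁ 1) (h : d₀ v = 0) : v = 0 := by
    obtain ⟨m, rfl⟩ := (hex₁ v).1 h
    rw [← hc₁' _ _ hv, hdc₁]
  have hker (a : CategoryAlgebra k E) : (positivePart (lengthGrading k E)).mkQ a = 0 ↔
      L.proj k 0 a = 0 := by
    rw [← LinearMap.mem_ker, Submodule.ker_mkQ, L.mem_positivePart_iff]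
  obtain ⟨p, hp, hεp⟩ : ∃ p ∈ 𝒬₀ 0, ε p = (positivePart (lengthGrading k E)).mkQ 1 := by
    obtain ⟨p, hp⟩ := hsurj ((positivePart (lengthGrading k E)).mkQ 1)
    refine ⟨c₀ 0 p, hc₀ _ _, ?_⟩
    rw [← hp]
    refine DFunLike.congr_fun (h𝒬₀.isInternal.addMonoidHom_ext
      (f := ε.toAddMonoidHom.comp (c₀ 0)) (g := ε.toAddMonoidHom) fun i m hm => ?_) p
    change ε (c₀ 0 m) = ε m
    by_cases h : 0 = i
    · subst h
      rw [hc₀' _ _ hm]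
    · have h1 := hε i m hm
      rw [concentratedInDegreeZero, if_neg (Ne.symm h), AddSubgroup.mem_bot] at h1
      rw [hc₀'' _ _ _ hm h, h1, map_zero]
  -- This lift need not respect the gradings; only its components in degrees zero and one are used
  -- afterwards.
  obtain ⟨ψ, hψ⟩ := Module.projective_lifting_property
    (positivePart (lengthGrading k E)).mkQ ε (Submodule.mkQ_surjective _)
  replace hψ (m : P₀) : (positivePart (lengthGrading k E)).mkQ (ψ m) = ε m :=
    LinearMap.congr_fun hψ m
  have hψp : L.proj k 0 (ψ p) = 1 := by
    have h := (hker (ψ p - 1)).1 (by rw [map_sub, hψ, hεp, sub_self])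
    rwa [map_sub, proj_zero_one, sub_eq_zero] at h
  have hψd (m : P₁) : L.proj k 0 (ψ (d₀ m)) = 0 := by
    rw [← hker, hψ]
    exact (hex₀ _).2 ⟨m, rfl⟩
  have hlift (a : CategoryAlgebra k E) : ∃ v ∈ 𝒬₁ 1, d₀ v = L.proj k 1 a • p := by
    obtain ⟨m, hm⟩ := (hex₀ (L.proj k 1 a • p)).1 (by
      rw [map_smul, hεp, ← map_smul, smul_eq_mul, mul_one, hker, proj_proj, if_neg zero_ne_one])
    refine ⟨c₁ 1 m, hc₁ _ _, ?_⟩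
    rw [hdc₀, hm]
    exact hc₀' _ _ (h𝒬₀.smul_mem 1 0 _ p (L.proj_mem 1 a) hp)
  choose f hf hdf using hlift
  have hfeq (a : CategoryAlgebra k E) (v : P₁) (hv : v ∈ 𝒬₁ 1) (h : d₀ v = L.proj k 1 a • p) :
      f a = v := by
    rw [← sub_eq_zero]
    exact huniq _ (sub_mem (hf a) hv) (by rw [map_sub, hdf, h, sub_self])
  have hsmul {b : CategoryAlgebra k E} (hb : b ∈ lengthGrading k E 0) (a : CategoryAlgebra k E) :
      f (b * a) = b • f a := by
    refine hfeq _ _ (h𝒬₁.smul_mem 0 1 b _ hb (hf a)) ?_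
    rw [map_smul, hdf, ← mul_smul]
    congr 1
    exact (L.proj_add_mul 1 0 hb a).symm
  let c : CategoryAlgebra k E →ₗ[k] P₁ :=
    { toFun := f
      map_add' := fun a b => hfeq _ _ (add_mem (hf a) (hf b)) (by
        rw [map_add, map_add, hdf, hdf, add_smul])
      map_smul' := fun r a => by
        rw [RingHom.id_apply, Algebra.smul_def, hsmul (L.algebraMap_mem r), algebraMap_smul] }
  obtain ⟨s, hs'⟩ := Module.projective_def'.1
    (show Module.Projective (CategoryAlgebra k E) P₁ from inferInstance)
  replace hs' (m : P₁) : Finsupp.linearCombination (CategoryAlgebra k E) id (s m) = m :=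
    LinearMap.congr_fun hs' m
  intro y
  have hc : IsEquivariantAt y c := fun g a => by
    have h := L.of_mem (k := k) g.hom
    rw [L.len_isIso (h := Iso.isIso_hom g)] at h
    exact hsmul h a
  obtain ⟨θ, hθ⟩ := L.exists_relTrace_eq_proj_zero (k := k) hs hEI y
  let q : (P₁ →₀ CategoryAlgebra k E) →ₗ[CategoryAlgebra k E] CategoryAlgebra k E :=
    ψ ∘ₗ d₀ ∘ₗ Finsupp.linearCombination (CategoryAlgebra k E) id
  -- Since `ψ ∘ d₀` lands in the ideal of positive degree, the degree one part of `q m` depends only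
  -- on the coefficients of `m` in degree zero, where traces are available.
  have hq (m : P₁ →₀ CategoryAlgebra k E) :
      L.proj k 1 (q (Finsupp.mapRange.linearMap (L.proj k 0) m)) = L.proj k 1 (q m) := by
    induction m using Finsupp.induction_linear with
    | zero => simp
    | add m m' h h' => rw [map_add, map_add, map_add, h, h', map_add, map_add]
    | single x a =>
      simp only [Finsupp.mapRange.linearMap_apply, Finsupp.mapRange_single, q,
        LinearMap.comp_apply, Finsupp.linearCombination_single, id_eq, map_smul, smul_eq_mul]
      rw [proj_one_mul, proj_one_mul, hψd, mul_zero, mul_zero, proj_proj, if_pos rfl]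
  refine ⟨(L.proj k 1 ∘ₗ q.restrictScalars k) ∘ₗ Finsupp.mapRange.linearMap θ ∘ₗ
    (s.restrictScalars k ∘ₗ c), fun a => ?_⟩
  have hqe : IsEquivariantAt y (L.proj k 1 ∘ₗ q.restrictScalars k) :=
    (L.proj_isEquivariantAt 1 y).comp (.of_linearMap q)
  have hθF (m : P₁ →₀ CategoryAlgebra k E) :
      relTrace y (Finsupp.mapRange.linearMap (α := P₁) θ) m =
        of k (𝟙 y) • Finsupp.mapRange.linearMap (L.proj k 0) m := by
    ext x
    have := hθ (m x)
    rw [relTrace_apply] at this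
    rw [relTrace_apply, Finsupp.finsetSum_apply]
    simpa using this
  rw [relTrace_comp hqe (.comp (.of_linearMap s) hc), hθF, hqe.map_id, smul_eq_mul]
  congr 1
  change L.proj k 1 (q (Finsupp.mapRange.linearMap (L.proj k 0) (s (f a)))) = _
  rw [hq]
  change L.proj k 1 (ψ (d₀ (Finsupp.linearCombination _ id (s (f a))))) = _
  rw [hs', hdf, map_smul, smul_eq_mul, proj_one_mul, hψp, mul_one, proj_proj, proj_proj,
    if_neg zero_ne_one, if_pos rfl, zero_mul, zero_add]

theorem degreeOneProjective_of_isKoszulAlgebra (hs : Skeletal E)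
    (hEI : ∀ (x : E) (f : x ⟶ x), IsIso f) [∀ y : E, Fintype (Aut y)]
    (h : IsKoszulAlgebra (lengthGrading k E)) : L.DegreeOneProjective k := by
  obtain ⟨P, 𝒬, d, ε, hP, h𝒬, hgen, hd, hε, hex, hex₀, hsurj⟩ := h.resolution
  let _ (n : ℕ) : Module k (P n) := Module.compHom (P n) (algebraMap k (CategoryAlgebra k E))
  have (n : ℕ) : IsScalarTower k (CategoryAlgebra k E) (P n) :=
    IsScalarTower.of_algebraMap_smul fun _ _ => rfl
  have := hP 0
  have := hP 1
  exact L.degreeOneProjective_of_presentation hs hEI (h𝒬 0) (h𝒬 1) (h𝒬 2) (hgen 2) (hd 0) (hd 1)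
    hε (hex 0) hex₀ hsurj

end LengthFunction

end CategoryTheory

/-! ### From finite projective dimension to projectivity over the automorphism groups -/

lemma projective_idempotentProjective {A : Type w} [Ring A] {e : A} (he : IsIdempotentElem e) :
    Module.Projective A (idempotentProjective e) := by
  have hmem (a : A) : LinearMap.toSpanSingleton A A e a ∈ idempotentProjective e :=
    Submodule.smul_mem _ _ (Submodule.mem_span_singleton_self e)
  refine Module.Projective.of_split (idempotentProjective e).subtype
    ((LinearMap.toSpanSingleton A A e).codRestrict _ hmem) (LinearMap.ext fun a => Subtype.ext ?_)
  obtain ⟨b, hb⟩ := Submodule.mem_span_singleton.1 a.2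
  change (a : A) * e = a
  rw [← hb, smul_eq_mul, mul_assoc, he]

namespace CategoryTheory

open CategoryAlgebra

namespace CategoryAlgebra

variable (k : Type w) [Field k] {E : Type u} [Category.{v} E] [Finite E]

open Classical in
/-- The sum of the identities of the objects in a set. -/
noncomputable def setIdempotent (s : Set E) : CategoryAlgebra k E :=
  letI := Fintype.ofFinite E
  ∑ z : E, if z ∈ s then of k (𝟙 z) else 0

variable {k}

open Classical in
lemma setIdempotent_mul_of (s : Set E) {x z : E} (α : x ⟶ z) :
    setIdempotent k s * of k α = if z ∈ s then of k α else 0 := by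
  let := Fintype.ofFinite E
  rw [setIdempotent, Finset.sum_mul, Finset.sum_eq_single z]
  · rw [ite_mul, zero_mul, of_id_mul_of]
  · intro w _ hw
    rw [ite_mul, zero_mul, of_mul_of_ne _ _ _ hw.symm, ite_self]
  · simp

open Classical in
lemma of_mul_setIdempotent (s : Set E) {x z : E} (α : x ⟶ z) :
    of k α * setIdempotent k s = if x ∈ s then of k α else 0 := by
  let := Fintype.ofFinite E
  rw [setIdempotent, Finset.mul_sum, Finset.sum_eq_single x]
  · rw [mul_ite, mul_zero, of_mul_of_id]
  · intro w _ hw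
    rw [mul_ite, mul_zero, of_mul_of_ne _ _ _ hw, ite_self]
  · simp

/-- A set of objects that contains the targets of the morphisms starting in it. -/
def IsUpwardClosed (s : Set E) : Prop := ∀ {x z : E}, (x ⟶ z) → x ∈ s → z ∈ s

lemma IsUpwardClosed.mul_mul {s : Set E} (hs : IsUpwardClosed s) (a : CategoryAlgebra k E) :
    setIdempotent k s * (a * setIdempotent k s) = a * setIdempotent k s := by
  classical
  induction a using CategoryAlgebra.induction with
  | zero => simp
  | add a b ha hb => rw [add_mul, mul_add, ha, hb]
  | smul_of c α =>
    rw [smul_mul', mul_smul', of_mul_setIdempotent]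
    split_ifs with h
    · rw [setIdempotent_mul_of, if_pos (hs α h)]
    · rw [mul_zero]

lemma isIdempotentElem_setIdempotent (s : Set E) : IsIdempotentElem (setIdempotent k s) := by
  classical
  let := Fintype.ofFinite E
  rw [IsIdempotentElem]
  nth_rw 2 3 [setIdempotent]
  rw [Finset.mul_sum]
  refine Finset.sum_congr rfl fun z _ => ?_
  split_ifs with h
  · rw [setIdempotent_mul_of, if_pos h]
  · rw [mul_zero]

variable (y : E) [Fintype (Aut y)]

variable (k) in
/-- The bimodule `1_y (kE) 1_x` is, as a left module, projective over the group algebra of `Aut y`. -/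
def IsColumnProjectiveAt (x : E) : Prop :=
  ∃ θ : CategoryAlgebra k E →ₗ[k] CategoryAlgebra k E,
    ∀ a, relTrace y θ a = of k (𝟙 y) * a * of k (𝟙 x)

variable {y}

lemma exists_relTrace_eq_mul_setIdempotent {s : Set E}
    (h : ∀ z ∈ s, IsColumnProjectiveAt k y z) :
    ∃ θ : CategoryAlgebra k E →ₗ[k] CategoryAlgebra k E,
      ∀ a, relTrace y θ a = of k (𝟙 y) * (a * setIdempotent k s) := by
  classical
  let := Fintype.ofFinite E
  choose θ hθ using h
  refine ⟨∑ z, if hz : z ∈ s then θ z hz else 0, fun a => ?_⟩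
  rw [relTrace_sum, LinearMap.sum_apply, setIdempotent, Finset.mul_sum, Finset.mul_sum]
  refine Finset.sum_congr rfl fun z _ => ?_
  split_ifs with hz
  · rw [hθ, mul_assoc]
  · simp [relTrace_apply]

lemma isProjectiveAt_idempotentProjective_of_trace {e : CategoryAlgebra k E}
    (he : IsIdempotentElem e) {θ : CategoryAlgebra k E →ₗ[k] CategoryAlgebra k E}
    (hθ : ∀ a, relTrace y θ (a * e) = of k (𝟙 y) * (a * e)) :
    IsProjectiveAt k y (idempotentProjective e) := by
  have hmem (a : CategoryAlgebra k E) : a * e ∈ idempotentProjective e :=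
    Submodule.smul_mem _ a (Submodule.mem_span_singleton_self e)
  obtain ⟨q, hq⟩ : ∃ q : CategoryAlgebra k E →ₗ[CategoryAlgebra k E] idempotentProjective e,
      ∀ a, (q a : CategoryAlgebra k E) = a * e :=
    ⟨{ toFun := fun a => ⟨a * e, hmem a⟩
       map_add' := fun a b => Subtype.ext (add_mul a b e)
       map_smul' := fun a b => Subtype.ext (mul_assoc a b e) }, fun a => rfl⟩
  have hae (a : idempotentProjective e) : (a : CategoryAlgebra k E) * e = a := by
    obtain ⟨b, hb⟩ := Submodule.mem_span_singleton.1 a.2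
    rw [← hb, smul_eq_mul, mul_assoc, he]
  refine ⟨q.restrictScalars k ∘ₗ θ ∘ₗ (Submodule.subtype _).restrictScalars k, fun a => ?_⟩
  rw [relTrace_comp (.of_linearMap q) (.of_linearMap (Submodule.subtype _))]
  refine Subtype.ext ?_
  rw [LinearMap.restrictScalars_apply, hq, LinearMap.restrictScalars_apply,
    Submodule.subtype_apply, ← hae a, hθ, hae, mul_assoc, hae]
  rfl

lemma isProjectiveAt_idempotentProjective {s : Set E}
    (h : ∀ z ∈ s, IsColumnProjectiveAt k y z) :
    IsProjectiveAt k y (idempotentProjective (setIdempotent k s)) := by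
  obtain ⟨θ, hθ⟩ := exists_relTrace_eq_mul_setIdempotent h
  have he := isIdempotentElem_setIdempotent (k := k) s
  exact isProjectiveAt_idempotentProjective_of_trace he fun a => by rw [hθ, mul_assoc a, he]

/-- A module supported on `s` is covered by copies of `kE 1_s`, which is projective at `y` by
assumption. As `s` is upward closed, the kernel is again supported on `s` and has smaller projective
dimension, so `IsProjectiveAt.of_quotient` applies. -/
theorem isProjectiveAt_of_hasProjectiveDimensionLT {s : Set E} (hs : IsUpwardClosed s)
    (h : ∀ z ∈ s, IsColumnProjectiveAt k y z) (n : ℕ) :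
    ∀ (M : Type (max u v w)) [AddCommGroup M] [Module k M] [Module (CategoryAlgebra k E) M]
      [IsScalarTower k (CategoryAlgebra k E) M], (∀ m : M, setIdempotent k s • m = m) →
      HasProjectiveDimensionLT (ModuleCat.of (CategoryAlgebra k E) M) (n + 1) →
      IsProjectiveAt k y M := by
  have hP := isProjectiveAt_idempotentProjective h
  have hproj (M : Type (max u v w)) : Module.Projective (CategoryAlgebra k E)
      (M →₀ idempotentProjective (setIdempotent k s)) := by
    classical
    have := projective_idempotentProjective (isIdempotentElem_setIdempotent (k := k) s)
    exact Module.Projective.of_equiv (finsuppLequivDFinsupp (CategoryAlgebra k E)).symm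
  induction n with
  | zero =>
    intro M _ _ _ _ hM hpd
    let f : (M →₀ idempotentProjective (setIdempotent k s)) →ₗ[CategoryAlgebra k E] M :=
      Finsupp.lsum ℕ fun m => LinearMap.toSpanSingleton _ _ m ∘ₗ Submodule.subtype _
    have hf : Function.Surjective f := fun m =>
      ⟨Finsupp.single m ⟨setIdempotent k s, Submodule.mem_span_singleton_self _⟩, by
        simp [f, hM]⟩
    have : Module.Projective (CategoryAlgebra k E) M := (IsProjective.iff_projective M).2
      (projective_iff_hasProjectiveDimensionLT_one.2 hpd)
    obtain ⟨g, hg⟩ := Module.projective_lifting_property f LinearMap.id hf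
    exact (hP.finsupp M).of_retract_linear f g fun m => LinearMap.congr_fun hg m
  | succ n ih =>
    intro M _ _ _ _ hM hpd
    let f : (M →₀ idempotentProjective (setIdempotent k s)) →ₗ[CategoryAlgebra k E] M :=
      Finsupp.lsum ℕ fun m => LinearMap.toSpanSingleton _ _ m ∘ₗ Submodule.subtype _
    have hf : Function.Surjective f := fun m =>
      ⟨Finsupp.single m ⟨setIdempotent k s, Submodule.mem_span_singleton_self _⟩, by
        simp [f, hM]⟩
    have hker := hasProjectiveDimensionLT_ker f hf n hpd
    refine .of_quotient (ih (LinearMap.ker f) ?_ hker) (hP.finsupp M) (LinearMap.ker f).subtype f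
      (Submodule.injective_subtype _) hf (LinearMap.exact_subtype_ker_map f)
    intro m
    refine Subtype.ext (Finsupp.ext fun x => Subtype.ext ?_)
    obtain ⟨b, hb⟩ := Submodule.mem_span_singleton.1 (m.1 x).2
    change setIdempotent k s * (m.1 x : CategoryAlgebra k E) = _
    rw [← hb, smul_eq_mul, hs.mul_mul]

end CategoryAlgebra

namespace LengthFunction

variable {k : Type w} [Field k] {E : Type u} [Category.{v} E] (L : LengthFunction E)

include L in
-- The composite is an endomorphism, hence of length zero, and by additivity so are both factors.
-- Thus the canonical preorder on objects is a partial order.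
lemma eq_of_hom_of_hom (hs : Skeletal E) (hEI : ∀ (x : E) (f : x ⟶ x), IsIso f) {x y : E}
    (f : x ⟶ y) (g : y ⟶ x) : x = y := by
  have := hEI x (f ≫ g)
  have h := L.len_isIso (f ≫ g)
  rw [L.len_comp] at h
  have : IsIso f := (L.len_eq_zero_iff f).1 (by omega)
  exact hs ⟨asIso f⟩

variable [Finite E]

lemma proj_zero_corner (hEI : ∀ (x : E) (f : x ⟶ x), IsIso f) (y : E) (a : CategoryAlgebra k E) :
    L.proj k 0 (of k (𝟙 y) * a * of k (𝟙 y)) = of k (𝟙 y) * a * of k (𝟙 y) := by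
  induction a using CategoryAlgebra.induction with
  | zero => simp
  | add a b ha hb => rw [mul_add, add_mul, map_add, ha, hb]
  | @smul_of c x z α =>
    rw [mul_smul', smul_mul', map_smul]
    congr 1
    by_cases hz : z = y
    · subst hz
      rw [of_id_mul_of]
      by_cases hx : z = x
      · subst hx
        have := hEI z α
        rw [of_mul_of_id, proj_of, if_pos (L.len_isIso α)]
      · rw [of_mul_of_ne _ _ _ hx, map_zero]
    · rw [of_mul_of_ne _ _ _ hz, zero_mul, map_zero]

lemma proj_zero_off_diagonal (hs : Skeletal E) {x y : E} (hxy : x ≠ y) (a : CategoryAlgebra k E) :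
    L.proj k 0 (of k (𝟙 y) * a * of k (𝟙 x)) = 0 := by
  induction a using CategoryAlgebra.induction with
  | zero => simp
  | add a b ha hb => rw [mul_add, add_mul, map_add, ha, hb, add_zero]
  | @smul_of c x' z α =>
    rw [mul_smul', smul_mul', map_smul]
    by_cases hz : z = y
    · subst hz
      rw [of_id_mul_of]
      by_cases hx : x = x'
      · subst hx
        rw [of_mul_of_id, proj_of, if_neg, smul_zero]
        intro h
        rw [L.len_eq_zero_iff] at h
        exact hxy (hs ⟨asIso α⟩)
      · rw [of_mul_of_ne _ _ _ hx, map_zero, smul_zero]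
    · rw [of_mul_of_ne _ _ _ hz, zero_mul, map_zero, smul_zero]

variable [∀ y : E, Fintype (Aut y)]

include L in
lemma isColumnProjectiveAt_self (hs : Skeletal E) (hEI : ∀ (x : E) (f : x ⟶ x), IsIso f) (y : E) :
    IsColumnProjectiveAt k y y := by
  obtain ⟨θ, hθ⟩ := L.exists_relTrace_eq_proj_zero (k := k) hs hEI y
  have hi : IsEquivariantAt y (LinearMap.mulRight k (of k (𝟙 y))) := fun g a =>
    mul_assoc _ _ _
  refine ⟨LinearMap.id ∘ₗ θ ∘ₗ LinearMap.mulRight k (of k (𝟙 y)), fun a => ?_⟩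
  rw [relTrace_comp .id hi, hθ, ← smul_eq_mul, ← (L.proj_isEquivariantAt 0 y).map_id]
  rw [LinearMap.id_apply, smul_eq_mul, LinearMap.mulRight_apply, ← mul_assoc]
  exact L.proj_zero_corner hEI y a

include L in
theorem isColumnProjectiveAt_of_hasProjectiveDimensionLT (hs : Skeletal E)
    (hEI : ∀ (x : E) (f : x ⟶ x), IsIso f) (n : ℕ)
    (h : HasProjectiveDimensionLT (ModuleCat.of (CategoryAlgebra k E)
      (positivePart (lengthGrading k E))) (n + 1)) (y x : E) : IsColumnProjectiveAt k y x := by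
  -- The induction runs downwards from the maximal objects: the claim for `x` uses all objects
  -- strictly above `x`.
  let r : E → E → Prop := fun z x => Nonempty (x ⟶ z) ∧ z ≠ x
  have : IsTrans E r := ⟨by
    rintro x y z ⟨⟨f⟩, hf⟩ ⟨⟨g⟩, hg⟩
    refine ⟨⟨g ≫ f⟩, ?_⟩
    rintro rfl
    exact hf (L.eq_of_hom_of_hom hs hEI g f)⟩
  have : Std.Irrefl r := ⟨fun x h => h.2 rfl⟩
  have hwf : WellFounded r := Finite.wellFounded_of_trans_of_irrefl r
  induction x using hwf.induction with
  | _ x ih =>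
  by_cases hxy : x = y
  · subst hxy
    exact L.isColumnProjectiveAt_self hs hEI x
  let s : Set E := {z | r z x}
  have hs' : IsUpwardClosed s := by
    rintro z w f ⟨⟨g⟩, hg⟩
    refine ⟨⟨g ≫ f⟩, ?_⟩
    rintro rfl
    exact hg (L.eq_of_hom_of_hom hs hEI f g)
  let φ : positivePart (lengthGrading k E) →ₗ[CategoryAlgebra k E]
      positivePart (lengthGrading k E) :=
    { toFun := fun a => ⟨a * of k (𝟙 x), L.mul_mem_positivePart_left a.2 _⟩
      map_add' := fun a b => Subtype.ext (add_mul _ _ _)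
      map_smul' := fun a b => Subtype.ext (mul_assoc _ _ _) }
  have hφ (a : positivePart (lengthGrading k E)) : φ (φ a) = φ a := by
    refine Subtype.ext ?_
    change (a : CategoryAlgebra k E) * of k (𝟙 x) * of k (𝟙 x) = a * of k (𝟙 x)
    rw [mul_assoc, of_mul_of_id]
  -- Right multiplication by `1_x` is an idempotent endomorphism of `J`, so `J 1_x` inherits the
  -- bound on projective dimension. For `x ≠ y` its component at `y` is the whole of `1_y kE 1_x`.
  have hret : Retract (ModuleCat.of (CategoryAlgebra k E) (LinearMap.range φ))
      (ModuleCat.of (CategoryAlgebra k E) (positivePart (lengthGrading k E))) :=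
    { i := ModuleCat.ofHom (Submodule.subtype _)
      r := ModuleCat.ofHom φ.rangeRestrict
      retract := by
        ext ⟨_, a, rfl⟩
        exact congrArg Subtype.val (hφ a) }
  have hM : IsProjectiveAt k y (LinearMap.range φ) := by
    refine isProjectiveAt_of_hasProjectiveDimensionLT hs' (fun z hz => ih z hz) n _ ?_
      (hret.hasProjectiveDimensionLT _)
    rintro ⟨_, ⟨a, ha⟩, rfl⟩
    refine Subtype.ext (Subtype.ext ?_)
    change setIdempotent k s * (a * of k (𝟙 x)) = a * of k (𝟙 x)
    refine L.positivePart_induction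
      (motive := fun a => setIdempotent k s * (a * of k (𝟙 x)) = a * of k (𝟙 x)) (by simp)
      (fun a b ha hb => by rw [add_mul, mul_add, ha, hb]) (fun c x' z α hα => ?_) ha
    rw [smul_mul', mul_smul']
    congr 1
    by_cases hx : x = x'
    · subst hx
      classical
      rw [of_mul_of_id, setIdempotent_mul_of, if_pos]
      refine ⟨⟨α⟩, ?_⟩
      rintro rfl
      exact hα ((L.len_eq_zero_iff α).2 (hEI _ α))
    · rw [of_mul_of_ne _ _ _ hx, mul_zero]
  obtain ⟨θ, hθ⟩ := hM
  have hmem (a : CategoryAlgebra k E) :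
      of k (𝟙 y) * a * of k (𝟙 x) ∈ positivePart (lengthGrading k E) := by
    rw [L.mem_positivePart_iff, L.proj_zero_off_diagonal hs hxy]
  let i : CategoryAlgebra k E →ₗ[k] LinearMap.range φ :=
    { toFun := fun a => ⟨φ ⟨of k (𝟙 y) * a * of k (𝟙 x), hmem a⟩, _, rfl⟩
      map_add' := fun a b => Subtype.ext (Subtype.ext (by
        change _ * (a + b) * _ * _ = _ * a * _ * _ + _ * b * _ * _
        rw [mul_add, add_mul, add_mul]))
      map_smul' := fun c a => Subtype.ext (Subtype.ext (by
        change _ * (c • a) * _ * _ = c • (_ * a * _ * _)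
        rw [mul_smul', CategoryAlgebra.smul_mul', CategoryAlgebra.smul_mul'])) }
  have hival (a : CategoryAlgebra k E) :
      ((i a : positivePart (lengthGrading k E)) : CategoryAlgebra k E) =
        of k (𝟙 y) * a * of k (𝟙 x) := by
    change of k (𝟙 y) * a * of k (𝟙 x) * of k (𝟙 x) = _
    rw [mul_assoc _ (of k (𝟙 x)), of_mul_of_id]
  have hi : IsEquivariantAt y i := fun g a => by
    refine Subtype.ext (Subtype.ext ?_)
    rw [hival]
    change _ = of k g.hom * (i a : positivePart (lengthGrading k E)).1
    rw [hival, smul_eq_mul, ← mul_assoc, ← mul_assoc, ← mul_assoc, of_id_mul_of, of_mul_of_id]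
  let j : LinearMap.range φ →ₗ[CategoryAlgebra k E] CategoryAlgebra k E :=
    Submodule.subtype _ ∘ₗ Submodule.subtype _
  refine ⟨j.restrictScalars k ∘ₗ θ ∘ₗ i, fun a => ?_⟩
  rw [relTrace_comp (.of_linearMap j) hi, hθ]
  change of k (𝟙 y) * (i a : positivePart (lengthGrading k E)).1 = _
  rw [hival, ← mul_assoc, ← mul_assoc, of_id_mul_of]

include L in
theorem isProjectiveAt_of_projectiveDimension (hs : Skeletal E)
    (hEI : ∀ (x : E) (f : x ⟶ x), IsIso f)
    (h : projectiveDimension (ModuleCat.of (CategoryAlgebra k E)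
        (DegreeZeroModule (lengthGrading k E))) < ⊤) (y : E) :
    IsProjectiveAt k y (CategoryAlgebra k E) := by
  let := Fintype.ofFinite E
  obtain ⟨n, hn⟩ := (projectiveDimension_ne_top_iff _).1 h.ne
  have h1 := hasProjectiveDimensionLT_ker (positivePart (lengthGrading k E)).mkQ
    (Submodule.mkQ_surjective _) n (hasProjectiveDimensionLT_of_ge _ (n + 1) (n + 2) (by omega))
  rw [Submodule.ker_mkQ] at h1
  choose θ hθ using L.isColumnProjectiveAt_of_hasProjectiveDimensionLT hs hEI n h1 y
  refine ⟨∑ x, θ x, fun a => ?_⟩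
  rw [relTrace_sum, LinearMap.sum_apply]
  simp only [hθ]
  rw [← Finset.mul_sum, ← one_def, mul_one, smul_eq_mul]

lemma degreeOneProjective_of_isProjectiveAt
    (h : ∀ y : E, IsProjectiveAt k y (CategoryAlgebra k E)) : L.DegreeOneProjective k := by
  intro y
  obtain ⟨θ, hθ⟩ := h y
  refine ⟨L.proj k 1 ∘ₗ θ ∘ₗ LinearMap.id, fun a => ?_⟩
  rw [relTrace_comp (L.proj_isEquivariantAt 1 y) .id, hθ, (L.proj_isEquivariantAt 1 y).map_id]
  rfl

end LengthFunction

end CategoryTheory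

/-! ### Composition factors, filtrations, and from stratification to projectivity -/

section

variable {A : Type w} [Ring A]

lemma mul_eq_self_of_idempotentProjective {e f : A} (h : e * f = e)
    (x : idempotentProjective e) : (x : A) * f = x := by
  obtain ⟨t, ht⟩ := Submodule.mem_span_singleton.1 x.2
  rw [← ht, smul_eq_mul, mul_assoc, h]

/-- The map `x ↦ x • d` on `A e` is nonzero, so its kernel lies in the radical, and the simple top
of `A e` is the quotient of the image of this map by the image of the radical. -/
lemma isCompositionFactor_of_smul_ne_zero [IsArtinian A A] [IsNoetherian A A] {e : A}
    (he : IsPrimitiveIdempotent e) {M : Type w} [AddCommGroup M] [Module A M] {d : M}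
    (hd : e • d ≠ 0) : IsCompositionFactor (A := A) (idempotentSimple e) M := by
  let h : idempotentProjective e →ₗ[A] M := LinearMap.toSpanSingleton A M d ∘ₗ Submodule.subtype _
  have hker : LinearMap.ker h ≤ Module.jacobson A (idempotentProjective e) := by
    refine he.le_jacobson fun htop => hd ?_
    have : (⟨e, Submodule.mem_span_singleton_self e⟩ : idempotentProjective e) ∈
        LinearMap.ker h := htop ▸ trivial
    exact this
  set R := Module.jacobson A (idempotentProjective e) with hR
  refine ⟨R.map h, LinearMap.range h, LinearMap.map_le_range, ⟨?_⟩⟩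
  let q : idempotentProjective e →ₗ[A] LinearMap.range h ⧸ (R.map h).submoduleOf (LinearMap.range h) :=
    Submodule.mkQ _ ∘ₗ h.rangeRestrict
  have hq : Function.Surjective q :=
    (Submodule.mkQ_surjective _).comp h.surjective_rangeRestrict
  have hqker : LinearMap.ker q = R := by
    ext x
    rw [LinearMap.mem_ker, LinearMap.comp_apply, ← LinearMap.mem_ker, Submodule.ker_mkQ]
    change h x ∈ R.map h ↔ _
    constructor
    · rintro ⟨y, hy, hxy⟩
      have : x - y ∈ R := hker (by rw [LinearMap.mem_ker, map_sub, hxy, sub_self])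
      simpa using add_mem this hy
    · exact fun hx => ⟨x, hx, rfl⟩
  exact (q.quotKerEquivOfSurjective hq).symm.trans (Submodule.quotEquivOfEq _ _ hqker)

lemma IsCompositionFactor.exists_smul_ne_zero [IsNoetherian A A] {e : A}
    (he : IsPrimitiveIdempotent e) {M : Type w} [AddCommGroup M] [Module A M]
    (h : IsCompositionFactor (A := A) (idempotentSimple e) M) : ∃ d : M, e • d ≠ 0 := by
  obtain ⟨N, N', -, ⟨f⟩⟩ := h
  set e' : idempotentProjective e := ⟨e, Submodule.mem_span_singleton_self e⟩
  have hgen (x : idempotentProjective e) : (x : A) • e' = x :=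
    Subtype.ext (mul_eq_self_of_idempotentProjective he.2.1 x)
  have hnt : Nontrivial (idempotentProjective e) :=
    ⟨e', 0, fun h => he.1 (congrArg Subtype.val h)⟩
  obtain ⟨C, hC, -⟩ := (eq_top_or_exists_le_coatom
    (⊥ : Submodule A (idempotentProjective e))).resolve_left bot_ne_top
  have hne : (Submodule.Quotient.mk e' : idempotentSimple e) ≠ 0 := by
    rw [Ne, Submodule.Quotient.mk_eq_zero]
    intro hmem
    have he'C : e' ∈ C := (sInf_le hC : Module.jacobson A (idempotentProjective e) ≤ C) hmem
    exact hC.1 (eq_top_iff.2 fun x _ => hgen x ▸ C.smul_mem _ he'C)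
  obtain ⟨n, hn⟩ := Submodule.mkQ_surjective _ (f.symm (Submodule.Quotient.mk e'))
  refine ⟨n, fun h0 => hne ?_⟩
  have h1 : (Submodule.Quotient.mk e' : idempotentSimple e) = e • Submodule.Quotient.mk e' := by
    rw [← Submodule.Quotient.mk_smul]
    exact congrArg _ (hgen e').symm
  have h2 : e • n = 0 := Subtype.ext h0
  rw [h1, ← f.apply_symm_apply (Submodule.Quotient.mk e'), ← map_smul, ← hn, ← map_smul, h2,
    map_zero, map_zero]

lemma HasFiltration.of_subsingleton {Λ : Type*} (Δ : Λ → ModuleCat.{w} A) (p : Λ → Prop)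
    (M : Type w) [AddCommGroup M] [Module A M] [Subsingleton M] : HasFiltration Δ p M :=
  ⟨0, fun _ => ⊥, rfl, Subsingleton.elim _ _, fun i hi => by omega⟩

/-- The filtration of the quotient is pulled back and shifted by one, which makes room for the copy
of `Δ μ` at the bottom. -/
lemma HasFiltration.of_injective {Λ : Type*} {Δ : Λ → ModuleCat.{w} A} {p : Λ → Prop}
    {M : Type w} [AddCommGroup M] [Module A M] {μ : Λ} (hμ : p μ) (j : Δ μ →ₗ[A] M)
    (hj : Function.Injective j) (h : HasFiltration Δ p (M ⧸ LinearMap.range j)) :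
    HasFiltration Δ p M := by
  obtain ⟨n, F, h0, hn, hF⟩ := h
  set π := (LinearMap.range j).mkQ with hπ
  let G : ℕ → Submodule A M := fun
    | 0 => ⊥
    | i + 1 => (F i).comap π
  have hG1 : G 1 = LinearMap.range j := by
    change (F 0).comap π = _
    rw [h0, Submodule.comap_bot, hπ, Submodule.ker_mkQ]
  refine ⟨n + 1, G, rfl, ?_, ?_⟩
  · change (F n).comap π = ⊤
    rw [hn, Submodule.comap_top]
  · rintro (_ | i) hi
    · refine ⟨bot_le, μ, hμ, ⟨?_⟩⟩
      rw [zero_add, hG1]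
      have : (⊥ : Submodule A M).submoduleOf (LinearMap.range j) = ⊥ :=
        (Submodule.comap_bot _).trans (Submodule.ker_subtype _)
      exact (Submodule.quotEquivOfEqBot _ this).trans (LinearEquiv.ofInjective j hj).symm
    · obtain ⟨hle, ν, hν, ⟨f⟩⟩ := hF i (by omega)
      refine ⟨Submodule.comap_mono hle, ν, hν, ⟨?_⟩⟩
      let q : (F (i + 1)).comap π →ₗ[A] F (i + 1) ⧸ (F i).submoduleOf (F (i + 1)) :=
        ((F i).submoduleOf (F (i + 1))).mkQ ∘ₗ (π.restrict fun _ hx => hx : (F (i + 1)).comap π →ₗ[A] F (i + 1))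
      have hq : Function.Surjective q := by
        refine (Submodule.mkQ_surjective _).comp ?_
        rintro ⟨x, hx⟩
        obtain ⟨m, rfl⟩ := Submodule.mkQ_surjective _ x
        exact ⟨⟨m, hx⟩, rfl⟩
      have hqker : LinearMap.ker q = (G (i + 1)).submoduleOf (G (i + 1 + 1)) := by
        ext x
        rw [LinearMap.mem_ker, LinearMap.comp_apply, ← LinearMap.mem_ker, Submodule.ker_mkQ]
        rfl
      exact ((Submodule.quotEquivOfEq _ _ hqker.symm).trans (q.quotKerEquivOfSurjective hq)).trans f

end

namespace CategoryTheory

open CategoryAlgebra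

namespace CategoryAlgebra

variable {k : Type w} [Field k] {E : Type u} [Category.{v} E] [Finite E]

lemma id_mul_mul_id_eq_zero {x y : E} (h : IsEmpty (x ⟶ y)) (a : CategoryAlgebra k E) :
    of k (𝟙 y) * a * of k (𝟙 x) = 0 := by
  induction a using CategoryAlgebra.induction with
  | zero => simp
  | add a b ha hb => rw [mul_add, add_mul, ha, hb, add_zero]
  | @smul_of c x' z α =>
    rw [mul_smul', smul_mul']
    by_cases hz : z = y
    · subst hz
      rw [of_id_mul_of]
      by_cases hx : x = x'
      · subst hx
        exact (h.false α).elim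
      · rw [of_mul_of_ne _ _ _ hx, smul_zero]
    · rw [of_mul_of_ne _ _ _ hz, zero_mul, smul_zero]

lemma exists_smul_ne_zero_of_id_smul {ι : Type*} [Fintype ι] {e : ι → CategoryAlgebra k E}
    {ob : ι → E} (he : CompleteOrthogonalIdempotents e)
    (hob : ∀ l, of k (𝟙 (ob l)) * e l = e l) {M : Type*} [AddCommGroup M]
    [Module (CategoryAlgebra k E) M] (N : Submodule (CategoryAlgebra k E) M) {y : E} {d : M}
    (hd : of k (𝟙 y) • d ∉ N) : ∃ l, ob l = y ∧ e l • d ∉ N := by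
  by_contra! h
  refine hd ?_
  rw [← one_smul (CategoryAlgebra k E) d, ← he.complete, Finset.sum_smul, Finset.smul_sum]
  refine sum_mem fun l _ => ?_
  by_cases hl : ob l = y
  · exact N.smul_mem _ (h l hl)
  · rw [← mul_smul, ← hob, ← mul_assoc, of_mul_of_ne _ _ _ hl, zero_mul, zero_smul]
    exact zero_mem _

end CategoryAlgebra

variable {k : Type w} [Field k] {E : Type u} [Category.{v} E] [Finite E]
  {K : Type (max u v w)} [AddCommGroup K] [Module k K] [Module (CategoryAlgebra k E) K]
  [IsScalarTower k (CategoryAlgebra k E) K] {Λ : Type*}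
  {Δ : Λ → ModuleCat.{max u v w} (CategoryAlgebra k E)} {p : Λ → Prop}

lemma _root_.HasFiltration.isProjectiveAt (h : HasFiltration Δ p K) [∀ l, Module k (Δ l)]
    [∀ l, IsScalarTower k (CategoryAlgebra k E) (Δ l)] (y : E) [Fintype (Aut y)]
    (hΔ : ∀ l, p l → IsProjectiveAt k y (Δ l)) : IsProjectiveAt k y K := by
  obtain ⟨n, F, h0, hn, hF⟩ := h
  have h1 := IsProjectiveAt.of_filtration (y := y) (k := k) F n h0 fun i hi => by
    obtain ⟨hle, l, hl, ⟨f⟩⟩ := hF i hi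
    exact ⟨hle, (hΔ l hl).of_linearEquiv f.symm⟩
  exact (h1.of_linearEquiv (LinearEquiv.ofEq _ _ hn)).of_linearEquiv Submodule.topEquiv

lemma _root_.HasFiltration.id_smul_eq_zero (h : HasFiltration Δ p K) (y : E)
    (hΔ : ∀ l, p l → ∀ d : Δ l, of k (𝟙 y) • d = 0) (m : K) : of k (𝟙 y) • m = 0 := by
  obtain ⟨n, F, h0, hn, hF⟩ := h
  have key : ∀ i ≤ n, ∀ m ∈ F i, of k (𝟙 y) • m = 0 := by
    intro i
    induction i with
    | zero =>
      intro _ m hm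
      rw [h0, Submodule.mem_bot] at hm
      rw [hm, smul_zero]
    | succ i ih =>
      intro hi m hm
      obtain ⟨hle, l, hl, ⟨f⟩⟩ := hF i (by omega)
      have h1 : of k (𝟙 y) • ((F i).submoduleOf (F (i + 1))).mkQ ⟨m, hm⟩ = 0 := by
        apply f.injective
        rw [map_smul, hΔ l hl, map_zero]
      rw [← map_smul, ← LinearMap.mem_ker, Submodule.ker_mkQ] at h1
      have h2 := ih (by omega) (of k (𝟙 y) • m) h1
      rwa [← mul_smul, of_id_mul_of] at h2
  exact key n le_rfl m (hn ▸ trivial)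

namespace LengthFunction

variable (L : LengthFunction E) [∀ x y : E, Finite (x ⟶ y)] [∀ y : E, Fintype (Aut y)]
include L

lemma isProjectiveAt_idempotentProjective_self (hs : Skeletal E)
    (hEI : ∀ (x : E) (f : x ⟶ x), IsIso f) {e : CategoryAlgebra k E} (he : IsIdempotentElem e)
    {y : E} (hy : e * of k (𝟙 y) = e) : IsProjectiveAt k y (idempotentProjective e) := by
  obtain ⟨θ, hθ⟩ := L.isColumnProjectiveAt_self (k := k) hs hEI y
  exact isProjectiveAt_idempotentProjective_of_trace he fun a => by
    rw [hθ, mul_assoc, mul_assoc a, hy]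

theorem isProjectiveAt_of_isStandardlyStratified (hs : Skeletal E)
    (hEI : ∀ (x : E) (f : x ⟶ x), IsIso f) (h : IsStandardlyStratified k E) (y : E) :
    IsProjectiveAt k y (CategoryAlgebra k E) := by
  obtain ⟨n, e, ob, he, hprim, hob, Δ, hΔ, hseq⟩ := h
  have : IsArtinian (CategoryAlgebra k E) (CategoryAlgebra k E) :=
    IsArtinianRing.of_finite k (CategoryAlgebra k E)
  have : IsNoetherian (CategoryAlgebra k E) (CategoryAlgebra k E) :=
    IsNoetherianRing.of_finite k (CategoryAlgebra k E)
  let _ (l : Fin n) : Module k (Δ l) := Module.compHom (Δ l) (algebraMap k (CategoryAlgebra k E))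
  have (l : Fin n) : IsScalarTower k (CategoryAlgebra k E) (Δ l) :=
    IsScalarTower.of_algebraMap_smul fun _ _ => rfl
  choose π hπ hfil using hseq
  -- A nonzero component at `z` gives a composition factor there, so `z ≤ ob l`; as a quotient of
  -- `P_l`, the module `Δ l` only meets objects `z ≥ ob l`. Antisymmetry leaves `z = ob l`.
  have hvan (l) (z : E) (hz : z ≠ ob l) (d : Δ l) : of k (𝟙 z) • d = 0 := by
    by_contra hd
    obtain ⟨m, rfl, hm⟩ := exists_smul_ne_zero_of_id_smul he (fun l => (hob l).1) ⊥ (y := z)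
      (d := d) hd
    have h1 : Nonempty (ob m ⟶ ob l) := by
      by_contra h1
      exact hΔ l m h1 (isCompositionFactor_of_smul_ne_zero (hprim m) hm)
    have h2 : Nonempty (ob l ⟶ ob m) := by
      by_contra h2
      refine hd ?_
      obtain ⟨a, rfl⟩ := hπ l d
      rw [← map_smul]
      refine (congrArg _ (Subtype.ext ?_)).trans (map_zero (π l))
      change of k (𝟙 (ob m)) * (a : CategoryAlgebra k E) = 0
      rw [← mul_eq_self_of_idempotentProjective (hob l).2 a, ← mul_assoc]
      exact id_mul_mul_id_eq_zero (not_nonempty_iff.1 h2) _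
    exact hz (L.eq_of_hom_of_hom hs hEI h1.some h2.some)
  have hvanK (l) (a : LinearMap.ker (π l)) : of k (𝟙 (ob l)) • a = 0 := by
    refine (hfil l).id_smul_eq_zero (ob l) (fun m hm d => hvan m _ ?_ d) a
    intro h
    exact hm.2 ⟨eqToHom h.symm⟩
  -- At `ob l` the kernel of `P_l → Δ l` vanishes, since its factors live strictly above; so `Δ l`
  -- agrees there with `P_l`, a summand of the group algebra.
  have hproj (l) : IsProjectiveAt k y (Δ l) := by
    by_cases hy : y = ob l
    · subst hy
      exact .of_quotient (.of_smul_eq_zero (hvanK l))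
        (L.isProjectiveAt_idempotentProjective_self hs hEI (hprim l).2.1 (hob l).2)
        (LinearMap.ker (π l)).subtype (π l) (Submodule.injective_subtype _) (hπ l)
        (LinearMap.exact_subtype_ker_map (π l))
    · exact .of_smul_eq_zero (hvan l y hy)
  have hP (l) : IsProjectiveAt k y (idempotentProjective (e l)) :=
    .of_extension ((hfil l).isProjectiveAt y fun m _ => hproj m) (hproj l)
      (LinearMap.ker (π l)).subtype (π l) (Submodule.injective_subtype _) (hπ l)
      (LinearMap.exact_subtype_ker_map (π l))
  choose θ hθ using hP
  let q (l) : CategoryAlgebra k E →ₗ[CategoryAlgebra k E] idempotentProjective (e l) :=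
    { toFun := fun a => ⟨a * e l, Submodule.smul_mem _ a (Submodule.mem_span_singleton_self _)⟩
      map_add' := fun a b => Subtype.ext (add_mul a b _)
      map_smul' := fun a b => Subtype.ext (mul_assoc a b _) }
  refine ⟨∑ l, (Submodule.subtype _).restrictScalars k ∘ₗ θ l ∘ₗ (q l).restrictScalars k,
    fun a => ?_⟩
  rw [relTrace_sum, LinearMap.sum_apply]
  have key (l) : relTrace y ((Submodule.subtype _).restrictScalars k ∘ₗ θ l ∘ₗ
      (q l).restrictScalars k) a = of k (𝟙 y) * (a * e l) := by
    rw [relTrace_comp (.of_linearMap _) (.of_linearMap _), hθ]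
    rfl
  simp only [key]
  rw [← Finset.mul_sum, ← Finset.mul_sum, he.complete, mul_one, smul_eq_mul]

end LengthFunction

end CategoryTheory

/-! ### From projectivity to stratification -/

namespace CategoryTheory

open CategoryAlgebra

variable {k : Type w} [Field k] {E : Type u} [Category.{v} E] [Finite E]

variable (k E) in
theorem exists_primitiveIdempotents_at_objects [∀ x y : E, Finite (x ⟶ y)] :
    ∃ (n : ℕ) (e : Fin n → CategoryAlgebra k E) (ob : Fin n → E),
      CompleteOrthogonalIdempotents e ∧ (∀ l, IsPrimitiveIdempotent (e l)) ∧
      ∀ l, of k (𝟙 (ob l)) * e l = e l ∧ e l * of k (𝟙 (ob l)) = e l := by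
  have := Fintype.ofFinite E
  have : IsArtinian (CategoryAlgebra k E) (CategoryAlgebra k E) :=
    IsArtinianRing.of_finite k (CategoryAlgebra k E)
  have hdec (x : E) := exists_primitive_decomposition (of k (𝟙 x)) (of_id_mul_of x (𝟙 x))
  choose ι hι f hf hsum hprim using hdec
  have hcorner (x : E) (i : ι x) : of k (𝟙 x) * f x i = f x i ∧ f x i * of k (𝟙 x) = f x i := by
    have := mul_eq_of_sum_orthogonalIdempotents (hf x) i
    rw [hsum] at this
    exact this.symm
  let φ := (Fintype.equivFin (Σ x, ι x)).symm
  have hortho : ∀ p q : Σ x, ι x, p ≠ q → f p.1 p.2 * f q.1 q.2 = 0 := by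
    rintro ⟨x, i⟩ ⟨y, j⟩ hne
    by_cases hxy : x = y
    · subst hxy
      exact (hf x).ortho fun h => hne (congrArg (Sigma.mk x) h)
    · change f x i * f y j = 0
      rw [← (hcorner x i).2, ← (hcorner y j).1, mul_assoc, ← mul_assoc (of k (𝟙 x)),
        of_mul_of_ne _ _ _ (Ne.symm hxy), zero_mul, mul_zero]
  refine ⟨_, fun l => f (φ l).1 (φ l).2, fun l => (φ l).1,
    ⟨⟨fun l => (hf _).idem _, fun l m hlm => hortho _ _ fun h => hlm (φ.injective h)⟩, ?_⟩,
    fun l => hprim _ _, fun l => hcorner _ _⟩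
  · rw [φ.sum_comp fun p : Σ x, ι x => f p.1 p.2, Fintype.sum_sigma, one_def]
    exact Finset.sum_congr rfl fun x _ => hsum x

/-- The module `kE_0 e`, a submodule of `kE_0`. -/
noncomputable abbrev degreeZeroPart (e : CategoryAlgebra k E) :
    Submodule (CategoryAlgebra k E) (DegreeZeroModule (lengthGrading k E)) :=
  Submodule.span _ {(positivePart (lengthGrading k E)).mkQ e}

namespace LengthFunction

variable (L : LengthFunction E)
include L

lemma mkQ_eq_zero_iff (a : CategoryAlgebra k E) :
    (positivePart (lengthGrading k E)).mkQ a = 0 ↔ L.proj k 0 a = 0 := by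
  rw [← LinearMap.mem_ker, Submodule.ker_mkQ, L.mem_positivePart_iff]

lemma smul_degreeZeroModule_eq_zero {a : CategoryAlgebra k E} (ha : L.proj k 0 a = 0)
    (m : DegreeZeroModule (lengthGrading k E)) : a • m = 0 := by
  obtain ⟨b, rfl⟩ := Submodule.mkQ_surjective _ m
  rw [← map_smul, L.mkQ_eq_zero_iff, smul_eq_mul, proj_zero_mul, ha, zero_mul]

variable (k) in
-- The projection to degree zero vanishes on `J`, hence descends to an equivariant section of `kE →
-- kE_0`, along which the trace for the regular representation is transported.
lemma isProjectiveAt_degreeZeroModule (hs : Skeletal E)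
    (hEI : ∀ (x : E) (f : x ⟶ x), IsIso f) (y : E) [Fintype (Aut y)] :
    IsProjectiveAt k y (DegreeZeroModule (lengthGrading k E)) := by
  obtain ⟨θ, hθ⟩ := L.exists_relTrace_eq_proj_zero (k := k) hs hEI y
  set J := positivePart (lengthGrading k E)
  have hπ : IsEquivariantAt y (J.mkQ.restrictScalars k) := .of_linearMap _
  obtain ⟨σ, hσ⟩ := (J.mkQ.restrictScalars k).exists_rightInverse_of_surjective
    (LinearMap.range_eq_top.2 J.mkQ_surjective)
  replace hσ (m) : J.mkQ (σ m) = m := LinearMap.congr_fun hσ m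
  have hproj (a : CategoryAlgebra k E) : L.proj k 0 (σ (J.mkQ a)) = L.proj k 0 a := by
    rw [← sub_eq_zero, ← map_sub, ← L.mkQ_eq_zero_iff]
    exact (map_sub J.mkQ _ _).trans (by rw [hσ, sub_self])
  have hi : IsEquivariantAt y (L.proj k 0 ∘ₗ σ) := fun g m => by
    obtain ⟨a, rfl⟩ := J.mkQ_surjective m
    rw [← map_smul, LinearMap.comp_apply, LinearMap.comp_apply, hproj, hproj]
    exact L.proj_isEquivariantAt 0 y g a
  refine ⟨J.mkQ.restrictScalars k ∘ₗ θ ∘ₗ (L.proj k 0 ∘ₗ σ), fun m => ?_⟩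
  obtain ⟨a, rfl⟩ := J.mkQ_surjective m
  rw [relTrace_comp hπ hi, hθ, LinearMap.comp_apply, hproj, proj_proj, if_pos rfl]
  rw [LinearMap.restrictScalars_apply, ← map_smul, ← sub_eq_zero, ← map_sub, L.mkQ_eq_zero_iff,
    smul_eq_mul, ← mul_sub, proj_zero_mul, map_sub, proj_proj, if_pos rfl, sub_self, mul_zero]

lemma isProjectiveAt_degreeZeroPart (hs : Skeletal E)
    (hEI : ∀ (x : E) (f : x ⟶ x), IsIso f) {e : CategoryAlgebra k E} (he : IsIdempotentElem e)
    (y : E) [Fintype (Aut y)] : IsProjectiveAt k y (degreeZeroPart e) := by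
  set J := positivePart (lengthGrading k E) with hJ
  obtain ⟨r, hr⟩ : ∃ r : DegreeZeroModule (lengthGrading k E) →ₗ[CategoryAlgebra k E]
      DegreeZeroModule (lengthGrading k E), ∀ a, r (J.mkQ a) = J.mkQ (a * e) := by
    refine ⟨J.liftQ (LinearMap.toSpanSingleton _ _ (J.mkQ e)) fun a ha => ?_, fun a => ?_⟩
    · rw [LinearMap.mem_ker, LinearMap.toSpanSingleton_apply]
      exact L.smul_degreeZeroModule_eq_zero (L.mem_positivePart_iff.1 ha) _
    · change a • J.mkQ e = J.mkQ (a * e)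
      rw [← map_smul, smul_eq_mul]
  have hmem (m) : r m ∈ degreeZeroPart e := by
    obtain ⟨a, rfl⟩ := J.mkQ_surjective m
    rw [hr, ← smul_eq_mul, map_smul]
    exact Submodule.smul_mem _ _ (Submodule.mem_span_singleton_self _)
  refine (L.isProjectiveAt_degreeZeroModule k hs hEI y).of_retract_linear (r.codRestrict _ hmem)
    (Submodule.subtype _) fun m => Subtype.ext ?_
  obtain ⟨a, ha⟩ := Submodule.mem_span_singleton.1 m.2
  change r m = m
  rw [← ha, map_smul, hr, he]

omit [Finite E] in
lemma wellFounded_of_finite [Finite E] (hs : Skeletal E) (hEI : ∀ (x : E) (f : x ⟶ x), IsIso f) :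
    WellFounded fun z x : E => Nonempty (x ⟶ z) ∧ z ≠ x := by
  have : IsTrans E fun z x : E => Nonempty (x ⟶ z) ∧ z ≠ x := ⟨by
    rintro x y z ⟨⟨f⟩, hf⟩ ⟨⟨g⟩, hg⟩
    refine ⟨⟨g ≫ f⟩, ?_⟩
    rintro rfl
    exact hf (L.eq_of_hom_of_hom hs hEI g f)⟩
  have : Std.Irrefl fun z x : E => Nonempty (x ⟶ z) ∧ z ≠ x := ⟨fun x h => h.2 rfl⟩
  exact Finite.wellFounded_of_trans_of_irrefl _

end LengthFunction

namespace LengthFunction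

variable (L : LengthFunction E)
  {M : Type (max u v w)} [AddCommGroup M] [Module k M] [Module (CategoryAlgebra k E) M]
  [IsScalarTower k (CategoryAlgebra k E) M]

/-- A module `M` with `1_y M = M`, on which the non-isomorphisms starting in `y` act as zero. -/
structure IsConcentratedAt (k : Type w) [Field k] {E : Type u} [Category.{v} E] [Finite E] (y : E)
    (M : Type*) [AddCommGroup M] [Module (CategoryAlgebra k E) M] : Prop where
  id_smul : ∀ m : M, of k (𝟙 y) • m = m
  smul_eq_zero : ∀ {z : E} (α : y ⟶ z), z ≠ y → ∀ m : M, of k α • m = 0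

lemma IsConcentratedAt.smul_eq_zero_of_ne {y : E} (h : IsConcentratedAt k y M) {x z : E}
    (α : x ⟶ z) (hα : ¬ (x = y ∧ z = y)) (m : M) : of k α • m = 0 := by
  by_cases hx : x = y
  · subst hx
    exact h.smul_eq_zero α (fun hz => hα ⟨rfl, hz⟩) m
  · rw [← h.id_smul m, ← mul_smul, of_mul_of_ne _ _ _ (Ne.symm hx), zero_smul]

/-- A map that commutes with the automorphisms of `y`, from a module concentrated at `y` to a module
on which the non-isomorphisms act as zero, is linear over the category algebra. -/
lemma IsConcentratedAt.exists_linearMap (hEI : ∀ (x : E) (f : x ⟶ x), IsIso f) (hs : Skeletal E)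
    {y : E} (h : IsConcentratedAt k y M)
    {N : Type*} [AddCommGroup N] [Module k N] [Module (CategoryAlgebra k E) N]
    [IsScalarTower k (CategoryAlgebra k E) N]
    (hN : ∀ (a : CategoryAlgebra k E), L.proj k 0 a = 0 → ∀ n : N, a • n = 0)
    {f : M →ₗ[k] N} (hf : IsEquivariantAt y f) (hf1 : ∀ m, of k (𝟙 y) • f m = f m) :
    ∃ g : M →ₗ[CategoryAlgebra k E] N, ∀ m, g m = f m := by
  refine ⟨{ f with map_smul' := fun a m => ?_ }, fun m => rfl⟩
  change f (a • m) = a • f m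
  induction a using CategoryAlgebra.induction with
  | zero => simp
  | add a b ha hb => rw [add_smul, map_add, ha, hb, add_smul]
  | @smul_of c x z α =>
    rw [smul_assoc, map_smul, smul_assoc]
    congr 1
    by_cases hα : x = y ∧ z = y
    · obtain ⟨rfl, rfl⟩ := hα
      have := hEI z α
      let g : Aut z := asIso α
      exact hf g m
    · rw [h.smul_eq_zero_of_ne α hα, map_zero]
      by_cases hx : x = y
      · subst hx
        refine (hN _ ?_ _).symm
        rw [proj_of, if_neg]
        intro h0
        rw [L.len_eq_zero_iff] at h0
        exact hα ⟨rfl, (hs ⟨asIso α⟩).symm⟩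
      · rw [← hf1 m, ← mul_smul, of_mul_of_ne _ _ _ (Ne.symm hx), zero_smul]

variable (k M) in
include L in
-- For `y` maximal in the support, the non-isomorphisms out of `y` act as zero, so `1_y M` is a
-- submodule.
lemma exists_isConcentratedAt_submodule (hs : Skeletal E) (hEI : ∀ (x : E) (f : x ⟶ x), IsIso f)
    [Nontrivial M] : ∃ (y : E) (N : Submodule (CategoryAlgebra k E) M), IsConcentratedAt k y N ∧
      (∀ m : M, of k (𝟙 y) • m ∈ N) ∧ N ≠ ⊥ := by
  have := Fintype.ofFinite E
  obtain ⟨y, ⟨m₀, hm₀⟩, hmax⟩ := (L.wellFounded_of_finite hs hEI).has_min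
    {y | ∃ m : M, of k (𝟙 y) • m ≠ 0} (by
      by_contra h
      obtain ⟨m, hm⟩ := exists_ne (0 : M)
      refine hm ?_
      rw [← one_smul (CategoryAlgebra k E) m, one_def, Finset.sum_smul]
      refine Finset.sum_eq_zero fun y _ => ?_
      by_contra hy
      exact h ⟨y, m, hy⟩)
  have hzero {z : E} (α : y ⟶ z) (hz : z ≠ y) (m : M) : of k α • m = 0 := by
    by_contra h
    refine hmax z ⟨of k α • m, ?_⟩ ⟨⟨α⟩, hz⟩
    rwa [← mul_smul, of_id_mul_of]
  let N : Submodule (CategoryAlgebra k E) M :=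
    { carrier := {m | of k (𝟙 y) • m = m}
      add_mem' := fun {a b} ha hb => by
        rw [Set.mem_ofPred_eq] at *
        rw [smul_add, ha, hb]
      zero_mem' := smul_zero _
      smul_mem' := fun a m hm => by
        rw [Set.mem_ofPred_eq] at *
        induction a using CategoryAlgebra.induction with
        | zero => simp
        | add a b ha hb => rw [add_smul, smul_add, ha, hb]
        | @smul_of c x z α =>
          rw [smul_assoc, smul_comm]
          congr 1
          by_cases hx : x = y
          · subst hx
            by_cases hz : z = x
            · subst hz
              rw [← mul_smul, of_id_mul_of]
            · rw [hzero α hz, smul_zero]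
          · rw [← hm, ← mul_smul (of k α), of_mul_of_ne _ _ _ (Ne.symm hx), zero_smul,
              smul_zero] }
  have hN (m : M) : of k (𝟙 y) • m ∈ N := by
    change of k (𝟙 y) • of k (𝟙 y) • m = _
    rw [← mul_smul, of_id_mul_of]
  refine ⟨y, N, ⟨fun m => Subtype.ext m.2, fun α hz m => Subtype.ext (hzero α hz m)⟩, hN, ?_⟩
  intro h
  exact hm₀ ((Submodule.mem_bot _).1 (h ▸ hN m₀))

variable [∀ x y : E, Finite (x ⟶ y)] [∀ y : E, Fintype (Aut y)]
  {n : ℕ} {e : Fin n → CategoryAlgebra k E} {ob : Fin n → E}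
include L

/-- A projective module over a group algebra contains the projective cover of each of its simple
quotients. Here `kE_0 e_l` plays the role of that cover, and the locality of the corner ring of
`e_l` replaces uniqueness of covers. -/
lemma exists_injective_degreeZeroPart (hs : Skeletal E) (hEI : ∀ (x : E) (f : x ⟶ x), IsIso f)
    (he : CompleteOrthogonalIdempotents e) (hprim : ∀ l, IsPrimitiveIdempotent (e l))
    (hob : ∀ l, of k (𝟙 (ob l)) * e l = e l ∧ e l * of k (𝟙 (ob l)) = e l)
    {y : E} (hM : IsConcentratedAt k y M) [IsNoetherian (CategoryAlgebra k E) M] [Nontrivial M]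
    (hproj : IsProjectiveAt k y M) :
    ∃ (l : Fin n) (φ : degreeZeroPart (e l) →ₗ[CategoryAlgebra k E] M), ob l = y ∧
      Function.Injective φ := by
  have : IsArtinian (CategoryAlgebra k E) (CategoryAlgebra k E) :=
    IsArtinianRing.of_finite k (CategoryAlgebra k E)
  have : IsNoetherian (CategoryAlgebra k E) (CategoryAlgebra k E) :=
    IsNoetherianRing.of_finite k (CategoryAlgebra k E)
  obtain ⟨C, hC, -⟩ := (eq_top_or_exists_le_coatom
    (⊥ : Submodule (CategoryAlgebra k E) M)).resolve_left bot_ne_top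
  obtain ⟨m₀, -, hm₀⟩ := SetLike.exists_of_lt hC.lt_top
  obtain ⟨l, hl, ht⟩ := exists_smul_ne_zero_of_id_smul he (fun l => (hob l).1) C (y := y)
    (d := m₀) (by rwa [hM.id_smul])
  set t := e l • m₀ with ht'
  have het : e l • t = t := by rw [ht', ← mul_smul, he.idem l]
  have hJM (a : CategoryAlgebra k E) (ha : a ∈ positivePart (lengthGrading k E)) (m : M) :
      a • m = 0 := by
    refine L.positivePart_induction (motive := fun a => a • m = 0) (zero_smul _ _)
      (fun a b ha hb => by rw [add_smul, ha, hb, add_zero]) (fun c x z α hα => ?_) ha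
    rw [smul_assoc, hM.smul_eq_zero_of_ne, smul_zero]
    rintro ⟨rfl, rfl⟩
    exact hα ((L.len_eq_zero_iff α).2 (hEI _ α))
  set J := positivePart (lengthGrading k E)
  let g : degreeZeroPart (e l) := ⟨J.mkQ (e l), Submodule.mem_span_singleton_self _⟩
  have hgen (x : degreeZeroPart (e l)) : ∃ a : CategoryAlgebra k E, a • g = x := by
    obtain ⟨a, ha⟩ := Submodule.mem_span_singleton.1 x.2
    exact ⟨a, Subtype.ext ha⟩
  have heg : e l • g = g := Subtype.ext (by
    change e l • J.mkQ (e l) = J.mkQ (e l)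
    rw [← map_smul, smul_eq_mul, he.idem l])
  obtain ⟨φ, hφ⟩ : ∃ φ : degreeZeroPart (e l) →ₗ[CategoryAlgebra k E] M, φ g = t := by
    refine ⟨J.liftQ (LinearMap.toSpanSingleton _ _ t) (fun a ha => hJM a ha t) ∘ₗ
      Submodule.subtype _, ?_⟩
    exact het
  have hsurj : Function.Surjective (C.mkQ ∘ₗ φ) := by
    have hsup : C ⊔ LinearMap.range φ = ⊤ := by
      refine hC.2 _ (left_lt_sup.2 fun h => ht (h ⟨g, hφ⟩))
    intro x
    obtain ⟨m, rfl⟩ := C.mkQ_surjective x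
    obtain ⟨c, hc, _, ⟨d, rfl⟩, hcd⟩ := Submodule.mem_sup.1
      (show m ∈ C ⊔ LinearMap.range φ from hsup ▸ trivial)
    refine ⟨d, ?_⟩
    have hc0 : C.mkQ c = 0 := (Submodule.Quotient.mk_eq_zero C).2 hc
    rw [LinearMap.comp_apply, ← hcd, map_add, hc0, zero_add]
  obtain ⟨σ, hσ⟩ := ((C.mkQ ∘ₗ φ).restrictScalars k).exists_rightInverse_of_surjective
    (LinearMap.range_eq_top.2 hsurj)
  obtain ⟨θ, hθ⟩ := hproj
  -- Projectivity of `M` lifts `M → M ⧸ C` through the surjection from `kE_0 e_l`: average `σ ∘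
  -- C.mkQ ∘ θ`, where `σ` is a merely linear section.
  obtain ⟨ψ, hψ⟩ := hM.exists_linearMap L hEI hs (N := degreeZeroPart (e l))
    (fun a ha n => Subtype.ext (L.smul_degreeZeroModule_eq_zero ha n.1))
    (relTrace_isEquivariantAt (y := y) (σ ∘ₗ C.mkQ.restrictScalars k ∘ₗ θ))
    (fun m => of_id_smul_relTrace _ m)
  have hρψ (m : M) : C.mkQ (φ (ψ m)) = C.mkQ m := by
    have h1 := relTrace_comp (y := y) (IsEquivariantAt.of_linearMap (k := k) (C.mkQ ∘ₗ φ))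
      (IsEquivariantAt.id (M := M)) (σ ∘ₗ C.mkQ.restrictScalars k ∘ₗ θ) m
    have h2 := relTrace_comp (y := y) (IsEquivariantAt.of_linearMap (k := k) C.mkQ)
      (IsEquivariantAt.id (M := M)) θ m
    have h3 : (C.mkQ ∘ₗ φ).restrictScalars k ∘ₗ (σ ∘ₗ C.mkQ.restrictScalars k ∘ₗ θ) ∘ₗ
        LinearMap.id = C.mkQ.restrictScalars k ∘ₗ θ ∘ₗ LinearMap.id := by
      rw [LinearMap.comp_id, LinearMap.comp_id, ← LinearMap.comp_assoc, hσ, LinearMap.id_comp]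
    rw [h3, h2, hθ, LinearMap.id_apply, hM.id_smul, ← hψ] at h1
    exact h1.symm
  refine ⟨l, φ, hl, ?_⟩
  -- All powers of `ψ ∘ φ` keep the image of the generator equal to the class of `t` modulo `C`,
  -- which is nonzero; this excludes nilpotence.
  rcases (hprim l).nilpotent_or_injective hgen heg (ψ ∘ₗ φ) with ⟨N, hN⟩ | hinj
  · exfalso
    have hpow (i : ℕ) : C.mkQ (φ (((ψ ∘ₗ φ : Module.End _ _) ^ i) g)) = C.mkQ t := by
      induction i with
      | zero => rw [pow_zero, Module.End.one_apply, hφ]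
      | succ i ih => rw [pow_succ', Module.End.mul_apply, LinearMap.comp_apply, hρψ, ih]
    have h1 := hpow N
    rw [hN, LinearMap.zero_apply, map_zero, map_zero] at h1
    exact ht ((Submodule.Quotient.mk_eq_zero C).1 h1.symm)
  · exact fun a b hab => hinj (by rw [LinearMap.comp_apply, hab, LinearMap.comp_apply])

/-- Induction on dimension: a copy of some `kE_0 e_l` embeds in the component at a maximal object of
the support. It is projective at every object, so by `IsProjectiveAt.of_quotient` the quotient
satisfies the same hypotheses. -/
theorem hasFiltration_of_isProjectiveAt (hs : Skeletal E) (hEI : ∀ (x : E) (f : x ⟶ x), IsIso f)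
    (he : CompleteOrthogonalIdempotents e) (hprim : ∀ l, IsPrimitiveIdempotent (e l))
    (hob : ∀ l, of k (𝟙 (ob l)) * e l = e l ∧ e l * of k (𝟙 (ob l)) = e l)
    (s : Set E) (d : ℕ) :
    ∀ (M : Type (max u v w)) [AddCommGroup M] [Module k M] [Module (CategoryAlgebra k E) M]
      [IsScalarTower k (CategoryAlgebra k E) M] [Module.Finite k M], Module.finrank k M ≤ d →
      (∀ z ∉ s, ∀ m : M, of k (𝟙 z) • m = 0) → (∀ y : E, IsProjectiveAt k y M) →
      HasFiltration (fun l => ModuleCat.of (CategoryAlgebra k E) (degreeZeroPart (e l))) (fun l => ob l ∈ s) M := by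
  induction d with
  | zero =>
    intro M _ _ _ _ _ hd _ _
    have := Module.finrank_zero_iff.1 (Nat.le_zero.1 hd)
    exact .of_subsingleton _ _ M
  | succ d ih =>
    intro M _ _ _ _ _ hd hsM hproj
    rcases subsingleton_or_nontrivial M with h | h
    · exact .of_subsingleton _ _ M
    have : IsNoetherian (CategoryAlgebra k E) M :=
      isNoetherian_of_tower k inferInstance
    obtain ⟨y, N, hN, hyN, hne⟩ := L.exists_isConcentratedAt_submodule k M hs hEI
    have hnt : Nontrivial N := (Submodule.nontrivial_iff_ne_bot).2 hne
    have hNproj : IsProjectiveAt k y N := by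
      refine (hproj y).of_retract (y := y)
        (q := (((Algebra.lsmul k k M (of k (𝟙 y))).codRestrict (N.restrictScalars k) hyN :
          M →ₗ[k] N.restrictScalars k) : M →ₗ[k] N)) (fun g m => Subtype.ext ?_)
        (.of_linearMap N.subtype) (fun n => Subtype.ext ?_)
      · exact IsEquivariantAt.lsmul_id g m
      · change of k (𝟙 y) • of k (𝟙 y) • (n : M) = of k (𝟙 y) • (n : M)
        rw [← mul_smul, of_id_mul_of]
    obtain ⟨l, φ, rfl, hφ⟩ :=
      L.exists_injective_degreeZeroPart hs hEI he hprim hob hN hNproj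
    have hj : Function.Injective (N.subtype ∘ₗ φ) := N.injective_subtype.comp hφ
    refine .of_injective (Δ := fun l => ModuleCat.of (CategoryAlgebra k E) (degreeZeroPart (e l))) (μ := l) ?_
      (N.subtype ∘ₗ φ) hj ?_
    · by_contra hl
      obtain ⟨n, hn⟩ := exists_ne (0 : N)
      refine hn (Subtype.ext ?_)
      have := congrArg Subtype.val (hN.id_smul n)
      rw [← this]
      exact hsM _ hl n
    · refine ih _ ?_ (fun z hz m => ?_) fun z => ?_
      · have hlt : Module.finrank k (M ⧸ (LinearMap.range (N.subtype ∘ₗ φ)).restrictScalars k) +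
            Module.finrank k ((LinearMap.range (N.subtype ∘ₗ φ)).restrictScalars k) =
              Module.finrank k M := Submodule.finrank_quotient_add_finrank _
        have hpos : 0 < Module.finrank k
            ((LinearMap.range (N.subtype ∘ₗ φ)).restrictScalars k) := by
          -- The corner at an object consists of elements of degree zero, so `e l` survives modulo
          -- `J` and the dimension really drops.
          have hel : (positivePart (lengthGrading k E)).mkQ (e l) ≠ 0 := fun h0 => by
            have h1 := L.proj_zero_corner hEI (ob l) (e l)
            rw [(hob l).1, (hob l).2, (L.mkQ_eq_zero_iff _).1 h0] at h1
            exact (hprim l).1 h1.symm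
          let g : degreeZeroPart (e l) := ⟨_, Submodule.mem_span_singleton_self _⟩
          have : Nontrivial ((LinearMap.range (N.subtype ∘ₗ φ)).restrictScalars k) :=
            ⟨⟨_, g, rfl⟩, 0, fun h0 => hel (congrArg Subtype.val (hj.eq_iff' (map_zero _) |>.1
              (congrArg Subtype.val h0) : g = 0))⟩
          exact Module.finrank_pos
        have heq : Module.finrank k (M ⧸ LinearMap.range (N.subtype ∘ₗ φ)) =
          Module.finrank k (M ⧸ (LinearMap.range (N.subtype ∘ₗ φ)).restrictScalars k) := rfl
        omega
      · obtain ⟨m, rfl⟩ := Submodule.mkQ_surjective _ m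
        rw [← map_smul, hsM z hz, map_zero]
      · exact .of_quotient (L.isProjectiveAt_degreeZeroPart hs hEI (he.idem l) z) (hproj z)
          (N.subtype ∘ₗ φ) (Submodule.mkQ _) hj (Submodule.mkQ_surjective _)
          (LinearMap.exact_map_mkQ_range _)

end LengthFunction

end CategoryTheory

lemma HasFiltration.mono {A : Type w} [Ring A] {Λ : Type*} {Δ : Λ → ModuleCat.{w} A}
    {p q : Λ → Prop} {K : Type w} [AddCommGroup K] [Module A K] (h : HasFiltration Δ p K)
    (hpq : ∀ l, p l → q l) : HasFiltration Δ q K := by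
  obtain ⟨n, F, h0, hn, hF⟩ := h
  exact ⟨n, F, h0, hn, fun i hi => ⟨(hF i hi).1, (hF i hi).2.imp fun μ hμ => ⟨hpq μ hμ.1, hμ.2⟩⟩⟩

namespace CategoryTheory.LengthFunction

open CategoryAlgebra

variable {k : Type w} [Field k] {E : Type u} [Category.{v} E] [Finite E] (L : LengthFunction E)
  [∀ x y : E, Finite (x ⟶ y)] [∀ y : E, Fintype (Aut y)]
include L

lemma not_isCompositionFactor_degreeZeroPart (hs : Skeletal E) {e f : CategoryAlgebra k E}
    {x y : E} (hxy : x ≠ y) (he : e * of k (𝟙 x) = e) (hf : of k (𝟙 y) * f = f)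
    (hprim : IsPrimitiveIdempotent f) :
    ¬ IsCompositionFactor (A := CategoryAlgebra k E) (idempotentSimple f) (degreeZeroPart e) := by
  have : IsNoetherian (CategoryAlgebra k E) (CategoryAlgebra k E) :=
    IsNoetherianRing.of_finite k (CategoryAlgebra k E)
  intro h
  obtain ⟨d, hd⟩ := h.exists_smul_ne_zero hprim
  refine hd (Subtype.ext ?_)
  obtain ⟨b, hb⟩ := Submodule.mem_span_singleton.1 d.2
  change f • (d : DegreeZeroModule (lengthGrading k E)) = 0
  rw [← hb, ← map_smul, ← map_smul, L.mkQ_eq_zero_iff, smul_eq_mul, smul_eq_mul, ← he, ← hf,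
    ← mul_assoc b, mul_assoc, ← mul_assoc f, ← mul_assoc, ← mul_assoc f]
  exact L.proj_zero_off_diagonal hs hxy _

/-- The standard modules are `kE_0 e_l`, and the kernel of `P_l → Δ_l` is the part of `P_l` strictly
above `ob l`. It inherits projectivity at every object from `P_l`, so it is filtered by standard
modules with strictly larger index. -/
theorem isStandardlyStratified_of_isProjectiveAt (hs : Skeletal E)
    (hEI : ∀ (x : E) (f : x ⟶ x), IsIso f)
    (h : ∀ y : E, IsProjectiveAt k y (CategoryAlgebra k E)) : IsStandardlyStratified k E := by
  obtain ⟨n, e, ob, he, hprim, hob⟩ := exists_primitiveIdempotents_at_objects k E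
  refine ⟨n, e, ob, he, hprim, hob,
    fun l => ModuleCat.of (CategoryAlgebra k E) (degreeZeroPart (e l)), fun l m hlm => ?_,
    fun l => ?_⟩
  · refine L.not_isCompositionFactor_degreeZeroPart hs (fun hlm' => ?_) (hob l).2 (hob m).1
      (hprim m)
    exact hlm ⟨eqToHom hlm'.symm⟩
  set P := idempotentProjective (e l) with hP
  have hPmul (a : P) : (a : CategoryAlgebra k E) * e l = a :=
    mul_eq_self_of_idempotentProjective (he.idem l) a
  have hPob (a : P) : (a : CategoryAlgebra k E) * of k (𝟙 (ob l)) = a :=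
    mul_eq_self_of_idempotentProjective (hob l).2 a
  set J := positivePart (lengthGrading k E)
  have hmem (a : P) : (J.mkQ ∘ₗ P.subtype) a ∈ degreeZeroPart (e l) := by
    change J.mkQ (a : CategoryAlgebra k E) ∈ degreeZeroPart (e l)
    rw [← hPmul a, ← smul_eq_mul, map_smul]
    exact Submodule.smul_mem _ _ (Submodule.mem_span_singleton_self _)
  let π : P →ₗ[CategoryAlgebra k E] degreeZeroPart (e l) := (J.mkQ ∘ₗ P.subtype).codRestrict _ hmem
  have hπ (a : P) : π a = 0 ↔ L.proj k 0 (a : CategoryAlgebra k E) = 0 := by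
    rw [← L.mkQ_eq_zero_iff, ← Subtype.coe_inj]
    rfl
  refine ⟨π, fun d => ?_, ?_⟩
  · obtain ⟨b, hb⟩ := Submodule.mem_span_singleton.1 d.2
    refine ⟨⟨b • e l, Submodule.smul_mem _ _ (Submodule.mem_span_singleton_self _)⟩,
      Subtype.ext ?_⟩
    rw [← hb, ← map_smul]
    rfl
  have hsupp (z : E) (hz : ¬ (Nonempty (ob l ⟶ z) ∧ z ≠ ob l)) (m : LinearMap.ker π) :
      of k (𝟙 z) • m = 0 := by
    refine Subtype.ext (Subtype.ext ?_)
    change of k (𝟙 z) * (m : P).1 = 0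
    rw [← hPob, ← mul_assoc]
    by_cases hz' : z = ob l
    · subst hz'
      rw [← L.proj_zero_corner hEI, mul_assoc, hPob, proj_zero_mul, (hπ _).1 m.2, mul_zero]
    · exact id_mul_mul_id_eq_zero (not_nonempty_iff.1 fun hne => hz ⟨hne, hz'⟩) _
  have hPproj (y : E) : IsProjectiveAt k y P := by
    refine (h y).of_retract_linear ((LinearMap.toSpanSingleton _ _ (e l)).codRestrict P fun a =>
      Submodule.smul_mem _ a (Submodule.mem_span_singleton_self _)) P.subtype fun a => ?_
    exact Subtype.ext (hPmul a)
  -- The component of the kernel at `y` is zero for `y = ob l`, and otherwise it is the full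
  -- component of `P_l`.
  have hproj (y : E) : IsProjectiveAt k y (LinearMap.ker π) := by
    by_cases hy : y = ob l
    · exact .of_smul_eq_zero (hsupp y fun h => h.2 hy)
    have hy0 (a : P) : of k (𝟙 y) • a ∈ LinearMap.ker π := by
      rw [LinearMap.mem_ker, hπ]
      change L.proj k 0 (of k (𝟙 y) * (a : CategoryAlgebra k E)) = 0
      rw [← hPob, ← mul_assoc]
      exact L.proj_zero_off_diagonal hs (Ne.symm hy) _
    refine (hPproj y).of_retract (y := y)
      (q := (((Algebra.lsmul k k P (of k (𝟙 y))).codRestrict ((LinearMap.ker π).restrictScalars k)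
        hy0 : P →ₗ[k] (LinearMap.ker π).restrictScalars k) : P →ₗ[k] LinearMap.ker π))
      (fun g m => Subtype.ext ?_) (.of_linearMap (LinearMap.ker π).subtype)
      (fun m => Subtype.ext ?_)
    · exact IsEquivariantAt.lsmul_id g m
    · change of k (𝟙 y) • of k (𝟙 y) • (m : P) = of k (𝟙 y) • (m : P)
      rw [← mul_smul, of_id_mul_of]
  have hfin : Module.Finite k (LinearMap.ker π) := by
    have : IsNoetherian k (CategoryAlgebra k E) := inferInstance
    have : IsNoetherian k P := isNoetherian_submodule' (P.restrictScalars k)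
    exact Module.IsNoetherian.finite k ((LinearMap.ker π).restrictScalars k)
  refine (L.hasFiltration_of_isProjectiveAt hs hEI he hprim hob
    {z | Nonempty (ob l ⟶ z) ∧ z ≠ ob l} _ (LinearMap.ker π) le_rfl
    (fun z hz => hsupp z fun h => hz h) hproj).mono ?_
  exact fun m ⟨⟨f⟩, hne⟩ => ⟨⟨f⟩, fun ⟨g⟩ => hne (L.eq_of_hom_of_hom hs hEI g f)⟩

end CategoryTheory.LengthFunction

theorem theorem4p3p4 (k : Type w) [Field k] [IsAlgClosed k]
    (E : Type u) [Category.{v} E] [Finite E] (hE : IsFiniteFreeEI E) :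
    List.TFAE [
      projectiveDimension (ModuleCat.of (CategoryAlgebra k E)
        (DegreeZeroModule (CategoryAlgebra.lengthGrading k E))) ≤ 1,
      IsKoszulAlgebra (CategoryAlgebra.lengthGrading k E),
      IsStandardlyStratified k E,
      projectiveDimension (ModuleCat.of (CategoryAlgebra k E)
        (DegreeZeroModule (CategoryAlgebra.lengthGrading k E))) < ⊤] := by
  have := hE.finite_hom
  have hs := hE.skeletal
  have hEI := hE.isIso
  have (y : E) : Fintype (Aut y) :=
    have : Finite (Aut y) := Finite.of_injective (fun g : Aut y => g.hom) fun _ _ h => Iso.ext h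
    Fintype.ofFinite _
  obtain ⟨L⟩ := hE.nonempty_lengthFunction
  -- Projectivity in degree one is the hub: conditions 2 and 3 both return to condition 1 through
  -- it, with `0 → J → kE → kE_0 → 0` as the resolution.
  have hpd (h : L.DegreeOneProjective k) : projectiveDimension (ModuleCat.of (CategoryAlgebra k E)
      (DegreeZeroModule (CategoryAlgebra.lengthGrading k E))) ≤ 1 := by
    have := h.projective_positivePart hs
    refine (projectiveDimension_le_iff _ 1).2 ?_
    have : Module.Projective (CategoryAlgebra k E) (LinearMap.ker
        (positivePart (CategoryAlgebra.lengthGrading k E)).mkQ) := by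
      rwa [Submodule.ker_mkQ]
    exact hasProjectiveDimensionLT_of_ker (positivePart (CategoryAlgebra.lengthGrading k E)).mkQ
      (Submodule.mkQ_surjective _)
  tfae_have 1 → 4 := fun h => h.trans_lt (by decide)
  tfae_have 4 → 3 := fun h => L.isStandardlyStratified_of_isProjectiveAt hs hEI
    (L.isProjectiveAt_of_projectiveDimension hs hEI h)
  tfae_have 3 → 1 := fun h => hpd (L.degreeOneProjective_of_isProjectiveAt
    (L.isProjectiveAt_of_isStandardlyStratified hs hEI h))
  tfae_have 4 → 2 := fun h => by
    have := (L.degreeOneProjective_of_isProjectiveAt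
      (L.isProjectiveAt_of_projectiveDimension hs hEI h)).projective_positivePart hs
    exact L.isKoszulAlgebra
  tfae_have 2 → 1 := fun h => hpd (L.degreeOneProjective_of_isKoszulAlgebra hs hEI h)
  tfae_finish
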